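/- **Setting.** Let $L$ and $\mathbf L$ be separable real Hilbert spaces, let $H_G\subset L$ be a dense subspace and $G:H_G\to\mathbf L$ a linear operator with closed graph such that $\|u\|_L\le C_P\|Gu\|_{\mathbf L}$ for all $u\in H_G$ and some $C_P$; equip $H_G$ with the norm $\|G\cdot\|_{\mathbf L}$, and embed $L$ into $H_G'$ by $y\mapsto\langle y,\cdot\rangle_L$. Let $H_D$ be the set of $v\in\mathbf L$ for which there is a (unique) $Dv\in L$ with $\langle v,Gu\rangle_{\mathbf L}+\langle Dv,u\rangle_L=0$ for all $u\in H_G$, with the graph norm; for general $v\in\mathbf L$, $Dv\in H_G'$ denotes $-\langle v,G\,\cdot\rangle_{\mathbf L}$. Let $T>0$; $L^2(Z)$ stands for $L^2(0,T;Z)$. Let $W$ be the set of $u\in L^2(H_G)$ for which there is $C\ge0$ with $\langle u,v'\rangle_{L^2(L)}\le C\|v\|_{L^2(H_G)}$ for all $v\in C^1_c((0,T);H_G)$, and let $u'\in L^2(H_G')$ be the weak derivative of $u\in W$; for $t\in[0,T]$, $u(t)\in L$ is the value of the representative of $u$ in $C([0,T];L)$. Let $\mathfrak S$ be a bounded symmetric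 positive operator on $\mathbf L$ with bounded inverse, and let $R:H_G'\to H_G$ be given by $\langle\mathfrak S GR\xi,Gv\rangle_{\mathbf L}=\langle\xi,v\rangle_{H_G',H_G}$ for all $v\in H_G$. Let $\Lambda(t)$, $t\in(0,T)$, be bounded linear operators on $\mathbf L$ such that $t\mapsto\Lambda(t)\xi$ is measurable for each $\xi\in\mathbf L$ and $\|\mathfrak S^{-1}\Lambda(t)\|\le M$ for a.e. $t$, for some $M$. **Discretisation.** A gradient discretisation $(X_h,P_h,G_h)$ consists of a finite-dimensional real vector space $X_h$ and linear maps $P_h:X_h\to L$, $G_h:X_h\to\mathbf L$ such that $\|G_h\cdot\|_{\mathbf L}$ is a norm on $X_h$. Define $R_h:X_h\to X_h$ by $\langle\mathfrak S G_hR_hu,G_hv\rangle_{\mathbf L}=\langle P_hu,P_hv\rangle_L$ for all $v\in X_h$, and, for $\varphi\in H_G$ and $\psi\in H_D$, $$\sigma_h(\varphi)=\inf_{v\in X_h}\bigl(\|P_hv-\varphi\|_L^2+\|G_hv-G\varphi\|_{\mathbf L}^2\bigr)^{1/2},\qquad \zeta_h(\psi)=\sup_{v\in X_h\setminus\{0\}}\frac{|\langle\psi,G_hv\rangle_{\mathbf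 L}+\langle D\psi,P_hv\rangle_L|}{\|\mathfrak S^{1/2}G_hv\|_{\mathbf L}}.$$ Given $N\ge1$ and $k=T/N$, let $W_h$ be the set of functions $w:[0,T]\to X_h$ with $w(0)=w^{(0)}$ and $w=w^{(m)}$ on $((m-1)k,mk]$ for some $w^{(0)},\dots,w^{(N)}\in X_h$, with $\partial w=(w^{(m)}-w^{(m-1)})/k$ on $((m-1)k,mk)$, and let $V_h$ be the set of (a.e. defined) functions $(0,T)\to X_h$ that are constant on each $((m-1)k,mk)$, $m=1,\dots,N$. For $u\in W$, $w\in W_h$ and $\varphi\in L^2(H_D)$ set $$\delta^{(T)}_h(u,w)=\|\mathfrak S^{1/2}(GRu'-G_hR_h\partial w)\|_{L^2(\mathbf L)}+\|\mathfrak S^{-1/2}\Lambda(Gu-G_hw)\|_{L^2(\mathbf L)}+\sup_{t\in[0,T]}\|u(t)-P_hw(t)\|_L,$$ $$\zeta^{(T)}_h(\varphi)=\sup_{v\in V_h\setminus\{0\}}\frac{|\langle\varphi,G_hv\rangle_{L^2(\mathbf L)}+\langle D\varphi,P_hv\rangle_{L^2(L)}|}{\|\mathfrak S^{1/2}G_hv\|_{L^2(\mathbf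 L)}}.$$ (Suprema over the empty set are $0$.) **Theorem 5.1.** Let $(X_{h_n},P_{h_n},G_{h_n})_{n\in\mathbb N}$ be gradient discretisations that are consistent, i.e. $\sigma_{h_n}(\varphi)\to0$ for every $\varphi\in H_G$, and limit-conforming, i.e. $\zeta_{h_n}(\psi)\to0$ for every $\psi\in H_D$. Let $N_n\ge1$ be integers with $N_n\to\infty$, and use the time steps $k_n=T/N_n$. Then: 1. $\zeta^{(T)}_{h_n}(\varphi)\to0$ for every $\varphi\in L^2(0,T;H_D)$. 2. $\inf_{v\in W_{h_n}}\delta^{(T)}_{h_n}(w,v)\to0$ for every $w\in W$. 3. Assume moreover that there is $\alpha>0$ such that $\langle\Lambda(t)\xi,\xi\rangle_{\mathbf L}\ge\alpha\langle\mathfrak S\xi,\xi\rangle_{\mathbf L}$ for a.e. $t\in(0,T)$ and all $\xi\in\mathbf L$. Let $\Phi:L\to L$ be linear with $\|\Phi y\|_L\le\|y\|_L$ for all $y$, let $f\in L^2(0,T;L)$, $\mathbf F\in L^2(0,T;\mathbf L)$, $\xi_0\in L$, and let $u\in W$ solve $$u'-D(\Lambda Gu+\mathbf F)=f\ \text{ in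 }L^2(0,T;H_G'),\qquad u(0)-\Phi u(T)=\xi_0.$$ For each $n$, let $w_{h_n}\in W_{h_n}$ be a solution of the implicit Euler scheme, that is, with $h=h_n$, $k=k_n$, $N=N_n$, and with $\Lambda^{(m)},f^{(m)},\mathbf F^{(m)}$ the mean values over $((m-1)k,mk)$: for all $z\in X_h$ and $m=1,\dots,N$, $$\langle P_hw^{(0)}-\Phi P_hw^{(N)},P_hz\rangle_L=\langle\xi_0,P_hz\rangle_L,$$ $$\Bigl\langle P_h\tfrac{w^{(m)}-w^{(m-1)}}k,P_hz\Bigr\rangle_L+\langle\Lambda^{(m)}G_hw^{(m)},G_hz\rangle_{\mathbf L}=\langle f^{(m)},P_hz\rangle_L-\langle\mathbf F^{(m)},G_hz\rangle_{\mathbf L}.$$ Then $\delta^{(T)}_{h_n}(u,w_{h_n})\to0$. -/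

import Mathlib

open MeasureTheory Filter Topology Set
open scoped RealInnerProductSpace ENNReal NNReal

noncomputable section

namespace ParabolicGDM

universe v

section Continuous

variable {L E : Type*} [NormedAddCommGroup L] [InnerProductSpace ℝ L]
  [NormedAddCommGroup E] [InnerProductSpace ℝ E]

/-- A densely defined closed linear operator `op : H_G ⊆ L → E` such that the Poincaré inequality
`‖u‖ ≤ C ‖op u‖` holds on its domain `H_G`. -/
structure GradientOperator (L E : Type*) [NormedAddCommGroup L] [InnerProductSpace ℝ L]
    [NormedAddCommGroup E] [InnerProductSpace ℝ E] where
  op : L →ₗ.[ℝ] E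
  dense_domain : Dense (op.domain : Set L)
  closed_graph : op.IsClosed
  poincare : ∃ C : ℝ, ∀ x : op.domain, ‖(x : L)‖ ≤ C * ‖op x‖

namespace GradientOperator

/-- The domain `H_G` as a type of its own (it gets the inner product `⟪G u, G v⟫`,
not the one of `L`). -/
def Space (G : GradientOperator L E) : Type _ := G.op.domain

instance (G : GradientOperator L E) : AddCommGroup G.Space :=
  inferInstanceAs (AddCommGroup G.op.domain)

instance (G : GradientOperator L E) : Module ℝ G.Space :=
  inferInstanceAs (Module ℝ G.op.domain)

/-- The inclusion `H_G → L` as a linear map. -/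
def inclₗ (G : GradientOperator L E) : G.Space →ₗ[ℝ] L := G.op.domain.subtype

/-- The operator `G : H_G → E` as a linear map. -/
def gradₗ (G : GradientOperator L E) : G.Space →ₗ[ℝ] E := G.op.toFun

theorem norm_inclₗ_le (G : GradientOperator L E) :
    ∃ C : ℝ, ∀ x : G.Space, ‖G.inclₗ x‖ ≤ C * ‖G.gradₗ x‖ := G.poincare

theorem inclₗ_injective (G : GradientOperator L E) : Function.Injective G.inclₗ :=
  Subtype.val_injective

/-- The inner product `⟪G u, G v⟫` on `H_G`; it is definite by the Poincaré inequality. -/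
@[reducible] def core (G : GradientOperator L E) : InnerProductSpace.Core ℝ G.Space where
  inner x y := ⟪G.gradₗ x, G.gradₗ y⟫
  conj_inner_symm x y := by simp [real_inner_comm]
  re_inner_nonneg x := by simp
  add_left x y z := by simp [inner_add_left]
  smul_left x y r := by simp [inner_smul_left]
  definite x hx := by
    obtain ⟨C, hC⟩ := G.norm_inclₗ_le
    have h0 : G.gradₗ x = 0 := inner_self_eq_zero.mp hx
    have h1 := hC x
    rw [h0, norm_zero, mul_zero] at h1
    apply G.inclₗ_injective
    rw [map_zero]
    exact norm_le_zero_iff.mp h1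

instance (G : GradientOperator L E) : NormedAddCommGroup G.Space :=
  @InnerProductSpace.Core.toNormedAddCommGroup ℝ G.Space _ _ _ G.core

instance (G : GradientOperator L E) : InnerProductSpace ℝ G.Space :=
  InnerProductSpace.ofCore G.core.toCore

theorem inner_def (G : GradientOperator L E) (x y : G.Space) :
    ⟪x, y⟫ = ⟪G.gradₗ x, G.gradₗ y⟫ := rfl

theorem norm_def (G : GradientOperator L E) (x : G.Space) : ‖x‖ = ‖G.gradₗ x‖ := by
  rw [@norm_eq_sqrt_real_inner G.Space, @norm_eq_sqrt_real_inner E, inner_def]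

/-- The continuous inclusion `H_G → L`. -/
def incl (G : GradientOperator L E) : G.Space →L[ℝ] L :=
  G.inclₗ.mkContinuousOfExistsBound (by
    obtain ⟨C, hC⟩ := G.norm_inclₗ_le
    exact ⟨C, fun x => by rw [norm_def]; exact hC x⟩)

/-- The operator `G : H_G → E` as a bounded operator. -/
def grad (G : GradientOperator L E) : G.Space →L[ℝ] E :=
  G.gradₗ.mkContinuous 1 (fun x => by rw [norm_def, one_mul])

@[simp] theorem incl_apply (G : GradientOperator L E) (x : G.Space) : G.incl x = G.inclₗ x := rfl

@[simp] theorem grad_apply (G : GradientOperator L E) (x : G.Space) : G.grad x = G.gradₗ x := rfl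

/-- `w` is a divergence of `v`: `⟪v, G u⟫ + ⟪w, u⟫ = 0` for all `u ∈ H_G`. -/
def IsDiv (G : GradientOperator L E) (v : E) (w : L) : Prop :=
  ∀ x : G.Space, ⟪v, G.grad x⟫ + ⟪w, G.incl x⟫ = 0

/-- The space `H_D` of the elements of `E` that have a divergence in `L`. -/
def HD (G : GradientOperator L E) : Set E := {v | ∃ w, G.IsDiv v w}

open Classical in
/-- The divergence operator `D : H_D → L` (extended by `0` outside `H_D`). -/
def div (G : GradientOperator L E) (v : E) : L :=
  if h : ∃ w, G.IsDiv v w then h.choose else 0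

theorem isDiv_div (G : GradientOperator L E) {v : E} (hv : v ∈ G.HD) : G.IsDiv v (G.div v) := by
  have h : ∃ w, G.IsDiv v w := hv
  rw [div, dif_pos h]
  exact h.choose_spec

theorem IsDiv.unique {G : GradientOperator L E} {v : E} {w w' : L}
    (h : G.IsDiv v w) (h' : G.IsDiv v w') : w = w' := by
  apply G.dense_domain.eq_of_inner_left (𝕜 := ℝ)
  intro x hx
  have h1 : _ + ⟪w, x⟫ = 0 := h (⟨x, hx⟩ : G.op.domain)
  have h2 : _ + ⟪w', x⟫ = 0 := h' (⟨x, hx⟩ : G.op.domain)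
  linarith

/-- The embedding of `L` into the dual space of `H_G`: `y ↦ ⟪y, ·⟫_L`. -/
def embedDual (G : GradientOperator L E) (y : L) : StrongDual ℝ G.Space :=
  (innerSL ℝ y).comp G.incl

/-- The divergence of an arbitrary element of `E`, as an element of the dual space of `H_G`:
`v ↦ -⟪v, G ·⟫_E`. -/
def divDual (G : GradientOperator L E) (v : E) : StrongDual ℝ G.Space :=
  -((innerSL ℝ v).comp G.grad)

open Classical in
/-- The Riesz operator `R` of `H_G` weighted by `S`, from the dual space of `H_G` to `H_G`:
`⟪S (G (R ξ)), G x⟫ = ξ x` for all `x ∈ H_G` (see `inner_riesz`). -/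
def riesz (G : GradientOperator L E) (S : E ≃L[ℝ] E) (ξ : StrongDual ℝ G.Space) : G.Space :=
  if h : ∃ r : G.Space, ∀ x : G.Space, ⟪S (G.grad r), G.grad x⟫ = ξ x then h.choose else 0

end GradientOperator

/-- The weighted norm `√⟪S ξ, ξ⟫` of a positive operator `S`. It is the norm `‖S^{1/2} ξ‖`
(see `weightedNorm_eq`). -/
def weightedNorm (S : E →L[ℝ] E) (ξ : E) : ℝ := √⟪S ξ, ξ⟫

theorem weightedNorm_eq {S B : E →L[ℝ] E} (hB : B.IsPositive) (h : B.comp B = S) (ξ : E) :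
    weightedNorm S ξ = ‖B ξ‖ := by
  have h1 : ⟪S ξ, ξ⟫ = ⟪B ξ, B ξ⟫ := by
    rw [← h]
    exact hB.isSymmetric (B ξ) ξ
  rw [weightedNorm, h1, real_inner_self_eq_norm_sq, Real.sqrt_sq (norm_nonneg _)]

theorem coercive_of_isPositive {S : E ≃L[ℝ] E} (hS : (S : E →L[ℝ] E).IsPositive) :
    ∃ c : ℝ, 0 < c ∧ ∀ ξ : E, c * ‖ξ‖ ^ 2 ≤ ⟪S ξ, ξ⟫ := by
  have hsymm : ∀ x y : E, ⟪S x, y⟫ = ⟪x, S y⟫ := fun x y => hS.isSymmetric x y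
  have hpos : ∀ x : E, 0 ≤ ⟪S x, x⟫ := fun x => hS.2 x
  set a : ℝ := ‖(S : E →L[ℝ] E)‖ + 1 with ha
  set b : ℝ := ‖(S.symm : E →L[ℝ] E)‖ + 1 with hb
  have ha0 : 0 < a := by positivity
  have hb0 : 0 < b := by positivity
  refine ⟨1 / (a * b ^ 2), by positivity, fun ξ => ?_⟩
  have h1 : ‖S ξ‖ ^ 2 ≤ a * ⟪S ξ, ξ⟫ := by
    have e := hpos (ξ - a⁻¹ • S ξ)
    have h2 : ⟪S (S ξ), S ξ⟫ ≤ a * ‖S ξ‖ ^ 2 := by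
      calc ⟪S (S ξ), S ξ⟫ ≤ ‖S (S ξ)‖ * ‖S ξ‖ := real_inner_le_norm _ _
        _ ≤ (a * ‖S ξ‖) * ‖S ξ‖ := by
            gcongr
            refine ((S : E →L[ℝ] E).le_opNorm (S ξ)).trans ?_
            gcongr
            linarith
        _ = a * ‖S ξ‖ ^ 2 := by ring
    have h3 : ⟪S (ξ - a⁻¹ • S ξ), ξ - a⁻¹ • S ξ⟫
        = ⟪S ξ, ξ⟫ - 2 * a⁻¹ * ‖S ξ‖ ^ 2 + a⁻¹ ^ 2 * ⟪S (S ξ), S ξ⟫ := by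
      simp only [map_sub, map_smul, inner_sub_left, inner_sub_right, inner_smul_left,
        inner_smul_right, real_inner_self_eq_norm_sq]
      rw [hsymm (S ξ) ξ, real_inner_self_eq_norm_sq]
      simp only [conj_trivial]
      ring
    rw [h3] at e
    have h4 : a⁻¹ ^ 2 * ⟪S (S ξ), S ξ⟫ ≤ a⁻¹ * ‖S ξ‖ ^ 2 := by
      calc a⁻¹ ^ 2 * ⟪S (S ξ), S ξ⟫ ≤ a⁻¹ ^ 2 * (a * ‖S ξ‖ ^ 2) := by gcongr
        _ = a⁻¹ * ‖S ξ‖ ^ 2 := by field_simp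
    have h5 : a⁻¹ * ‖S ξ‖ ^ 2 ≤ ⟪S ξ, ξ⟫ := by linarith
    calc ‖S ξ‖ ^ 2 = a * (a⁻¹ * ‖S ξ‖ ^ 2) := by field_simp
      _ ≤ a * ⟪S ξ, ξ⟫ := by gcongr
  have h6 : ‖ξ‖ ≤ b * ‖S ξ‖ := by
    calc ‖ξ‖ = ‖(S.symm : E →L[ℝ] E) (S ξ)‖ := by simp
      _ ≤ ‖(S.symm : E →L[ℝ] E)‖ * ‖S ξ‖ := ContinuousLinearMap.le_opNorm _ _
      _ ≤ b * ‖S ξ‖ := by gcongr; linarith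
  have h7 : ‖ξ‖ ^ 2 ≤ b ^ 2 * (a * ⟪S ξ, ξ⟫) := by
    calc ‖ξ‖ ^ 2 ≤ (b * ‖S ξ‖) ^ 2 := by gcongr
      _ = b ^ 2 * ‖S ξ‖ ^ 2 := by ring
      _ ≤ b ^ 2 * (a * ⟪S ξ, ξ⟫) := by gcongr
  rw [one_div, inv_mul_le_iff₀ (by positivity)]
  linarith

namespace GradientOperator

instance [CompleteSpace L] [CompleteSpace E] (G : GradientOperator L E) :
    CompleteSpace G.Space := by
  refine Metric.complete_of_cauchySeq_tendsto fun s hs => ?_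
  have h1 : CauchySeq fun n => G.incl (s n) := hs.map G.incl.uniformContinuous
  have h2 : CauchySeq fun n => G.grad (s n) := hs.map G.grad.uniformContinuous
  obtain ⟨x, hx⟩ := cauchySeq_tendsto_of_complete h1
  obtain ⟨y, hy⟩ := cauchySeq_tendsto_of_complete h2
  have hmem : (x, y) ∈ (G.op.graph : Set (L × E)) := by
    refine IsClosed.mem_of_tendsto (b := atTop) G.closed_graph (hx.prodMk_nhds hy) ?_
    exact Eventually.of_forall fun n => G.op.mem_graph (s n)
  obtain ⟨z, hz⟩ : ∃ z : G.Space, G.gradₗ z = y := by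
    obtain ⟨z, -, hz⟩ := (LinearPMap.mem_graph_iff _).mp hmem
    exact ⟨z, hz⟩
  refine ⟨z, ?_⟩
  rw [tendsto_iff_norm_sub_tendsto_zero]
  have h3 : ∀ n, ‖s n - z‖ = ‖G.grad (s n) - y‖ := by
    intro n
    rw [norm_def, map_sub, hz, grad_apply]
  simp_rw [h3]
  exact tendsto_iff_norm_sub_tendsto_zero.mp hy

theorem inner_riesz [CompleteSpace L] [CompleteSpace E] (G : GradientOperator L E)
    {S : E ≃L[ℝ] E} (hS : (S : E →L[ℝ] E).IsPositive) (ξ : StrongDual ℝ G.Space) (x : G.Space) :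
    ⟪S (G.grad (G.riesz S ξ)), G.grad x⟫ = ξ x := by
  have h : ∃ r : G.Space, ∀ x : G.Space, ⟪S (G.grad r), G.grad x⟫ = ξ x := by
    let B : G.Space →L[ℝ] G.Space →L[ℝ] ℝ :=
      (innerSL ℝ : E →L[ℝ] E →L[ℝ] ℝ).bilinearComp ((S : E →L[ℝ] E).comp G.grad) G.grad
    have hB : IsCoercive B := by
      obtain ⟨c, hc, h⟩ := coercive_of_isPositive hS
      refine ⟨c, hc, fun r => ?_⟩
      have := h (G.grad r)
      have e : ‖G.grad r‖ = ‖r‖ := (G.norm_def r).symm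
      rw [e] at this
      calc c * ‖r‖ * ‖r‖ = c * ‖r‖ ^ 2 := by ring
        _ ≤ _ := this
    refine ⟨hB.continuousLinearEquivOfBilin.symm ((InnerProductSpace.toDual ℝ G.Space).symm ξ),
      fun x => ?_⟩
    have h1 := hB.continuousLinearEquivOfBilin_apply
      (hB.continuousLinearEquivOfBilin.symm ((InnerProductSpace.toDual ℝ G.Space).symm ξ)) x
    rw [ContinuousLinearEquiv.apply_symm_apply, InnerProductSpace.toDual_symm_apply] at h1
    exact h1.symm
  rw [riesz, dif_pos h]
  exact h.choose_spec x

end GradientOperator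

/-- Lebesgue measure on the time interval `(0,T)`. -/
def timeMeasure (T : ℝ) : Measure ℝ := volume.restrict (Ioo 0 T)

/-- `φ ∈ L²(0,T;H_D)`, where `H_D` has the graph norm of `D`. -/
def MemL2HD (G : GradientOperator L E) (T : ℝ) (φ : ℝ → E) : Prop :=
  MemLp φ 2 (timeMeasure T) ∧ (∀ᵐ t ∂timeMeasure T, φ t ∈ G.HD) ∧
    MemLp (fun t => G.div (φ t)) 2 (timeMeasure T)

/-- `v ∈ C¹_c((0,T);H_G)`. -/
def IsTest (G : GradientOperator L E) (T : ℝ) (v : ℝ → G.Space) : Prop :=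
  ContDiff ℝ 1 v ∧ HasCompactSupport v ∧ tsupport v ⊆ Ioo 0 T

/-- `u ∈ W`: `u ∈ L²(0,T;H_G)`, and `⟨u, v'⟩_{L²(L)} ≤ C ‖v‖_{L²(H_G)}` for all test
functions `v`. -/
def MemW (G : GradientOperator L E) (T : ℝ) (u : ℝ → G.Space) : Prop :=
  MemLp u 2 (timeMeasure T) ∧
    ∃ C : ℝ, 0 ≤ C ∧ ∀ v : ℝ → G.Space, IsTest G T v →
      ∫ t, ⟪G.incl (u t), G.incl (deriv v t)⟫ ∂timeMeasure T
        ≤ C * (eLpNorm v 2 (timeMeasure T)).toReal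

/-- `u' ∈ L²(0,T;H_G')` is the weak time derivative of `u`. -/
def IsTimeDeriv (G : GradientOperator L E) (T : ℝ) (u : ℝ → G.Space)
    (u' : ℝ → StrongDual ℝ G.Space) : Prop :=
  MemLp u' 2 (timeMeasure T) ∧
    ∀ v : ℝ → G.Space, IsTest G T v →
      ∫ t, u' t (v t) ∂timeMeasure T = -∫ t, ⟪G.incl (u t), G.incl (deriv v t)⟫ ∂timeMeasure T

open Classical in
/-- The weak time derivative of an element of `W` (determined up to a null set). -/
def timeDeriv (G : GradientOperator L E) (T : ℝ) (u : ℝ → G.Space) :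
    ℝ → StrongDual ℝ G.Space :=
  if h : ∃ u', IsTimeDeriv G T u u' then h.choose else 0

open Classical in
/-- The continuous representative `[0,T] → L` of an element of `W`, which gives a meaning to
`u(t) ∈ L` for every `t ∈ [0,T]`. -/
def contRep (G : GradientOperator L E) (T : ℝ) (u : ℝ → G.Space) : ℝ → L :=
  if h : ∃ g : ℝ → L, ContinuousOn g (Icc 0 T) ∧
      g =ᵐ[timeMeasure T] fun t => G.incl (u t) then h.choose
  else fun t => G.incl (u t)

/-- `u` solves `u' - D(Λ G u + F) = f` in `L²(0,T;H_G')` with `u(0) - Φ u(T) = ξ₀`. -/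
def IsSolution (G : GradientOperator L E) (T : ℝ) (Λ : ℝ → E →L[ℝ] E) (Φ : L →ₗ[ℝ] L)
    (f : ℝ → L) (F : ℝ → E) (ξ₀ : L) (u : ℝ → G.Space) : Prop :=
  MemW G T u ∧
    (∀ᵐ t ∂timeMeasure T,
      timeDeriv G T u t - G.divDual (Λ t (G.grad (u t)) + F t) = G.embedDual (f t)) ∧
    contRep G T u 0 - Φ (contRep G T u T) = ξ₀

end Continuous

section Discrete

/-- A gradient discretisation: a finite-dimensional space `X` of unknowns with reconstructions
`P : X → L` and `Gr : X → E` such that `‖Gr ·‖` is a norm on `X`. -/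
structure GradientDiscretisation (L : Type*) (E : Type*) [NormedAddCommGroup L]
    [InnerProductSpace ℝ L] [NormedAddCommGroup E] [InnerProductSpace ℝ E] where
  X : Type v
  [addCommGroup : AddCommGroup X]
  [module : Module ℝ X]
  [finiteDimensional : FiniteDimensional ℝ X]
  P : X →ₗ[ℝ] L
  Gr : X →ₗ[ℝ] E
  eq_zero_of_norm_Gr : ∀ z : X, ‖Gr z‖ = 0 → z = 0

attribute [instance] GradientDiscretisation.addCommGroup GradientDiscretisation.module
  GradientDiscretisation.finiteDimensional

variable {L E : Type*} [NormedAddCommGroup L] [InnerProductSpace ℝ L]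
  [NormedAddCommGroup E] [InnerProductSpace ℝ E]

namespace GradientDiscretisation

/-- The spatial interpolation error `σ_h(φ) = inf_v (‖P v - φ‖² + ‖Gr v - G φ‖²)^{1/2}`. -/
def sigma (D : GradientDiscretisation.{v} L E) (G : GradientOperator L E) (φ : G.Space) : ℝ :=
  ⨅ z : D.X, √(‖D.P z - G.incl φ‖ ^ 2 + ‖D.Gr z - G.grad φ‖ ^ 2)

/-- The spatial conformity error `ζ_h(φ)`: the supremum over `z ≠ 0` of
`|⟪φ, Gr z⟫ + ⟪D φ, P z⟫| / ‖S^{1/2} Gr z‖` (which is `0` if `X = 0`). -/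
def zeta (D : GradientDiscretisation.{v} L E) (G : GradientOperator L E) (S : E ≃L[ℝ] E)
    (φ : E) : ℝ≥0∞ :=
  ⨆ (z : D.X) (_ : z ≠ 0),
    ENNReal.ofReal (|⟪φ, D.Gr z⟫ + ⟪G.div φ, D.P z⟫| / weightedNorm (S : E →L[ℝ] E) (D.Gr z))

open Classical in
/-- The discrete Riesz operator `R_h : X → X`: `⟪S (Gr (R_h z)), Gr y⟫ = ⟪P z, P y⟫`
for all `y ∈ X` (see `inner_rieszDisc`). -/
def rieszDisc (D : GradientDiscretisation.{v} L E) (S : E ≃L[ℝ] E) (z : D.X) : D.X :=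
  if h : ∃ r : D.X, ∀ y : D.X, ⟪S (D.Gr r), D.Gr y⟫ = ⟪D.P z, D.P y⟫ then h.choose else 0

theorem inner_rieszDisc (D : GradientDiscretisation.{v} L E) {S : E ≃L[ℝ] E}
    (hS : (S : E →L[ℝ] E).IsPositive) (z y : D.X) :
    ⟪S (D.Gr (D.rieszDisc S z)), D.Gr y⟫ = ⟪D.P z, D.P y⟫ := by
  have h : ∃ r : D.X, ∀ y : D.X, ⟪S (D.Gr r), D.Gr y⟫ = ⟪D.P z, D.P y⟫ := by
    let A : D.X →ₗ[ℝ] Module.Dual ℝ D.X :=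
      (innerₗ E).compl₁₂ ((S : E →L[ℝ] E).toLinearMap.comp D.Gr) D.Gr
    have hA : Function.Injective A := by
      rw [← LinearMap.ker_eq_bot, LinearMap.ker_eq_bot']
      intro r hr
      obtain ⟨c, hc, h⟩ := coercive_of_isPositive hS
      have h1 : ⟪S (D.Gr r), D.Gr r⟫ = 0 := LinearMap.congr_fun hr r
      have h2 := h (D.Gr r)
      rw [h1] at h2
      apply D.eq_zero_of_norm_Gr
      by_contra h3
      have : 0 < ‖D.Gr r‖ := lt_of_le_of_ne (norm_nonneg _) (Ne.symm h3)
      have : 0 < c * ‖D.Gr r‖ ^ 2 := by positivity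
      linarith
    have hA' : Function.Surjective A :=
      (LinearMap.injective_iff_surjective_of_finrank_eq_finrank
        (Subspace.dual_finrank_eq).symm).mp hA
    obtain ⟨r, hr⟩ := hA' ((innerₗ L (D.P z)).comp D.P)
    exact ⟨r, fun y => LinearMap.congr_fun hr y⟩
  rw [rieszDisc, dif_pos h]
  exact h.choose_spec y

end GradientDiscretisation

/-- The function of `W_h` with values `w 0` at time `0` and `w m` on `((m-1)k, mk]`,
for `m = 1, …, N` (and `0` outside `[0, Nk]`). -/
def stepW {X : Type*} [AddCommGroup X] {N : ℕ} (k : ℝ) (w : Fin (N + 1) → X) (t : ℝ) : X :=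
  indicator {0} (fun _ => w 0) t +
    ∑ m : Fin N, indicator (Ioc ((m : ℝ) * k) (((m : ℝ) + 1) * k)) (fun _ => w m.succ) t

/-- The function of `V_h` with value `v m` on `(mk, (m+1)k)`, for `m = 0, …, N-1`
(and `0` elsewhere). -/
def stepV {X : Type*} [AddCommGroup X] {N : ℕ} (k : ℝ) (v : Fin N → X) (t : ℝ) : X :=
  ∑ m : Fin N, indicator (Ioo ((m : ℝ) * k) (((m : ℝ) + 1) * k)) (fun _ => v m) t

/-- The discrete time derivative `∂ : W_h → V_h`. -/
def discDeriv {X : Type*} [AddCommGroup X] [Module ℝ X] {N : ℕ} (k : ℝ) (w : Fin (N + 1) → X) :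
    Fin N → X :=
  fun m => k⁻¹ • (w m.succ - w m.castSucc)

/-- The mean value `f^{(m+1)}` of `f` over `(mk, (m+1)k)`. -/
def stepMean {Z : Type*} [NormedAddCommGroup Z] [NormedSpace ℝ Z] (k : ℝ) (f : ℝ → Z) (m : ℕ) : Z :=
  k⁻¹ • ∫ t in ((m : ℝ) * k)..(((m : ℝ) + 1) * k), f t

namespace GradientDiscretisation

/-- The space-time conformity error `ζ^{(T)}_h(φ)`: the supremum over `v ∈ V_h`, `v ≠ 0`, of
`|⟨φ, Gr v⟩_{L²(E)} + ⟨D φ, P v⟩_{L²(L)}| / ‖S^{1/2} Gr v‖_{L²(E)}`. -/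
def zetaT (D : GradientDiscretisation.{v} L E) (G : GradientOperator L E) (S : E ≃L[ℝ] E)
    (T : ℝ) (N : ℕ) (φ : ℝ → E) : ℝ≥0∞ :=
  ⨆ (y : Fin N → D.X) (_ : y ≠ 0),
    ENNReal.ofReal
        |(∫ t, ⟪φ t, D.Gr (stepV (T / N) y t)⟫ ∂timeMeasure T) +
          ∫ t, ⟪G.div (φ t), D.P (stepV (T / N) y t)⟫ ∂timeMeasure T| /
      eLpNorm (fun t => weightedNorm (S : E →L[ℝ] E) (D.Gr (stepV (T / N) y t))) 2 (timeMeasure T)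

/-- The distance `δ^{(T)}_h(u, w)` between `u ∈ W` and `w ∈ W_h`:
`‖S^{1/2}(G R u' - Gr R_h ∂w)‖_{L²(E)} + ‖S^{-1/2} Λ (G u - Gr w)‖_{L²(E)}
+ sup_{t ∈ [0,T]} ‖u(t) - P w(t)‖_L`. -/
def deltaT (D : GradientDiscretisation.{v} L E) (G : GradientOperator L E) (S : E ≃L[ℝ] E)
    (Λ : ℝ → E →L[ℝ] E) (T : ℝ) (N : ℕ) (u : ℝ → G.Space) (w : Fin (N + 1) → D.X) : ℝ≥0∞ :=
  eLpNorm (fun t => weightedNorm (S : E →L[ℝ] E)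
      (G.grad (G.riesz S (timeDeriv G T u t)) -
        D.Gr (D.rieszDisc S (stepV (T / N) (discDeriv (T / N) w) t)))) 2 (timeMeasure T) +
    eLpNorm (fun t => weightedNorm (S.symm : E →L[ℝ] E)
      (Λ t (G.grad (u t) - D.Gr (stepW (T / N) w t)))) 2 (timeMeasure T) +
    ⨆ t ∈ Icc 0 T, ‖contRep G T u t - D.P (stepW (T / N) w t)‖ₑ

/-- `w = (w^{(0)}, …, w^{(N)})` solves the implicit Euler scheme with time step `k = T / N`. -/
def IsSchemeSolution (D : GradientDiscretisation.{v} L E) (T : ℝ) (N : ℕ)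
    (Λ : ℝ → E →L[ℝ] E) (Φ : L →ₗ[ℝ] L) (f : ℝ → L) (F : ℝ → E) (ξ₀ : L)
    (w : Fin (N + 1) → D.X) : Prop :=
  (∀ z : D.X, ⟪D.P (w 0) - Φ (D.P (w (Fin.last N))), D.P z⟫ = ⟪ξ₀, D.P z⟫) ∧
    ∀ (m : Fin N) (z : D.X),
      ⟪D.P (discDeriv (T / N) w m), D.P z⟫ +
          ⟪stepMean (T / N) (fun t => Λ t (D.Gr (w m.succ))) m, D.Gr z⟫ =
        ⟪stepMean (T / N) f m, D.P z⟫ - ⟪stepMean (T / N) F m, D.Gr z⟫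

end GradientDiscretisation

end Discrete

end ParabolicGDM

end

open MeasureTheory Filter Topology Set
open scoped RealInnerProductSpace ENNReal NNReal

noncomputable section

/-! Write ι for the inclusion of H_G into L and K = ι*ι for its Gram operator on H_G. Everything
rests on turning statements about u' into statements about K and about the Riesz operator, for which
limit-conformity gives discrete counterparts.

Uniform Poincaré inequality. For y in L, the vector ψ = S G R y has divergence -y. So ζ_h(ψ) → 0
bounds ⟪P z, y⟫ by a multiple of ‖Gr z‖ for each fixed y, and Banach-Steinhaus gives ‖P z‖ ≤ C ‖Gr
z‖ uniformly in the discretisation (`exists_poincare`). Claim 1 follows: Cauchy-Schwarz in time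
bounds ζ^{(T)} by the L² norm of t ↦ ζ_h(φ(t)), whatever the time step, and dominated convergence
applies with a bound supplied by the Poincaré inequality (`zetaT_le`, `tendsto_zetaT`).

Claim 2. For u in W, K u = ξ + ∫ z with z the Riesz representative of u'. Applying (K + ε)⁻¹ to such
a primitive, with z replaced by a continuous function, gives C¹ functions v with v close to u and K
v' close to z in L²(H_G). The identity d/dt ‖ι v‖² = 2⟪v, K v'⟫ makes this approximation uniform in
L as well (`MemW.exists_contDiff_approx`). A C¹ function is interpolated at the time nodes by the
best approximation operator of each discretisation. The operators P I, Gr I and Gr R_h I are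
uniformly bounded and converge strongly, hence uniformly on compact sets (`tendsto_Gr_rieszDisc`,
`tendstoUniformlyOn_of_strong`, `exists_interpolation_contDiff`).

Claim 3 is consistency plus stability. The flux S G R u' + Λ G u + F has divergence -f. Inserting an
interpolant v of u into the scheme therefore leaves a residual controlled by ζ^{(T)} of the flux and
by the approximation error of v (`IsSchemeSolution.abs_eulerForm_sub_le`). For e = w - v the energy
inequality controls the growth in time. As no initial value is prescribed, some step at which P e is
small is found by averaging, its smallness is carried to the final time, then to time 0 by the
contraction Φ, then to all steps (`stability`). Testing with R_h ∂e controls the derivative part,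
and the triangle inequality concludes. -/

namespace ParabolicGDM

universe v

/-! ### Dominated convergence and Cauchy-Schwarz in L². -/

section General

variable {α : Type*} {mα : MeasurableSpace α} {μ : Measure α}

theorem tendsto_eLpNorm_two_of_dominated {Z : Type*} [NormedAddCommGroup Z] {F : ℕ → α → Z}
    {g : α → ℝ} (hg : MemLp g 2 μ) (hF : ∀ n, AEStronglyMeasurable (F n) μ)
    (hb : ∀ n, ∀ᵐ x ∂μ, ‖F n x‖ ≤ g x)
    (hlim : ∀ᵐ x ∂μ, Tendsto (fun n => F n x) atTop (𝓝 0)) :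
    Tendsto (fun n => eLpNorm (F n) 2 μ) atTop (𝓝 0) := by
  have h2 : (2 : ℝ≥0∞) ≠ 0 := by norm_num
  have h2' : (2 : ℝ≥0∞) ≠ ∞ := by norm_num
  simp_rw [eLpNorm_eq_lintegral_rpow_enorm_toReal h2 h2']
  have key : Tendsto (fun n => ∫⁻ x, ‖F n x‖ₑ ^ (2 : ℝ≥0∞).toReal ∂μ) atTop
      (𝓝 (∫⁻ _, 0 ∂μ)) := by
    refine tendsto_lintegral_of_dominated_convergence' (fun x => ‖g x‖ₑ ^ (2 : ℝ≥0∞).toReal)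
      (fun n => (hF n).enorm.pow_const _) (fun n => ?_) ?_ ?_
    · filter_upwards [hb n] with x hx
      gcongr
      rw [enorm_le_iff_norm_le]
      exact hx.trans (le_abs_self _)
    · exact (lintegral_rpow_enorm_lt_top_of_eLpNorm_lt_top h2 h2' hg.2).ne
    · filter_upwards [hlim] with x hx
      have h1 : Tendsto (fun n => ‖F n x‖ₑ) atTop (𝓝 0) := by simpa using hx.enorm
      have := h1.ennrpow_const (2 : ℝ≥0∞).toReal
      rwa [ENNReal.zero_rpow_of_pos (by simp)] at this
  rw [lintegral_zero] at key
  have := key.ennrpow_const (1 / (2 : ℝ≥0∞).toReal)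
  rwa [ENNReal.zero_rpow_of_pos (by simp)] at this

theorem integrable_inner_of_memLp {Z : Type*} [NormedAddCommGroup Z] [InnerProductSpace ℝ Z]
    {f g : α → Z} (hf : MemLp f 2 μ) (hg : MemLp g 2 μ) :
    Integrable (fun x => ⟪f x, g x⟫) μ := by
  have h := L2.integrable_inner (𝕜 := ℝ) hf.toLp hg.toLp
  refine h.congr ?_
  filter_upwards [hf.coeFn_toLp, hg.coeFn_toLp] with x h1 h2
  rw [h1, h2]

/-- Cauchy-Schwarz in the Hilbert space of real L² functions, applied to the two norms; this is why
the target spaces need no inner product. -/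
theorem integral_norm_mul_norm_le {Y Z : Type*} [NormedAddCommGroup Y] [NormedAddCommGroup Z]
    {f : α → Y} {g : α → Z} (hf : MemLp f 2 μ) (hg : MemLp g 2 μ) :
    ∫ x, ‖f x‖ * ‖g x‖ ∂μ ≤ (eLpNorm f 2 μ).toReal * (eLpNorm g 2 μ).toReal := by
  have h1 := real_inner_le_norm (hf.norm.toLp) (hg.norm.toLp)
  rw [L2.inner_def, Lp.norm_toLp, Lp.norm_toLp, eLpNorm_norm, eLpNorm_norm] at h1
  refine le_trans (le_of_eq (integral_congr_ae ?_)) h1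
  filter_upwards [hf.norm.coeFn_toLp, hg.norm.coeFn_toLp] with x h1 h2
  rw [h1, h2]
  simp [mul_comm]

theorem integrable_norm_mul_norm {Y Z : Type*} [NormedAddCommGroup Y] [NormedAddCommGroup Z]
    {f : α → Y} {g : α → Z} (hf : MemLp f 2 μ) (hg : MemLp g 2 μ) :
    Integrable (fun x => ‖f x‖ * ‖g x‖) μ := by
  refine (integrable_inner_of_memLp hg.norm hf.norm).congr ?_
  exact Eventually.of_forall fun x => by simp

theorem abs_integral_inner_le {Z : Type*} [NormedAddCommGroup Z] [InnerProductSpace ℝ Z]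
    {f g : α → Z} (hf : MemLp f 2 μ) (hg : MemLp g 2 μ) :
    |∫ x, ⟪f x, g x⟫ ∂μ| ≤ (eLpNorm f 2 μ).toReal * (eLpNorm g 2 μ).toReal := by
  refine le_trans ?_ (integral_norm_mul_norm_le hf hg)
  refine (abs_integral_le_integral_abs).trans ?_
  refine integral_mono (integrable_inner_of_memLp hf hg).abs (integrable_norm_mul_norm hf hg) ?_
  intro x
  exact abs_real_inner_le_norm _ _

theorem eLpNorm_two_le_of_bound {Z : Type*} [NormedAddCommGroup Z] [IsFiniteMeasure μ]
    {f : α → Z} {C : ℝ} (h : ∀ᵐ x ∂μ, ‖f x‖ ≤ C) :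
    eLpNorm f 2 μ ≤ (μ univ) ^ (2⁻¹ : ℝ) * ENNReal.ofReal C := by
  simpa using eLpNorm_le_of_ae_bound (p := 2) h

theorem toReal_eLpNorm_two_sq {Z : Type*} [NormedAddCommGroup Z]
    {f : α → Z} (hf : MemLp f 2 μ) :
    (eLpNorm f 2 μ).toReal ^ 2 = ∫ x, ‖f x‖ ^ 2 ∂μ := by
  have h1 : ⟪hf.norm.toLp, hf.norm.toLp⟫ = _ := L2.inner_def (𝕜 := ℝ) hf.norm.toLp hf.norm.toLp
  rw [real_inner_self_eq_norm_sq, Lp.norm_toLp, eLpNorm_norm] at h1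
  rw [h1]
  refine integral_congr_ae ?_
  filter_upwards [hf.norm.coeFn_toLp] with x h1
  rw [h1]
  simp [sq]

end General

/-! ### The Gram operator of an embedding and its resolvents. -/

section Resolvent

variable {L H : Type*} [NormedAddCommGroup L] [InnerProductSpace ℝ L] [CompleteSpace L]
  [NormedAddCommGroup H] [InnerProductSpace ℝ H] [CompleteSpace H]

/-- The Gram operator `ι* ι` of a bounded operator. -/
def gram (ι : H →L[ℝ] L) : H →L[ℝ] H := (ContinuousLinearMap.adjoint ι).comp ι

theorem inner_gram (ι : H →L[ℝ] L) (x y : H) : ⟪gram ι x, y⟫ = ⟪ι x, ι y⟫ := by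
  simp [gram, ContinuousLinearMap.adjoint_inner_left]

/-- Lax-Milgram: the Gram operator is nonnegative, so adding ε times the identity makes the form
coercive with constant ε. -/
theorem exists_resolvent (ι : H →L[ℝ] L) {ε : ℝ} (hε : 0 < ε) :
    ∃ B : H →L[ℝ] H, (∀ x, gram ι (B x) + ε • B x = x) ∧ (∀ x, B (gram ι x + ε • x) = x) := by
  let b : H →L[ℝ] H →L[ℝ] ℝ :=
    (innerSL ℝ : H →L[ℝ] H →L[ℝ] ℝ).comp (gram ι + ε • ContinuousLinearMap.id ℝ H)
  have hb : IsCoercive b := by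
    refine ⟨ε, hε, fun x => ?_⟩
    have h1 : b x x = ‖ι x‖ ^ 2 + ε * ‖x‖ ^ 2 := by
      change ⟪gram ι x + ε • x, x⟫ = _
      rw [inner_add_left, inner_gram, real_inner_smul_left, real_inner_self_eq_norm_sq,
        real_inner_self_eq_norm_sq]
    rw [h1]
    nlinarith [sq_nonneg ‖ι x‖]
  have h1 : ∀ x, hb.continuousLinearEquivOfBilin x = gram ι x + ε • x := by
    intro x
    refine ext_inner_right ℝ fun y => ?_
    rw [hb.continuousLinearEquivOfBilin_apply]
    rfl
  refine ⟨hb.continuousLinearEquivOfBilin.symm, fun x => ?_, fun x => ?_⟩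
  · have := h1 (hb.continuousLinearEquivOfBilin.symm x)
    rw [ContinuousLinearEquiv.apply_symm_apply] at this
    exact this.symm
  · rw [← h1]
    exact ContinuousLinearEquiv.symm_apply_apply _ _

/-- A vector x orthogonal to the range satisfies ‖ι x‖² = ⟪ι*ι x, x⟫ = 0. -/
theorem dense_range_gram {ι : H →L[ℝ] L} (hι : Function.Injective ι) :
    DenseRange (gram ι) := by
  have h : (LinearMap.range (gram ι).toLinearMap).topologicalClosure = ⊤ := by
    rw [Submodule.topologicalClosure_eq_top_iff, Submodule.eq_bot_iff]
    intro x hx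
    have h1 : ⟪gram ι x, x⟫ = 0 := hx _ ⟨x, rfl⟩
    rw [inner_gram, inner_self_eq_zero] at h1
    exact hι (by rw [h1, map_zero])
  have h2 := Submodule.dense_iff_topologicalClosure_eq_top.mpr h
  exact h2

/-- Bounded operators `B n` that commute with `ι* ι` and for which `ι* ι (B n)` is a
contraction converging strongly to the identity. -/
theorem exists_smoothing {ι : H →L[ℝ] L} (hι : Function.Injective ι) :
    ∃ B : ℕ → H →L[ℝ] H, (∀ n x, B n (gram ι x) = gram ι (B n x)) ∧
      (∀ n x, ‖gram ι (B n x)‖ ≤ ‖x‖) ∧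
      ∀ x, Tendsto (fun n => gram ι (B n x)) atTop (𝓝 x) := by
  have hpos : ∀ n : ℕ, (0 : ℝ) < 1 / (n + 1) := fun n => Nat.one_div_pos_of_nat
  choose B hB1 hB2 using fun n : ℕ => exists_resolvent ι (hpos n)
  have hcomm : ∀ n x, B n (gram ι x) = gram ι (B n x) := by
    intro n x
    have h1 := hB1 n x
    have h2 := hB2 n x
    rw [map_add, map_smul] at h2
    exact add_right_cancel (h2.trans h1.symm)
  -- Expand the square of x = K(B x) + ε B x with K = ι*ι: the cross term is 2 ε ‖ι(B x)‖², which is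
  -- nonnegative and may be dropped.
  have hsq : ∀ n x, ‖gram ι (B n x)‖ ^ 2 + ((1 : ℝ) / (n + 1)) ^ 2 * ‖B n x‖ ^ 2 ≤ ‖x‖ ^ 2 := by
    intro n x
    have h1 : ‖x‖ ^ 2 = ‖gram ι (B n x) + ((1 : ℝ) / (n + 1)) • B n x‖ ^ 2 := by rw [hB1 n x]
    rw [h1, norm_add_sq_real, norm_smul, inner_smul_right, inner_gram,
      real_inner_self_eq_norm_sq, mul_pow, Real.norm_eq_abs, sq_abs]
    have := hpos n
    have : 0 ≤ 2 * (1 / ((n : ℝ) + 1) * ‖ι (B n x)‖ ^ 2) := by positivity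
    linarith
  have hK : ∀ n x, ‖gram ι (B n x)‖ ≤ ‖x‖ := by
    intro n x
    refine abs_le_of_sq_le_sq' ?_ (norm_nonneg _) |>.2
    have := hsq n x
    have : 0 ≤ ((1 : ℝ) / (n + 1)) ^ 2 * ‖B n x‖ ^ 2 := by positivity
    linarith
  refine ⟨B, hcomm, hK, fun x => ?_⟩
  rw [Metric.tendsto_atTop]
  intro δ hδ
  -- On the range of K the convergence has a rate, K B K y - K y = -ε K B y, of norm at most ε ‖y‖.
  -- The contraction property extends it to the closure.
  obtain ⟨y, hy⟩ := (dense_range_gram hι).exists_dist_lt x (show 0 < δ / 4 by positivity)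
  have hlim : Tendsto (fun n : ℕ => (1 : ℝ) / (n + 1) * ‖y‖) atTop (𝓝 0) := by
    simpa using tendsto_one_div_add_atTop_nhds_zero_nat.mul_const ‖y‖
  obtain ⟨n0, hn0⟩ := (hlim.eventually (gt_mem_nhds (show 0 < δ / 4 by positivity))).exists_forall_of_atTop
  refine ⟨n0, fun n hn => ?_⟩
  have h1 : gram ι (B n (gram ι y)) - gram ι y = -((1 : ℝ) / (n + 1)) • gram ι (B n y) := by
    have h2 := hB1 n (gram ι y)
    rw [hcomm n y] at h2 ⊢
    linear_combination (norm := module) h2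
  have h2 : ‖gram ι (B n (gram ι y)) - gram ι y‖ ≤ 1 / (n + 1) * ‖y‖ := by
    rw [h1, norm_smul, norm_neg, Real.norm_of_nonneg (hpos n).le]
    exact mul_le_mul_of_nonneg_left (hK n y) (hpos n).le
  have h3 : ‖gram ι (B n (x - gram ι y))‖ ≤ ‖x - gram ι y‖ := hK _ _
  rw [map_sub, map_sub] at h3
  rw [dist_eq_norm] at hy ⊢
  have h4 : gram ι (B n x) - x = (gram ι (B n x) - gram ι (B n (gram ι y)))
      + (gram ι (B n (gram ι y)) - gram ι y) - (x - gram ι y) := by abel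
  have h5 := hn0 n hn
  rw [h4]
  calc _ ≤ ‖gram ι (B n x) - gram ι (B n (gram ι y))‖ +
      ‖gram ι (B n (gram ι y)) - gram ι y‖ + ‖x - gram ι y‖ :=
        (norm_sub_le _ _).trans (by gcongr; exact norm_add_le _ _)
    _ < δ := by linarith

end Resolvent

/-! ### Integration over the time interval. -/

section TimeMeasure

instance (T : ℝ) : IsFiniteMeasure (timeMeasure T) := by
  unfold timeMeasure
  infer_instance

theorem timeMeasure_univ (T : ℝ) : timeMeasure T univ = ENNReal.ofReal T := by
  simp [timeMeasure]

theorem ae_mem_Ioo (T : ℝ) : ∀ᵐ t ∂timeMeasure T, t ∈ Ioo 0 T :=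
  ae_restrict_mem measurableSet_Ioo

theorem memLp_timeMeasure_of_continuousOn {Z : Type*} [NormedAddCommGroup Z] {T : ℝ} {v : ℝ → Z}
    (hv : ContinuousOn v (Icc 0 T)) : MemLp v 2 (timeMeasure T) := by
  obtain ⟨C, hC⟩ := isCompact_Icc.exists_bound_of_continuousOn hv
  refine MemLp.of_bound ((hv.mono Ioo_subset_Icc_self).aestronglyMeasurable measurableSet_Ioo) C ?_
  filter_upwards [ae_mem_Ioo T] with t ht
  exact hC t (Ioo_subset_Icc_self ht)

theorem intervalIntegrable_of_memLp {Z : Type*} [NormedAddCommGroup Z] {T : ℝ} {w : ℝ → Z}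
    (hw : MemLp w 2 (timeMeasure T)) {a b : ℝ} (ha : a ∈ Icc 0 T) (hb : b ∈ Icc 0 T) :
    IntervalIntegrable w volume a b := by
  have h1 : IntegrableOn w (Ioo 0 T) := hw.integrable (by norm_num)
  have h2 : IntegrableOn w (Icc 0 T) := by rwa [integrableOn_Icc_iff_integrableOn_Ioo]
  refine intervalIntegrable_iff.mpr (h2.mono_set ?_)
  exact uIoc_subset_uIcc.trans (uIcc_subset_Icc ha hb)

theorem enorm_intervalIntegral_le_eLpNorm_one {Z : Type*} [NormedAddCommGroup Z] [NormedSpace ℝ Z]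
    {T : ℝ} (w : ℝ → Z) {a b : ℝ} (ha : a ∈ Icc 0 T) (hb : b ∈ Icc 0 T) :
    ‖∫ s in a..b, w s‖ₑ ≤ eLpNorm w 1 (timeMeasure T) := by
  rw [eLpNorm_one_eq_lintegral_enorm, timeMeasure, restrict_Ioo_eq_restrict_Ioc]
  have key : ∀ c d : ℝ, c ∈ Icc 0 T → d ∈ Icc 0 T →
      ‖∫ s in Ioc c d, w s‖ₑ ≤ ∫⁻ s in Ioc 0 T, ‖w s‖ₑ := by
    intro c d hc hd
    refine (enorm_integral_le_lintegral_enorm _).trans (lintegral_mono_set ?_)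
    exact Ioc_subset_Ioc hc.1 hd.2
  rcases le_total a b with h | h
  · rw [intervalIntegral.integral_of_le h]
    exact key a b ha hb
  · rw [intervalIntegral.integral_of_ge h, enorm_neg]
    exact key b a hb ha

end TimeMeasure

/-! ### Smoothing in time and the energy bound. -/

section Density

variable {L H : Type*} [NormedAddCommGroup L] [InnerProductSpace ℝ L] [CompleteSpace L]
  [NormedAddCommGroup H] [InnerProductSpace ℝ H] [CompleteSpace H]

/-- With K = ι*ι, only K u is a primitive, so u itself need not be differentiable in H. The bounded
operator B from `exists_smoothing` acts as an approximate inverse of K: v = B(ξ + ∫ g) is C¹ for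
continuous g. Both errors split into a part caused by g ≠ z and a part of the form K B f - f. -/
theorem exists_contDiff_approx {ι : H →L[ℝ] L} (hι : Function.Injective ι) {T : ℝ}
    {u z : ℝ → H} (hu : MemLp u 2 (timeMeasure T)) (hz : MemLp z 2 (timeMeasure T)) {ξ : H}
    (h : ∀ᵐ t ∂timeMeasure T, gram ι (u t) = ξ + ∫ s in 0..t, z s) {η : ℝ≥0∞} (hη : η ≠ 0) :
    ∃ v : ℝ → H, ContDiff ℝ 1 v ∧ eLpNorm (fun t => v t - u t) 2 (timeMeasure T) ≤ η ∧
      eLpNorm (fun t => gram ι (deriv v t) - z t) 2 (timeMeasure T) ≤ η := by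
  obtain ⟨B, hcomm, hbound, hlim⟩ := exists_smoothing hι
  have hη2 : η / 2 ≠ 0 := ENNReal.div_ne_zero.mpr ⟨hη, by norm_num⟩
  have conv : ∀ f : ℝ → H, MemLp f 2 (timeMeasure T) →
      Tendsto (fun n => eLpNorm (fun t => gram ι (B n (f t)) - f t) 2 (timeMeasure T)) atTop
        (𝓝 0) := by
    intro f hf
    refine tendsto_eLpNorm_two_of_dominated (hf.norm.const_mul 2) (fun n => ?_) (fun n => ?_) ?_
    · exact (((gram ι).comp (B n)).continuous.comp_aestronglyMeasurable hf.1).sub hf.1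
    · refine Eventually.of_forall fun t => ?_
      have := hbound n (f t)
      refine (norm_sub_le _ _).trans ?_
      linarith
    · refine Eventually.of_forall fun t => ?_
      simpa using (hlim (f t)).sub_const (f t)
  have hev := ((conv u hu).eventually (ge_mem_nhds (pos_iff_ne_zero.mpr hη2))).and
    ((conv z hz).eventually (ge_mem_nhds (pos_iff_ne_zero.mpr hη2)))
  obtain ⟨n, hn1, hn2⟩ := hev.exists
  -- This bounds the map g ↦ B(∫₀ᵗ g) on L²(0,T): one root of the measure passes from L¹ to L², the
  -- other from the supremum to L². Since n is fixed before g is chosen, ‖B n‖ may be large.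
  set K : ℝ≥0∞ := ‖B n‖ₑ * timeMeasure T univ ^ (2⁻¹ : ℝ) * timeMeasure T univ ^ (2⁻¹ : ℝ) with hK
  have hKtop : K ≠ ∞ := by
    refine ENNReal.mul_ne_top (ENNReal.mul_ne_top enorm_ne_top ?_) ?_ <;>
      exact ENNReal.rpow_ne_top_of_nonneg (by norm_num) (measure_ne_top _ _)
  set δ : ℝ≥0∞ := min (η / 2) (η / 2 / K) with hδ
  have hδ0 : δ ≠ 0 := by
    rw [hδ, ← pos_iff_ne_zero, lt_min_iff]
    exact ⟨pos_iff_ne_zero.mpr hη2, ENNReal.div_pos hη2 hKtop⟩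
  obtain ⟨g, hg, hgL⟩ := hz.exists_boundedContinuous_eLpNorm_sub_le (by norm_num) hδ0
  have hgc : Continuous g := g.continuous
  have hgz : MemLp (fun t => g t - z t) 2 (timeMeasure T) := hgL.sub hz
  have hgz' : eLpNorm (fun t => g t - z t) 2 (timeMeasure T) ≤ δ := by
    have := eLpNorm_sub_comm (f := ⇑g) (g := z) (p := 2) (μ := timeMeasure T)
    change eLpNorm (⇑g - z) 2 (timeMeasure T) ≤ δ
    rw [this]
    exact hg
  set v : ℝ → H := fun t => B n (ξ + ∫ s in 0..t, g s) with hv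
  have hderiv : ∀ t, HasDerivAt v (B n (g t)) t := by
    intro t
    exact (B n).hasFDerivAt.comp_hasDerivAt t
      ((hgc.integral_hasStrictDerivAt 0 t).hasDerivAt.const_add ξ)
  have hd : deriv v = fun t => B n (g t) := funext fun t => (hderiv t).deriv
  refine ⟨v, ?_, ?_, ?_⟩
  · rw [contDiff_one_iff_deriv]
    refine ⟨fun t => (hderiv t).differentiableAt, ?_⟩
    rw [hd]
    exact (B n).continuous.comp hgc
  -- B commutes with K = ι*ι, so B(ξ + ∫ z) = B K u = K B u.
  · have e1 : (fun t => v t - u t) =ᵐ[timeMeasure T]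
        (fun t => B n (∫ s in 0..t, (g s - z s))) + fun t => gram ι (B n (u t)) - u t := by
      filter_upwards [h, ae_mem_Ioo T] with t ht htT
      have h0 : (0 : ℝ) ∈ Icc 0 T := ⟨le_rfl, (htT.1.trans htT.2).le⟩
      have ht' := Ioo_subset_Icc_self htT
      rw [Pi.add_apply, intervalIntegral.integral_sub (intervalIntegrable_of_memLp hgL h0 ht')
        (intervalIntegrable_of_memLp hz h0 ht'), ← hcomm, ht, map_sub, map_add]
      simp only [hv, map_add]
      abel
    have hprim : ∀ᵐ t ∂timeMeasure T, ‖B n (∫ s in 0..t, (g s - z s))‖ₑ ≤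
        ‖B n‖ₑ * (eLpNorm (fun t => g t - z t) 2 (timeMeasure T) *
          timeMeasure T univ ^ (2⁻¹ : ℝ)) := by
      filter_upwards [ae_mem_Ioo T] with t htT
      have h0 : (0 : ℝ) ∈ Icc 0 T := ⟨le_rfl, (htT.1.trans htT.2).le⟩
      refine ((B n).le_opENorm _).trans ?_
      gcongr
      refine (enorm_intervalIntegral_le_eLpNorm_one _ h0 (Ioo_subset_Icc_self htT)).trans ?_
      have := eLpNorm_le_eLpNorm_mul_rpow_measure_univ (p := 1) (q := 2) (by norm_num) hgz.1
      refine this.trans (le_of_eq ?_)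
      norm_num
    have m2 : AEStronglyMeasurable (fun t => gram ι (B n (u t)) - u t) (timeMeasure T) :=
      (((gram ι).comp (B n)).continuous.comp_aestronglyMeasurable hu.1).sub hu.1
    have m1 : AEStronglyMeasurable (fun t => B n (∫ s in 0..t, (g s - z s))) (timeMeasure T) := by
      have mv : AEStronglyMeasurable (fun t => v t - u t) (timeMeasure T) :=
        (continuous_iff_continuousAt.mpr fun t =>
          (hderiv t).continuousAt).aestronglyMeasurable.sub hu.1
      refine (mv.sub m2).congr ?_
      filter_upwards [e1] with t ht
      rw [Pi.sub_apply, ht]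
      simp
    rw [eLpNorm_congr_ae e1]
    refine (eLpNorm_add_le m1 m2 (by norm_num)).trans ?_
    rw [← ENNReal.add_halves η]
    gcongr
    refine (eLpNorm_le_of_ae_enorm_bound hprim).trans ?_
    calc _ = K * eLpNorm (fun t => g t - z t) 2 (timeMeasure T) := by
          rw [hK, smul_eq_mul]
          norm_num
          ring
      _ ≤ K * (η / 2 / K) := by
          gcongr
          exact hgz'.trans (min_le_right _ _)
      _ ≤ η / 2 := ENNReal.mul_div_le
  · have e1 : (fun t => gram ι (deriv v t) - z t) =
        (fun t => gram ι (B n (g t - z t))) + fun t => gram ι (B n (z t)) - z t := by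
      funext t
      rw [hd, Pi.add_apply, map_sub, map_sub]
      abel
    rw [e1]
    refine (eLpNorm_add_le ?_ ?_ (by norm_num)).trans ?_
    · exact ((gram ι).comp (B n)).continuous.comp_aestronglyMeasurable hgz.1
    · exact (((gram ι).comp (B n)).continuous.comp_aestronglyMeasurable hz.1).sub hz.1
    rw [← ENNReal.add_halves η]
    gcongr
    refine (eLpNorm_mono fun t => hbound n (g t - z t)).trans ?_
    exact hgz'.trans (min_le_left _ _)

/-- The derivative of ‖ι v‖² is 2⟪v, ι*ι v'⟫. Integrating it between s and t and then averaging over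
s removes the unknown value at s; the average of ‖ι v(s)‖² is what produces the factor ‖ι‖²/T. -/
theorem exists_energy_bound (ι : H →L[ℝ] L) {T : ℝ} (hT : 0 < T) :
    ∃ C : ℝ, 0 ≤ C ∧ ∀ v : ℝ → H, ContDiff ℝ 1 v → ∀ t ∈ Icc 0 T,
      ‖ι (v t)‖ ≤ C * ((eLpNorm v 2 (timeMeasure T)).toReal +
        (eLpNorm (fun s => gram ι (deriv v s)) 2 (timeMeasure T)).toReal) := by
  refine ⟨√(‖ι‖ ^ 2 / T + 1), Real.sqrt_nonneg _, fun v hv t ht => ?_⟩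
  have hvc : Continuous v := hv.continuous
  have hdc : Continuous (deriv v) := hv.continuous_deriv le_rfl
  have hKc : Continuous fun s => gram ι (deriv v s) := (gram ι).continuous.comp hdc
  have hvL : MemLp v 2 (timeMeasure T) := memLp_timeMeasure_of_continuousOn hvc.continuousOn
  have hKL : MemLp (fun s => gram ι (deriv v s)) 2 (timeMeasure T) :=
    memLp_timeMeasure_of_continuousOn hKc.continuousOn
  set a := (eLpNorm v 2 (timeMeasure T)).toReal with ha
  set b := (eLpNorm (fun s => gram ι (deriv v s)) 2 (timeMeasure T)).toReal with hb
  have ha0 : 0 ≤ a := ENNReal.toReal_nonneg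
  have hb0 : 0 ≤ b := ENNReal.toReal_nonneg
  have hder : ∀ s, HasDerivAt (fun s => ‖ι (v s)‖ ^ 2) (2 * ⟪v s, gram ι (deriv v s)⟫) s := by
    intro s
    have h1 : HasDerivAt (fun s => ι (v s)) (ι (deriv v s)) s :=
      ι.hasFDerivAt.comp_hasDerivAt s ((hv.differentiable one_ne_zero) s).hasDerivAt
    have h2 := h1.norm_sq
    rw [real_inner_comm, inner_gram, real_inner_comm]
    exact h2
  have hcont : Continuous fun s => 2 * ⟪v s, gram ι (deriv v s)⟫ :=
    continuous_const.mul (hvc.inner hKc)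
  have hdiff : ∀ s ∈ Icc 0 T, ‖ι (v t)‖ ^ 2 - ‖ι (v s)‖ ^ 2 ≤ 2 * (a * b) := by
    intro s hs
    rw [← intervalIntegral.integral_eq_sub_of_hasDerivAt (fun r _ => hder r)
      (hcont.intervalIntegrable s t), intervalIntegral.integral_const_mul]
    gcongr
    refine (le_abs_self _).trans ?_
    rw [← Real.norm_eq_abs]
    have h1 := enorm_intervalIntegral_le_eLpNorm_one (T := T)
      (fun s => ⟪v s, gram ι (deriv v s)⟫) hs ht
    have hint := integrable_inner_of_memLp hvL hKL
    rw [← toReal_enorm]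
    refine (ENNReal.toReal_mono (memLp_one_iff_integrable.mpr hint).2.ne h1).trans ?_
    rw [eLpNorm_one_eq_lintegral_enorm, ← integral_norm_eq_lintegral_enorm hint.1]
    refine le_trans ?_ (integral_norm_mul_norm_le hvL hKL)
    exact integral_mono hint.norm (integrable_norm_mul_norm hvL hKL)
      fun r => norm_inner_le_norm _ _
  have hint : ∫ s, ‖ι (v s)‖ ^ 2 ∂timeMeasure T ≤ ‖ι‖ ^ 2 * a ^ 2 := by
    rw [ha, toReal_eLpNorm_two_sq hvL, ← integral_const_mul]
    refine integral_mono ?_ ?_ ?_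
    · exact (ι.comp_memLp' hvL).integrable_norm_pow (by norm_num)
    · exact (hvL.integrable_norm_pow (by norm_num)).const_mul _
    · intro s
      simp only
      rw [← mul_pow]
      gcongr
      exact ι.le_opNorm _
  have hmean : T * ‖ι (v t)‖ ^ 2 ≤ ‖ι‖ ^ 2 * a ^ 2 + T * (2 * (a * b)) := by
    have h1 : ∫ _, (‖ι (v t)‖ ^ 2 - 2 * (a * b)) ∂timeMeasure T ≤
        ∫ s, ‖ι (v s)‖ ^ 2 ∂timeMeasure T := by
      refine integral_mono_ae (integrable_const _) ?_ ?_
      · exact (ι.comp_memLp' hvL).integrable_norm_pow (by norm_num)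
      · filter_upwards [ae_mem_Ioo T] with s hs
        have := hdiff s (Ioo_subset_Icc_self hs)
        linarith
    rw [integral_const, measureReal_def, timeMeasure_univ, ENNReal.toReal_ofReal hT.le,
      smul_eq_mul] at h1
    linarith
  have hfin : ‖ι (v t)‖ ^ 2 ≤ (‖ι‖ ^ 2 / T + 1) * (a + b) ^ 2 := by
    have h1 : ‖ι (v t)‖ ^ 2 ≤ ‖ι‖ ^ 2 / T * a ^ 2 + 2 * (a * b) := by
      have : ‖ι (v t)‖ ^ 2 ≤ (‖ι‖ ^ 2 * a ^ 2 + T * (2 * (a * b))) / T := by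
        rw [le_div_iff₀ hT]
        linarith
      refine this.trans (le_of_eq ?_)
      field_simp
    have h2 : ‖ι‖ ^ 2 / T * a ^ 2 ≤ ‖ι‖ ^ 2 / T * (a + b) ^ 2 := by
      gcongr
      linarith
    nlinarith [sq_nonneg a, sq_nonneg b]
  calc ‖ι (v t)‖ = √(‖ι (v t)‖ ^ 2) := (Real.sqrt_sq (norm_nonneg _)).symm
    _ ≤ √((‖ι‖ ^ 2 / T + 1) * (a + b) ^ 2) := Real.sqrt_le_sqrt hfin
    _ = _ := by rw [Real.sqrt_mul (by positivity), Real.sqrt_sq (by positivity)]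

end Density

/-! ### Functions with vanishing weak derivative. -/

section DuBoisReymond

theorem exists_primitive_of_integral_eq_zero {T : ℝ} (hT : 0 < T) {ρ : ℝ → ℝ} (hρ : Continuous ρ)
    (hc : HasCompactSupport ρ) (hs : tsupport ρ ⊆ Ioo 0 T) (h0 : ∫ t, ρ t = 0) :
    ∃ θ : ℝ → ℝ, ContDiff ℝ 1 θ ∧ HasCompactSupport θ ∧ tsupport θ ⊆ Ioo 0 T ∧ deriv θ = ρ := by
  -- The point T/2 only serves to make the compact set nonempty, so that it has extreme points even
  -- when ρ = 0.
  have hK : IsCompact (insert (T / 2) (tsupport ρ)) := IsCompact.insert hc _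
  have hne : (insert (T / 2) (tsupport ρ)).Nonempty := ⟨_, mem_insert _ _⟩
  have hKs : insert (T / 2) (tsupport ρ) ⊆ Ioo 0 T :=
    insert_subset ⟨by linarith, by linarith⟩ hs
  obtain ⟨a', ha', hamin⟩ := hK.exists_isLeast hne
  obtain ⟨b, hb, hbmax⟩ := hK.exists_isGreatest hne
  have ha'0 := (hKs ha').1
  have ha'b : a' ≤ b := hamin hb
  -- The left end is moved strictly below the support, which then lies in the half-open interval
  -- `Ioc a b`.
  set a := a' / 2 with ha
  have hsupp : Function.support ρ ⊆ Ioc a b := by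
    intro t ht
    have ht' : t ∈ insert (T / 2) (tsupport ρ) := mem_insert_of_mem _ (subset_tsupport _ ht)
    refine ⟨?_, hbmax ht'⟩
    have := hamin ht'
    linarith
  have hder : ∀ t, HasDerivAt (fun t => ∫ s in a..t, ρ s) (ρ t) t :=
    fun t => (hρ.integral_hasStrictDerivAt a t).hasDerivAt
  have hd : deriv (fun t => ∫ s in a..t, ρ s) = ρ := funext fun t => (hder t).deriv
  have hsup : Function.support (fun t => ∫ s in a..t, ρ s) ⊆ Icc a b := by
    intro t ht
    by_contra hcon
    apply ht
    rcases lt_or_ge t a with h | h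
    · change ∫ s in a..t, ρ s = 0
      rw [intervalIntegral.integral_of_ge h.le,
        setIntegral_eq_zero_of_forall_eq_zero, neg_zero]
      intro s hs
      by_contra hne
      exact absurd (hsupp hne).1 (not_lt.mpr hs.2)
    · have hbt : b < t := by
        by_contra hle
        exact hcon ⟨h, not_lt.mp hle⟩
      have h1 := intervalIntegral.integral_eq_integral_of_support_subset (μ := volume)
        (hsupp.trans (Ioc_subset_Ioc_right hbt.le))
      change ∫ s in a..t, ρ s = 0
      rw [h1, h0]
  have hts : tsupport (fun t => ∫ s in a..t, ρ s) ⊆ Icc a b :=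
    closure_minimal hsup isClosed_Icc
  refine ⟨fun t => ∫ s in a..t, ρ s, ?_, ?_, ?_, hd⟩
  · rw [contDiff_one_iff_deriv, hd]
    exact ⟨fun t => (hder t).differentiableAt, hρ⟩
  · exact isCompact_Icc.of_isClosed_subset (isClosed_tsupport _) hts
  · refine hts.trans fun t ht => ⟨?_, ht.2.trans_lt (hKs hb).2⟩
    have := ht.1
    linarith

/-- The lemma of du Bois-Reymond: an integrable function on `(0,T)` whose weak derivative
vanishes is constant. -/
theorem exists_ae_eq_const_of_integral_deriv_smul {H : Type*} [NormedAddCommGroup H]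
    [NormedSpace ℝ H] [CompleteSpace H] {T : ℝ} (hT : 0 < T) {q : ℝ → H}
    (hq : Integrable q (timeMeasure T))
    (h : ∀ θ : ℝ → ℝ, ContDiff ℝ 1 θ → HasCompactSupport θ → tsupport θ ⊆ Ioo 0 T →
      ∫ t, deriv θ t • q t ∂timeMeasure T = 0) :
    ∃ c : H, ∀ᵐ t ∂timeMeasure T, q t = c := by
  -- A bump of integral 1 inside (0,T). Subtracting (∫ g) θ₀ from a test function g leaves mean
  -- zero, hence the derivative of an admissible θ; the constant is the θ₀-weighted mean of q.
  let φ : ContDiffBump (T / 2) := ⟨T / 8, T / 4, by linarith, by linarith⟩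
  set θ₀ : ℝ → ℝ := φ.normed volume with hθ₀
  have hθc : Continuous θ₀ := φ.continuous_normed
  have hθs : tsupport θ₀ ⊆ Ioo 0 T := by
    rw [hθ₀, φ.tsupport_normed_eq, Real.closedBall_eq_Icc]
    intro t ht
    have h1 := ht.1
    have h2 := ht.2
    change T / 2 - T / 4 ≤ t at h1
    change t ≤ T / 2 + T / 4 at h2
    exact ⟨by linarith, by linarith⟩
  have hθcs : HasCompactSupport θ₀ := φ.hasCompactSupport_normed
  have hint : ∀ g : ℝ → ℝ, Continuous g → HasCompactSupport g →
      Integrable (fun t => g t • q t) (timeMeasure T) := by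
    intro g hg hgc
    obtain ⟨C, hC⟩ := hg.bounded_above_of_compact_support hgc
    exact hq.bdd_smul C hg.aestronglyMeasurable (Eventually.of_forall hC)
  refine ⟨∫ t, θ₀ t • q t ∂timeMeasure T, ?_⟩
  set c := ∫ t, θ₀ t • q t ∂timeMeasure T with hc
  have hset : ∀ (g : ℝ → ℝ) (w : ℝ → H), tsupport g ⊆ Ioo 0 T →
      ∫ t, g t • w t ∂timeMeasure T = ∫ t, g t • w t := by
    intro g w hg
    refine setIntegral_eq_integral_of_forall_compl_eq_zero fun t ht => ?_
    rw [image_eq_zero_of_notMem_tsupport fun h => ht (hg h), zero_smul]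
  have hqc : ∀ᵐ t, t ∈ Ioo 0 T → q t - c = 0 := by
    refine isOpen_Ioo.ae_eq_zero_of_integral_contDiff_smul_eq_zero ?_ fun g hg hgc hgs => ?_
    · exact IntegrableOn.locallyIntegrableOn (hq.sub (integrable_const c))
    · set I := ∫ t, g t with hI
      have hgcont : Continuous g := hg.continuous
      have e1 : Integrable (fun t => g t) := hgcont.integrable_of_hasCompactSupport hgc
      have e2 : Integrable (fun t => I * θ₀ t) :=
        (hθc.integrable_of_hasCompactSupport hθcs).const_mul I
      have hsub : tsupport (fun t => g t - I * θ₀ t) ⊆ Ioo 0 T := by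
        refine (tsupport_sub g (fun t => I * θ₀ t)).trans (union_subset hgs ?_)
        exact (tsupport_mul_subset_right).trans hθs
      obtain ⟨θ, h1, h2, h3, h4⟩ := exists_primitive_of_integral_eq_zero hT
        (ρ := fun t => g t - I * θ₀ t) (hgcont.sub (continuous_const.mul hθc))
        (hgc.sub hθcs.mul_left) hsub (by
          rw [integral_sub e1 e2, integral_const_mul, φ.integral_normed, mul_one, sub_self])
      have h5 := h θ h1 h2 h3
      rw [h4] at h5
      simp_rw [sub_smul, mul_smul] at h5
      rw [integral_sub (hint g hgcont hgc) ((hint θ₀ hθc hθcs).fun_smul I), integral_smul,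
        ← hc, sub_eq_zero] at h5
      rw [← hset g _ hgs]
      simp_rw [smul_sub]
      rw [integral_sub (hint g hgcont hgc) (e1.restrict.smul_const c), h5, integral_smul_const]
      have h6 := hset g (fun _ => c) hgs
      rw [integral_smul_const, integral_smul_const] at h6
      rw [h6, sub_self]
  rw [timeMeasure, ae_restrict_iff' measurableSet_Ioo]
  filter_upwards [hqc] with t ht htT
  exact sub_eq_zero.mp (ht htT)

end DuBoisReymond

/-! ### Existence of the weak time derivative and its primitive. -/

section WeakDerivative

variable {L E : Type*} [NormedAddCommGroup L] [InnerProductSpace ℝ L]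
  [NormedAddCommGroup E] [InnerProductSpace ℝ E]

/-- The space of test functions `C¹_c((0,T);H_G)`. -/
def testSpace (G : GradientOperator L E) (T : ℝ) : Submodule ℝ (ℝ → G.Space) where
  carrier := {v | IsTest G T v}
  zero_mem' := by
    refine ⟨contDiff_const, HasCompactSupport.zero, ?_⟩
    rw [tsupport, Function.support_zero, closure_empty]
    exact empty_subset _
  add_mem' {v w} hv hw :=
    ⟨hv.1.add hw.1, hv.2.1.add hw.2.1, (tsupport_add v w).trans (union_subset hv.2.2 hw.2.2)⟩
  smul_mem' c v hv :=
    ⟨hv.1.const_smul c, hv.2.1.smul_left (f := fun _ => c),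
      (tsupport_smul_subset_right (fun _ : ℝ => c) v).trans hv.2.2⟩

theorem IsTest.memLp {G : GradientOperator L E} {T : ℝ} {v : ℝ → G.Space} (hv : IsTest G T v) :
    MemLp v 2 (timeMeasure T) :=
  memLp_timeMeasure_of_continuousOn hv.1.continuous.continuousOn

theorem IsTest.memLp_deriv {G : GradientOperator L E} {T : ℝ} {v : ℝ → G.Space}
    (hv : IsTest G T v) : MemLp (deriv v) 2 (timeMeasure T) :=
  memLp_timeMeasure_of_continuousOn (hv.1.continuous_deriv le_rfl).continuousOn

theorem IsTest.smul_const {G : GradientOperator L E} {T : ℝ} {θ : ℝ → ℝ} (h1 : ContDiff ℝ 1 θ)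
    (h2 : HasCompactSupport θ) (h3 : tsupport θ ⊆ Ioo 0 T) (x : G.Space) :
    IsTest G T fun t => θ t • x :=
  ⟨h1.smul contDiff_const, h2.smul_right,
    (tsupport_smul_subset_left θ (fun _ : ℝ => x)).trans h3⟩

variable [CompleteSpace L] [CompleteSpace E]

/-- The bound in the definition of W says that v ↦ -∫⟪u, v'⟫ is continuous for the L²(H_G) norm on
test functions. Hahn-Banach extends it to L²(0,T;H_G), where the Riesz theorem represents it. -/
theorem MemW.exists_isTimeDeriv {G : GradientOperator L E} {T : ℝ} {u : ℝ → G.Space}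
    (hu : MemW G T u) : ∃ u', IsTimeDeriv G T u u' := by
  obtain ⟨huL, C, hC, hbound⟩ := hu
  have hι : MemLp (fun t => G.incl (u t)) 2 (timeMeasure T) := G.incl.comp_memLp' huL
  have hint : ∀ v : testSpace G T,
      Integrable (fun t => ⟪G.incl (u t), G.incl (deriv v.1 t)⟫) (timeMeasure T) := fun v =>
    integrable_inner_of_memLp hι (G.incl.comp_memLp' (IsTest.memLp_deriv v.2))
  let e : testSpace G T →ₗ[ℝ] Lp G.Space 2 (timeMeasure T) :=
    { toFun := fun v => (IsTest.memLp v.2).toLp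
      map_add' := fun v w => MemLp.toLp_add (IsTest.memLp v.2) (IsTest.memLp w.2)
      map_smul' := fun c v => MemLp.toLp_const_smul c (IsTest.memLp v.2) }
  let f : testSpace G T →ₗ[ℝ] ℝ :=
    { toFun := fun v => -∫ t, ⟪G.incl (u t), G.incl (deriv v.1 t)⟫ ∂timeMeasure T
      map_add' := fun v w => by
        rw [← neg_add, ← integral_add (hint v) (hint w)]
        congr 2
        funext t
        have := deriv_add ((v.2.1.differentiable one_ne_zero) t)
          ((w.2.1.differentiable one_ne_zero) t)
        rw [Submodule.coe_add, this, map_add, inner_add_right]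
      map_smul' := fun c v => by
        rw [RingHom.id_apply, smul_eq_mul, mul_neg, ← integral_const_mul]
        congr 2
        funext t
        have := deriv_const_smul c ((v.2.1.differentiable one_ne_zero) t)
        rw [Submodule.coe_smul, this, map_smul, inner_smul_right] }
  have hfe : ∀ v, ‖f v‖ ≤ C * ‖e v‖ := by
    -- The definition of W bounds one sign only; the other follows by replacing v with -v.
    have h1 : ∀ v, -f v ≤ C * ‖e v‖ := by
      intro v
      change - -_ ≤ C * ‖(IsTest.memLp v.2).toLp‖
      rw [neg_neg, Lp.norm_toLp]
      exact hbound v.1 v.2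
    intro v
    rw [Real.norm_eq_abs, abs_le]
    have h2 := h1 (-v)
    rw [map_neg, map_neg, norm_neg, neg_neg] at h2
    exact ⟨by linarith [h1 v], h2⟩
  -- The bound by ‖e v‖ lets f descend to the range of e; extension to all of L² is the next step.
  have hdense : DenseRange e.rangeRestrict := (LinearMap.surjective_rangeRestrict e).denseRange
  obtain ⟨g, hg, -⟩ := exists_extension_norm_eq (LinearMap.range e)
    (f.extendOfNorm e.rangeRestrict)
  have hge : ∀ v, g (e v) = f v := by
    intro v
    rw [← LinearMap.extendOfNorm_eq hdense ⟨C, hfe⟩ v, ← hg]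
    rfl
  set z := (InnerProductSpace.toDual ℝ (Lp G.Space 2 (timeMeasure T))).symm g with hz
  refine ⟨fun t => innerSL ℝ (z t), (innerSL ℝ).comp_memLp' (Lp.memLp z), fun v hv => ?_⟩
  have h1 : ⟪z, e ⟨v, hv⟩⟫ = f ⟨v, hv⟩ := by
    rw [hz, InnerProductSpace.toDual_symm_apply, hge]
  rw [L2.inner_def] at h1
  refine Eq.trans (integral_congr_ae ?_) h1
  filter_upwards [hv.memLp.coeFn_toLp] with t ht
  change _ = ⟪z t, hv.memLp.toLp v t⟫
  rw [ht, innerSL_apply_apply]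

theorem MemW.isTimeDeriv_timeDeriv {G : GradientOperator L E} {T : ℝ} {u : ℝ → G.Space}
    (hu : MemW G T u) : IsTimeDeriv G T u (timeDeriv G T u) := by
  have h := hu.exists_isTimeDeriv
  rw [timeDeriv, dif_pos h]
  exact h.choose_spec

/-- The primitive of an L² function is absolutely continuous, so integration by parts holds, and θ
vanishes at both ends. -/
theorem integral_deriv_mul_primitive {T : ℝ} (hT : 0 < T) {ζ θ : ℝ → ℝ}
    (hζ : MemLp ζ 2 (timeMeasure T)) (h1 : ContDiff ℝ 1 θ) (h3 : tsupport θ ⊆ Ioo 0 T) :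
    ∫ t, deriv θ t * (∫ s in 0..t, ζ s) ∂timeMeasure T = -∫ t, θ t * ζ t ∂timeMeasure T := by
  have hT0 : (0 : ℝ) ∈ Icc 0 T := ⟨le_rfl, hT.le⟩
  have hTT : T ∈ Icc 0 T := ⟨hT.le, le_rfl⟩
  have hi := intervalIntegrable_of_memLp hζ hT0 hTT
  have hac := hi.absolutelyContinuousOnInterval_intervalIntegral (c := 0) left_mem_uIcc
  have hθ : AbsolutelyContinuousOnInterval θ 0 T :=
    h1.contDiffOn.absolutelyContinuousOnInterval
  have hθ0 : θ 0 = 0 := image_eq_zero_of_notMem_tsupport fun h => lt_irrefl _ (h3 h).1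
  have hθT : θ T = 0 := image_eq_zero_of_notMem_tsupport fun h => lt_irrefl _ (h3 h).2
  have key := hac.integral_mul_deriv_eq_deriv_mul hθ
  rw [hθ0, hθT, mul_zero, mul_zero, sub_zero, zero_sub] at key
  have conv : ∀ f : ℝ → ℝ, ∫ t, f t ∂timeMeasure T = ∫ t in 0..T, f t := fun f => by
    rw [timeMeasure, intervalIntegral.integral_of_le hT.le, integral_Ioc_eq_integral_Ioo]
  rw [conv, conv]
  simp_rw [mul_comm (deriv θ _)]
  rw [key, neg_inj]
  refine intervalIntegral.integral_congr_ae ?_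
  filter_upwards [hi.ae_hasDerivAt_integral] with t ht htT
  rw [(ht (uIoc_subset_uIcc htT) 0 left_mem_uIcc).deriv, mul_comm]

/-- Testing with θ(t) φ for fixed φ in H_G shows that K u - ∫ z, with K the Gram operator of
`G.incl`, has zero weak derivative, so it is constant. -/
theorem IsTimeDeriv.exists_primitive {G : GradientOperator L E} {T : ℝ} (hT : 0 < T)
    {u : ℝ → G.Space} {u' : ℝ → StrongDual ℝ G.Space} (hu : MemLp u 2 (timeMeasure T))
    (h : IsTimeDeriv G T u u') :
    ∃ ξ : G.Space, ∀ᵐ t ∂timeMeasure T, gram G.incl (u t) =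
      ξ + ∫ s in 0..t, (InnerProductSpace.toDual ℝ G.Space).symm (u' s) := by
  set z : ℝ → G.Space := fun t => (InnerProductSpace.toDual ℝ G.Space).symm (u' t) with hzdef
  have hz : MemLp z 2 (timeMeasure T) :=
    (InnerProductSpace.toDual ℝ G.Space).symm.toContinuousLinearEquiv.toContinuousLinearMap.comp_memLp'
      h.1
  have hK : MemLp (fun t => gram G.incl (u t)) 2 (timeMeasure T) := (gram G.incl).comp_memLp' hu
  have hT0 : (0 : ℝ) ∈ Icc 0 T := ⟨le_rfl, hT.le⟩
  have hTT : T ∈ Icc 0 T := ⟨hT.le, le_rfl⟩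
  have hprimc : ContinuousOn (fun t => ∫ s in 0..t, z s) (Icc 0 T) := by
    have hint : IntegrableOn z (Icc 0 T) := by
      rw [integrableOn_Icc_iff_integrableOn_Ioo]
      exact hz.integrable (by norm_num)
    exact intervalIntegral.continuousOn_primitive_interval (by rwa [uIcc_of_le hT.le]) |>.mono
      (by rw [uIcc_of_le hT.le])
  have hprim : MemLp (fun t => ∫ s in 0..t, z s) 2 (timeMeasure T) :=
    memLp_timeMeasure_of_continuousOn hprimc
  have hq : Integrable (fun t => gram G.incl (u t) - ∫ s in 0..t, z s) (timeMeasure T) :=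
    (hK.sub hprim).integrable (by norm_num)
  suffices hweak : ∀ θ : ℝ → ℝ, ContDiff ℝ 1 θ → HasCompactSupport θ → tsupport θ ⊆ Ioo 0 T →
      ∫ t, deriv θ t • (gram G.incl (u t) - ∫ s in 0..t, z s) ∂timeMeasure T = 0 by
    obtain ⟨c, hc⟩ := exists_ae_eq_const_of_integral_deriv_smul hT hq hweak
    refine ⟨c, ?_⟩
    filter_upwards [hc] with t ht
    rw [← ht]
    abel
  · intro θ h1 h2 h3
    refine ext_inner_right ℝ fun φ => ?_
    have hθ' : MemLp (deriv θ) 2 (timeMeasure T) :=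
      memLp_timeMeasure_of_continuousOn (h1.continuous_deriv le_rfl).continuousOn
    have hθb : ∃ C, ∀ x, ‖deriv θ x‖ ≤ C :=
      (h1.continuous_deriv le_rfl).bounded_above_of_compact_support h2.deriv
    obtain ⟨C, hC⟩ := hθb
    have hi : Integrable (fun t => deriv θ t • (gram G.incl (u t) - ∫ s in 0..t, z s))
        (timeMeasure T) := hq.bdd_smul C hθ'.1 (Eventually.of_forall hC)
    rw [inner_zero_left, real_inner_comm, ← integral_inner hi]
    have hpt : ∀ᵐ t ∂timeMeasure T,
        ⟪φ, deriv θ t • (gram G.incl (u t) - ∫ s in 0..t, z s)⟫ =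
        ⟪G.incl (u t), G.incl (deriv (fun t => θ t • φ) t)⟫ -
          deriv θ t * ∫ s in 0..t, ⟪φ, z s⟫ := by
      filter_upwards [ae_mem_Ioo T] with t ht
      have hd : deriv (fun t => θ t • φ) t = deriv θ t • φ :=
        deriv_smul_const ((h1.differentiable one_ne_zero) t) φ
      have hin : ⟪φ, ∫ s in 0..t, z s⟫ = ∫ s in 0..t, ⟪φ, z s⟫ := by
        have := (innerSL ℝ φ).intervalIntegral_comp_comm
          (intervalIntegrable_of_memLp hz hT0 (Ioo_subset_Icc_self ht))
        exact this.symm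
      rw [hd, map_smul, inner_smul_right, inner_smul_right, inner_sub_right, hin,
        real_inner_comm (gram G.incl (u t)) φ, inner_gram, mul_sub]
    have htest := IsTest.smul_const h1 h2 h3 φ
    have i1 : Integrable (fun t => ⟪G.incl (u t), G.incl (deriv (fun t => θ t • φ) t)⟫)
        (timeMeasure T) :=
      integrable_inner_of_memLp (G.incl.comp_memLp' hu) (G.incl.comp_memLp' htest.memLp_deriv)
    have hφz : MemLp (fun s => ⟪φ, z s⟫) 2 (timeMeasure T) := (innerSL ℝ φ).comp_memLp' hz
    have hpz : ContinuousOn (fun t => ∫ s in 0..t, ⟪φ, z s⟫) (Icc 0 T) := by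
      refine (continuousOn_const.inner hprimc (𝕜 := ℝ) (f := fun _ => φ)).congr fun t ht => ?_
      exact (innerSL ℝ φ).intervalIntegral_comp_comm (intervalIntegrable_of_memLp hz hT0 ht)
    have i2 : Integrable (fun t => deriv θ t * ∫ s in 0..t, ⟪φ, z s⟫) (timeMeasure T) :=
      ((memLp_timeMeasure_of_continuousOn hpz).integrable (by norm_num)).bdd_mul hθ'.1
        (Eventually.of_forall hC)
    rw [integral_congr_ae hpt, integral_sub i1 i2, integral_deriv_mul_primitive hT hφz h1 h3]
    have hw := h.2 _ htest
    rw [← neg_eq_iff_eq_neg] at hw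
    rw [← hw, sub_neg_eq_add, neg_add_eq_zero]
    refine integral_congr_ae (Eventually.of_forall fun t => ?_)
    simp only [hzdef, map_smul, smul_eq_mul]
    rw [real_inner_comm, InnerProductSpace.toDual_symm_apply]

end WeakDerivative

/-! ### The representative in C([0,T];L) and C¹ approximation. -/

section ContinuousRepresentative

variable {L E : Type*} [NormedAddCommGroup L] [InnerProductSpace ℝ L]
  [NormedAddCommGroup E] [InnerProductSpace ℝ E] [CompleteSpace L] [CompleteSpace E]

/-- The Riesz representative in `H_G` of the weak time derivative. -/
def rieszDeriv (G : GradientOperator L E) (T : ℝ) (u : ℝ → G.Space) (t : ℝ) : G.Space :=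
  (InnerProductSpace.toDual ℝ G.Space).symm (timeDeriv G T u t)

theorem MemW.memLp_rieszDeriv {G : GradientOperator L E} {T : ℝ} {u : ℝ → G.Space}
    (hu : MemW G T u) : MemLp (rieszDeriv G T u) 2 (timeMeasure T) :=
  (InnerProductSpace.toDual ℝ G.Space).symm.toContinuousLinearEquiv.toContinuousLinearMap.comp_memLp'
      hu.isTimeDeriv_timeDeriv.1

/-- Elements of `W` are approximated in `W`, and uniformly in `L`, by elements of
`C¹([0,T];H_G)`. -/
theorem MemW.exists_contDiff_approx {G : GradientOperator L E} {T : ℝ} (hT : 0 < T)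
    {u : ℝ → G.Space} (hu : MemW G T u) {δ : ℝ} (hδ : 0 < δ) :
    ∃ v : ℝ → G.Space, ContDiff ℝ 1 v ∧
      eLpNorm (fun t => v t - u t) 2 (timeMeasure T) ≤ ENNReal.ofReal δ ∧
      eLpNorm (fun t => gram G.incl (deriv v t) - rieszDeriv G T u t) 2 (timeMeasure T) ≤
        ENNReal.ofReal δ ∧
      ∀ t ∈ Icc 0 T, ‖contRep G T u t - G.incl (v t)‖ ≤ δ := by
  have huL := hu.1
  have hz := hu.memLp_rieszDeriv
  obtain ⟨ξ, hξ⟩ := hu.isTimeDeriv_timeDeriv.exists_primitive hT huL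
  obtain ⟨C, hC0, hC⟩ := exists_energy_bound (H := G.Space) G.incl hT
  set η : ℕ → ℝ := fun j => 1 / ((j : ℝ) + 1) with hη
  have hη0 : ∀ j, 0 < η j := fun j => Nat.one_div_pos_of_nat
  have hηlim : Tendsto η atTop (𝓝 0) := tendsto_one_div_add_atTop_nhds_zero_nat
  choose v hv hvu hvz using fun j => ParabolicGDM.exists_contDiff_approx G.inclₗ_injective huL hz hξ
    (η := ENNReal.ofReal (η j)) (by simpa using hη0 j)
  have hvL : ∀ j, MemLp (v j) 2 (timeMeasure T) := fun j =>
    memLp_timeMeasure_of_continuousOn (hv j).continuous.continuousOn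
  have hKL : ∀ j, MemLp (fun t => gram G.incl (deriv (v j) t)) 2 (timeMeasure T) := fun j =>
    memLp_timeMeasure_of_continuousOn
      ((gram G.incl).continuous.comp ((hv j).continuous_deriv le_rfl)).continuousOn
  have htri : ∀ (f : ℕ → ℝ → G.Space) (w : ℝ → G.Space),
      (∀ j, MemLp (f j) 2 (timeMeasure T)) → MemLp w 2 (timeMeasure T) →
      (∀ j, eLpNorm (fun t => f j t - w t) 2 (timeMeasure T) ≤ ENNReal.ofReal (η j)) →
      ∀ i j, (eLpNorm (fun t => f i t - f j t) 2 (timeMeasure T)).toReal ≤ η i + η j := by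
    intro f w hf hw hfw i j
    refine ENNReal.toReal_le_of_le_ofReal (add_nonneg (hη0 i).le (hη0 j).le) ?_
    have e : (fun t => f i t - f j t) = (fun t => f i t - w t) - fun t => f j t - w t := by
      funext t
      rw [Pi.sub_apply]
      abel
    rw [e, ENNReal.ofReal_add (hη0 i).le (hη0 j).le]
    exact (eLpNorm_sub_le ((hf i).1.sub hw.1) ((hf j).1.sub hw.1) (by norm_num)).trans
      (add_le_add (hfw i) (hfw j))
  -- The energy bound applied to the difference of two approximants: both L² distances are at most η
  -- i + η j, whence the factor 2. The sequence is thus uniformly Cauchy in L.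
  have hdist : ∀ i j, ∀ t ∈ Icc 0 T, ‖G.incl (v i t) - G.incl (v j t)‖ ≤ 2 * C * (η i + η j) := by
    intro i j t ht
    have h1 := hC (fun s => v i s - v j s) ((hv i).sub (hv j)) t ht
    rw [map_sub] at h1
    refine h1.trans ?_
    have h2 := htri v u hvL huL hvu i j
    have h3 := htri (fun j t => gram G.incl (deriv (v j) t)) _ hKL hz hvz i j
    have h4 : (fun s => gram G.incl (deriv (fun s => v i s - v j s) s)) =
        fun s => gram G.incl (deriv (v i) s) - gram G.incl (deriv (v j) s) := by
      funext s
      rw [deriv_fun_sub ((hv i).differentiable one_ne_zero s)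
        ((hv j).differentiable one_ne_zero s), map_sub]
    rw [h4]
    nlinarith
  have hlim0 : ∀ i, Tendsto (fun j => 2 * C * (η i + η j)) atTop (𝓝 (2 * C * (η i + 0))) :=
    fun i => (hηlim.const_add (η i)).const_mul _
  have hcau : ∀ t, ∃ y, t ∈ Icc 0 T → Tendsto (fun j => G.incl (v j t)) atTop (𝓝 y) := by
    intro t
    by_cases ht : t ∈ Icc 0 T
    · have : CauchySeq fun j => G.incl (v j t) := by
        refine cauchySeq_of_le_tendsto_0 (fun n => 2 * C * (η n + η n)) (fun i j n hi hj => ?_) ?_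
        · rw [dist_eq_norm]
          refine (hdist i j t ht).trans ?_
          have hmono : ∀ m, n ≤ m → η m ≤ η n := fun m hm => Nat.one_div_le_one_div hm
          have := hmono i hi
          have := hmono j hj
          gcongr
        · simpa using (hηlim.add hηlim).const_mul (2 * C)
      obtain ⟨y, hy⟩ := cauchySeq_tendsto_of_complete this
      exact ⟨y, fun _ => hy⟩
    · exact ⟨0, fun h => absurd h ht⟩
  choose y hy using hcau
  have hyv : ∀ j, ∀ t ∈ Icc 0 T, ‖y t - G.incl (v j t)‖ ≤ 2 * C * η j := by
    intro j t ht
    have h1 := ((hy t ht).const_sub (G.incl (v j t))).norm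
    rw [norm_sub_rev]
    have h2 := le_of_tendsto_of_tendsto' h1 (hlim0 j) fun i => hdist j i t ht
    rwa [add_zero] at h2
  have hunif : TendstoUniformlyOn (fun j t => G.incl (v j t)) y atTop (Icc 0 T) := by
    rw [Metric.tendstoUniformlyOn_iff]
    intro ε hε
    have : Tendsto (fun j => 2 * C * η j) atTop (𝓝 0) := by simpa using hηlim.const_mul (2 * C)
    filter_upwards [this.eventually (gt_mem_nhds hε)] with j hj t ht
    rw [dist_eq_norm]
    exact (hyv j t ht).trans_lt hj
  have hyc : ContinuousOn y (Icc 0 T) := hunif.continuousOn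
    (Eventually.of_forall fun j => (G.incl.continuous.comp (hv j).continuous).continuousOn).frequently
  have hιu : MemLp (fun t => G.incl (u t)) 2 (timeMeasure T) := G.incl.comp_memLp' huL
  have hyL : MemLp y 2 (timeMeasure T) := memLp_timeMeasure_of_continuousOn hyc
  have hyae : y =ᵐ[timeMeasure T] fun t => G.incl (u t) := by
    have hle : ∀ j, eLpNorm (fun t => y t - G.incl (u t)) 2 (timeMeasure T) ≤
        timeMeasure T univ ^ (2⁻¹ : ℝ) * ENNReal.ofReal (2 * C * η j) +
          ENNReal.ofReal ‖G.incl‖ * ENNReal.ofReal (η j) := by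
      intro j
      have e : (fun t => y t - G.incl (u t)) =
          (fun t => y t - G.incl (v j t)) + fun t => G.incl (v j t - u t) := by
        funext t
        rw [Pi.add_apply, map_sub]
        abel
      rw [e]
      refine (eLpNorm_add_le ?_ ?_ (by norm_num)).trans (add_le_add ?_ ?_)
      · exact hyL.1.sub (G.incl.comp_memLp' (hvL j)).1
      · exact G.incl.continuous.comp_aestronglyMeasurable ((hvL j).1.sub huL.1)
      · refine eLpNorm_two_le_of_bound ?_
        filter_upwards [ae_mem_Ioo T] with t ht
        exact hyv j t (Ioo_subset_Icc_self ht)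
      · refine (eLpNorm_le_mul_eLpNorm_of_ae_le_mul
          (Eventually.of_forall fun t => G.incl.le_opNorm _) 2).trans ?_
        gcongr
        exact hvu j
    have hlim : Tendsto (fun j => timeMeasure T univ ^ (2⁻¹ : ℝ) * ENNReal.ofReal (2 * C * η j) +
          ENNReal.ofReal ‖G.incl‖ * ENNReal.ofReal (η j)) atTop (𝓝 0) := by
      have h1 : Tendsto (fun j => ENNReal.ofReal (2 * C * η j)) atTop (𝓝 0) := by
        simpa using ENNReal.tendsto_ofReal (hηlim.const_mul (2 * C))
      have h2 : Tendsto (fun j => ENNReal.ofReal (η j)) atTop (𝓝 0) := by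
        simpa using ENNReal.tendsto_ofReal hηlim
      have h3 : timeMeasure T univ ^ (2⁻¹ : ℝ) ≠ ∞ :=
        ENNReal.rpow_ne_top_of_nonneg (by norm_num) (measure_ne_top _ _)
      simpa using (ENNReal.Tendsto.const_mul h1 (Or.inr h3)).add
        (ENNReal.Tendsto.const_mul h2 (Or.inr ENNReal.ofReal_ne_top))
    have h0 : eLpNorm (fun t => y t - G.incl (u t)) 2 (timeMeasure T) = 0 :=
      le_antisymm (ge_of_tendsto' hlim hle) zero_le
    have h1 := (eLpNorm_eq_zero_iff (hyL.1.sub hιu.1) (by norm_num)).mp h0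
    filter_upwards [h1] with t ht
    exact sub_eq_zero.mp ht
  have hrep : ∃ g : ℝ → L, ContinuousOn g (Icc 0 T) ∧
      g =ᵐ[timeMeasure T] fun t => G.incl (u t) := ⟨y, hyc, hyae⟩
  -- Two continuous functions that agree almost everywhere agree on the closed interval; this
  -- identifies the arbitrary choice inside `contRep`, also at the end points.
  have hcr : EqOn (contRep G T u) y (Icc 0 T) := by
    have h1 : ContinuousOn (contRep G T u) (Icc 0 T) ∧
        contRep G T u =ᵐ[timeMeasure T] fun t => G.incl (u t) := by
      rw [contRep, dif_pos hrep]
      exact hrep.choose_spec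
    refine Measure.eqOn_Icc_of_ae_eq volume hT.ne ?_ h1.1 hyc
    rw [← restrict_Ioo_eq_restrict_Icc]
    exact h1.2.trans hyae.symm
  have hev : ∀ᶠ j in atTop, η j < δ ∧ 2 * C * η j < δ := by
    have : Tendsto (fun j => 2 * C * η j) atTop (𝓝 0) := by simpa using hηlim.const_mul (2 * C)
    exact (hηlim.eventually (gt_mem_nhds hδ)).and (this.eventually (gt_mem_nhds hδ))
  obtain ⟨j, hj1, hj2⟩ := hev.exists
  refine ⟨v j, hv j, (hvu j).trans (ENNReal.ofReal_le_ofReal hj1.le),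
    (hvz j).trans (ENNReal.ofReal_le_ofReal hj1.le), fun t ht => ?_⟩
  rw [hcr ht]
  exact (hyv j t ht).trans hj2.le

end ContinuousRepresentative

/-! ### Comparison of the weighted norm with the norm of E. -/

section WeightedNorm

variable {E : Type*} [NormedAddCommGroup E] [InnerProductSpace ℝ E]

theorem weightedNorm_le (S : E →L[ℝ] E) (ξ : E) : weightedNorm S ξ ≤ √‖S‖ * ‖ξ‖ := by
  rw [weightedNorm, ← Real.sqrt_sq (norm_nonneg ξ), ← Real.sqrt_mul (norm_nonneg _)]
  refine Real.sqrt_le_sqrt ?_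
  calc ⟪S ξ, ξ⟫ ≤ ‖S ξ‖ * ‖ξ‖ := real_inner_le_norm _ _
    _ ≤ ‖S‖ * ‖ξ‖ * ‖ξ‖ := by gcongr; exact S.le_opNorm _
    _ = ‖S‖ * ‖ξ‖ ^ 2 := by ring

theorem le_weightedNorm {S : E →L[ℝ] E} {c : ℝ} (hc : 0 ≤ c)
    (h : ∀ ξ : E, c * ‖ξ‖ ^ 2 ≤ ⟪S ξ, ξ⟫) (ξ : E) : √c * ‖ξ‖ ≤ weightedNorm S ξ := by
  rw [weightedNorm, ← Real.sqrt_sq (norm_nonneg ξ), ← Real.sqrt_mul hc]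
  exact Real.sqrt_le_sqrt (by simpa using h ξ)

theorem weightedNorm_nonneg (S : E →L[ℝ] E) (ξ : E) : 0 ≤ weightedNorm S ξ := Real.sqrt_nonneg _

end WeightedNorm

/-- If `a ‖ξ‖² ≤ b ‖ξ‖` then `‖ξ‖ ≤ b / a`. -/
theorem le_div_of_mul_sq_le {a b x : ℝ} (ha : 0 < a) (hb : 0 ≤ b) (hx : 0 ≤ x)
    (h : a * x ^ 2 ≤ b * x) : x ≤ b / a := by
  rcases hx.eq_or_lt with rfl | hx
  · positivity
  · rw [le_div_iff₀ ha]
    nlinarith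

/-! ### The weighted Riesz operator as a bounded linear map. -/

section Riesz

variable {L E : Type*} [NormedAddCommGroup L] [InnerProductSpace ℝ L]
  [NormedAddCommGroup E] [InnerProductSpace ℝ E]

theorem GradientOperator.norm_grad (G : GradientOperator L E) (x : G.Space) :
    ‖G.grad x‖ = ‖x‖ := (G.norm_def x).symm

theorem GradientOperator.IsDiv.div_eq {G : GradientOperator L E} {v : E} {w : L}
    (h : G.IsDiv v w) : G.div v = w :=
  (G.isDiv_div ⟨w, h⟩).unique h

variable [CompleteSpace L] [CompleteSpace E]

/-- Uniqueness from coercivity of S. The operator is defined by choice, so its linearity has to be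
deduced from this. -/
theorem GradientOperator.riesz_eq (G : GradientOperator L E) {S : E ≃L[ℝ] E}
    (hS : (S : E →L[ℝ] E).IsPositive) {ξ : StrongDual ℝ G.Space} {r : G.Space}
    (h : ∀ x : G.Space, ⟪S (G.grad r), G.grad x⟫ = ξ x) : G.riesz S ξ = r := by
  obtain ⟨c, hc, hcoer⟩ := coercive_of_isPositive hS
  have h1 := hcoer (G.grad (G.riesz S ξ - r))
  have h2 : ⟪S (G.grad (G.riesz S ξ - r)), G.grad (G.riesz S ξ - r)⟫ = 0 := by
    rw [map_sub G.grad, map_sub S, inner_sub_left, ← map_sub G.grad, G.inner_riesz hS, h, sub_self]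
  rw [h2, G.norm_grad] at h1
  have h3 : ‖G.riesz S ξ - r‖ ^ 2 ≤ 0 := by
    by_contra hcon
    push Not at hcon
    have := mul_pos hc hcon
    linarith
  have h4 : ‖G.riesz S ξ - r‖ = 0 := by
    have := le_antisymm h3 (by positivity)
    exact pow_eq_zero_iff (two_ne_zero) |>.mp this
  exact sub_eq_zero.mp (norm_eq_zero.mp h4)

/-- The operator `A` on `H_G` with `⟪S G (A z), G x⟫ = ⟪G z, G x⟫`. -/
theorem GradientOperator.exists_rieszMap (G : GradientOperator L E) {S : E ≃L[ℝ] E}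
    (hS : (S : E →L[ℝ] E).IsPositive) :
    ∃ A : G.Space →L[ℝ] G.Space, (∀ z x, ⟪S (G.grad (A z)), G.grad x⟫ = ⟪z, x⟫) ∧
      ∀ ξ : StrongDual ℝ G.Space,
        G.riesz S ξ = A ((InnerProductSpace.toDual ℝ G.Space).symm ξ) := by
  obtain ⟨c, hc, hcoer⟩ := coercive_of_isPositive hS
  have hin : ∀ z x : G.Space, ⟪S (G.grad (G.riesz S (innerSL ℝ z))), G.grad x⟫ = ⟪z, x⟫ :=
    fun z x => G.inner_riesz hS (innerSL ℝ z) x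
  let A₀ : G.Space →ₗ[ℝ] G.Space :=
    { toFun := fun z => G.riesz S (innerSL ℝ z)
      map_add' := fun z w => G.riesz_eq hS fun x => by
        rw [map_add G.grad, map_add S, inner_add_left, hin, hin, innerSL_apply_apply,
          inner_add_left]
      map_smul' := fun a z => G.riesz_eq hS fun x => by
        rw [map_smul G.grad, map_smul S, inner_smul_left, hin, innerSL_apply_apply,
          inner_smul_left, RingHom.id_apply] }
  have hb : ∀ z, ‖A₀ z‖ ≤ 1 / c * ‖z‖ := by
    intro z
    rw [one_div, inv_mul_eq_div]
    refine le_div_of_mul_sq_le hc (norm_nonneg _) (norm_nonneg _) ?_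
    have h1 := hcoer (G.grad (A₀ z))
    rw [show ⟪S (G.grad (A₀ z)), G.grad (A₀ z)⟫ = ⟪z, A₀ z⟫ from hin z _, G.norm_grad] at h1
    exact h1.trans (real_inner_le_norm _ _)
  refine ⟨A₀.mkContinuous (1 / c) hb, hin, fun ξ => ?_⟩
  change _ = G.riesz S (innerSL ℝ ((InnerProductSpace.toDual ℝ G.Space).symm ξ))
  congr 1
  ext x
  rw [innerSL_apply_apply, InnerProductSpace.toDual_symm_apply]

/-- Places the flux of A(ι*ι x) in H_D, so that limit-conformity can be applied to it; A composed
with ι*ι is the limit of the discrete Riesz operators. -/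
theorem GradientOperator.isDiv_of_gram (G : GradientOperator L E) {S : E ≃L[ℝ] E}
    {A : G.Space →L[ℝ] G.Space} (hA : ∀ z x, ⟪S (G.grad (A z)), G.grad x⟫ = ⟪z, x⟫)
    (x : G.Space) : G.IsDiv (S (G.grad (A (gram G.incl x)))) (-G.incl x) := by
  intro y
  rw [hA, inner_gram, inner_neg_left]
  ring

end Riesz

/-! ### The uniform discrete Poincaré inequality. -/

section Discrete

variable {L E : Type*} [NormedAddCommGroup L] [InnerProductSpace ℝ L]
  [NormedAddCommGroup E] [InnerProductSpace ℝ E]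

namespace GradientDiscretisation

theorem abs_le_zeta_mul (D : GradientDiscretisation.{v} L E) (G : GradientOperator L E)
    {S : E ≃L[ℝ] E} (hS : (S : E →L[ℝ] E).IsPositive) {φ : E} (h : D.zeta G S φ ≠ ∞) (z : D.X) :
    |⟪φ, D.Gr z⟫ + ⟪G.div φ, D.P z⟫| ≤
      (D.zeta G S φ).toReal * weightedNorm (S : E →L[ℝ] E) (D.Gr z) := by
  obtain ⟨c, hc, hcoer⟩ := coercive_of_isPositive hS
  by_cases hz : z = 0
  · simp [hz, weightedNorm]
  have hGz : 0 < ‖D.Gr z‖ :=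
    lt_of_le_of_ne (norm_nonneg _) fun h => hz (D.eq_zero_of_norm_Gr z h.symm)
  have hpos : 0 < weightedNorm (S : E →L[ℝ] E) (D.Gr z) :=
    lt_of_lt_of_le (mul_pos (Real.sqrt_pos.mpr hc) hGz) (le_weightedNorm hc.le hcoer _)
  rw [← div_le_iff₀ hpos, ← ENNReal.ofReal_le_iff_le_toReal h]
  exact le_iSup₂ (f := fun (z : D.X) (_ : z ≠ 0) => ENNReal.ofReal
    (|⟪φ, D.Gr z⟫ + ⟪G.div φ, D.P z⟫| / weightedNorm (S : E →L[ℝ] E) (D.Gr z))) z hz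

theorem Gr_injective (D : GradientDiscretisation.{v} L E) : Function.Injective D.Gr := by
  rw [← LinearMap.ker_eq_bot, LinearMap.ker_eq_bot']
  intro z hz
  exact D.eq_zero_of_norm_Gr z (by rw [hz, norm_zero])

/-- Finite dimension gives a constant for one discretisation. It is needed only for the finitely
many indices at which the conformity error is not yet small. -/
theorem exists_norm_P_le (D : GradientDiscretisation.{v} L E) :
    ∃ C, 0 ≤ C ∧ ∀ z, ‖D.P z‖ ≤ C * ‖D.Gr z‖ := by
  let e := LinearEquiv.ofInjective D.Gr D.Gr_injective
  let f : LinearMap.range D.Gr →ₗ[ℝ] L := D.P.comp e.symm.toLinearMap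
  refine ⟨‖LinearMap.toContinuousLinearMap f‖, ContinuousLinearMap.opNorm_nonneg _, fun z => ?_⟩
  have h := (LinearMap.toContinuousLinearMap f).le_opNorm (e z)
  have h1 : LinearMap.toContinuousLinearMap f (e z) = D.P z := by
    simp [f]
  rw [h1] at h
  exact h

variable [CompleteSpace L] [CompleteSpace E]

/-- The uniform discrete Poincaré inequality for limit-conforming gradient discretisations. -/
theorem exists_poincare (G : GradientOperator L E) {S : E ≃L[ℝ] E}
    (hS : (S : E →L[ℝ] E).IsPositive) {D : ℕ → GradientDiscretisation.{v} L E}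
    (hconf : ∀ φ ∈ G.HD, Tendsto (fun n => (D n).zeta G S φ) atTop (𝓝 0)) :
    ∃ C, 0 < C ∧ ∀ n z, ‖(D n).P z‖ ≤ C * ‖(D n).Gr z‖ := by
  choose K hK0 hK using fun n => (D n).exists_norm_P_le
  -- Banach-Steinhaus runs over all pairs (n, z) at once. For z = 0 the functional is 0, as 0⁻¹ = 0.
  let g : (Σ n, (D n).X) → L →L[ℝ] ℝ := fun p =>
    ‖(D p.1).Gr p.2‖⁻¹ • innerSL ℝ ((D p.1).P p.2)
  obtain ⟨C, hC⟩ := banach_steinhaus (g := g) fun y => by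
    set r := G.riesz S (G.embedDual y) with hr
    -- Every y in L is minus a divergence, so limit-conformity trades ⟪P z, y⟫ for ⟪Gr z, ψ⟫, up to
    -- ζ(ψ) times the weighted norm of Gr z.
    have hdiv : G.IsDiv (S (G.grad r)) (-y) := by
      intro x
      rw [G.inner_riesz hS, inner_neg_left]
      change ⟪y, G.incl x⟫ + _ = 0
      ring
    set ψ := S (G.grad r) with hψ
    have hev := (hconf ψ ⟨_, hdiv⟩).eventually (ge_mem_nhds (show (0 : ℝ≥0∞) < 1 by norm_num))
    obtain ⟨n0, hn0⟩ := hev.exists_forall_of_atTop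
    set B := √‖(S : E →L[ℝ] E)‖ + ‖ψ‖ + ∑ n ∈ Finset.range n0, K n * ‖y‖ with hB
    have hsum0 : 0 ≤ ∑ n ∈ Finset.range n0, K n * ‖y‖ :=
      Finset.sum_nonneg fun n _ => mul_nonneg (hK0 n) (norm_nonneg y)
    have hB0 : 0 ≤ B := by positivity
    refine ⟨B, fun ⟨n, z⟩ => ?_⟩
    have hg : ‖g ⟨n, z⟩ y‖ = ‖(D n).Gr z‖⁻¹ * |⟪(D n).P z, y⟫| := by
      simp [g]
    rw [hg]
    have hmain : |⟪(D n).P z, y⟫| ≤ B * ‖(D n).Gr z‖ := by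
      rcases lt_or_ge n n0 with h | h
      · calc |⟪(D n).P z, y⟫| ≤ ‖(D n).P z‖ * ‖y‖ := abs_real_inner_le_norm _ _
          _ ≤ K n * ‖(D n).Gr z‖ * ‖y‖ := by gcongr; exact hK n z
          _ = K n * ‖y‖ * ‖(D n).Gr z‖ := by ring
          _ ≤ B * ‖(D n).Gr z‖ := by
              gcongr
              have := Finset.single_le_sum (f := fun n => K n * ‖y‖)
                (fun n _ => mul_nonneg (hK0 n) (norm_nonneg y)) (Finset.mem_range.mpr h)
              have h1 : 0 ≤ √‖(S : E →L[ℝ] E)‖ + ‖ψ‖ := by positivity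
              linarith
      · have h1 := hn0 n h
        have hz := (D n).abs_le_zeta_mul G hS (ne_top_of_le_ne_top ENNReal.one_ne_top h1) z
        rw [hdiv.div_eq, inner_neg_left, real_inner_comm _ y, real_inner_comm _ ψ] at hz
        have h2 : ((D n).zeta G S ψ).toReal ≤ 1 := ENNReal.toReal_le_of_le_ofReal zero_le_one
          (by simpa using h1)
        have h3 : (((D n).zeta G S ψ).toReal * weightedNorm (S : E →L[ℝ] E) ((D n).Gr z)) ≤
            √‖(S : E →L[ℝ] E)‖ * ‖(D n).Gr z‖ :=
          (mul_le_of_le_one_left (weightedNorm_nonneg _ _) h2).trans (weightedNorm_le _ _)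
        have h4 := abs_real_inner_le_norm ((D n).Gr z) ψ
        have h5 : |⟪(D n).P z, y⟫| ≤ |⟪(D n).Gr z, ψ⟫ + -⟪(D n).P z, y⟫| + |⟪(D n).Gr z, ψ⟫| := by
          have := abs_sub ⟪(D n).Gr z, ψ⟫ (⟪(D n).Gr z, ψ⟫ + -⟪(D n).P z, y⟫)
          rw [show ∀ a b : ℝ, a - (a + -b) = b from fun a b => by ring] at this
          linarith
        have h6 : 0 ≤ (∑ n ∈ Finset.range n0, K n * ‖y‖) * ‖(D n).Gr z‖ := by positivity
        calc |⟪(D n).P z, y⟫| ≤ √‖(S : E →L[ℝ] E)‖ * ‖(D n).Gr z‖ + ‖(D n).Gr z‖ * ‖ψ‖ := by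
              linarith
          _ ≤ B * ‖(D n).Gr z‖ := by
              rw [hB]
              linarith
    rcases (norm_nonneg ((D n).Gr z)).eq_or_lt with h | h
    · rw [← h]
      simpa using hB0
    · rw [inv_mul_le_iff₀ h]
      linarith
  refine ⟨max C 1, by positivity, fun n z => ?_⟩
  have h := hC ⟨n, z⟩
  have hg : ‖g ⟨n, z⟩‖ = ‖(D n).Gr z‖⁻¹ * ‖(D n).P z‖ := by
    simp only [g]
    rw [norm_smul, innerSL_apply_norm, norm_inv, norm_norm]
  rw [hg] at h
  rcases (norm_nonneg ((D n).Gr z)).eq_or_lt with h0 | h0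
  · have : z = 0 := (D n).eq_zero_of_norm_Gr z h0.symm
    simp [this]
  · rw [inv_mul_le_iff₀ h0] at h
    refine h.trans ?_
    rw [mul_comm]
    gcongr
    exact le_max_left _ _

end GradientDiscretisation

end Discrete

/-! ### From strong convergence of operators to uniform convergence along curves. -/

section StrongConvergence

variable {H Z : Type*} [NormedAddCommGroup H] [NormedSpace ℝ H] [NormedAddCommGroup Z]
  [NormedSpace ℝ Z]

/-- Uniformly bounded linear maps that converge strongly converge uniformly along a uniformly
convergent sequence of functions with continuous limit on a compact interval. -/
theorem tendstoUniformlyOn_of_strong {A : ℕ → H →ₗ[ℝ] Z} {A' : H →ₗ[ℝ] Z} {C : ℝ}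
    (hC : ∀ n x, ‖A n x‖ ≤ C * ‖x‖) (hA : ∀ x, Tendsto (fun n => A n x) atTop (𝓝 (A' x)))
    {K : Set ℝ} (hK : IsCompact K) {f : ℝ → H} (hf : ContinuousOn f K) {F : ℕ → ℝ → H}
    (hF : TendstoUniformlyOn F f atTop K) :
    TendstoUniformlyOn (fun n t => A n (F n t)) (fun t => A' (f t)) atTop K := by
  have hA' : ∀ x, ‖A' x‖ ≤ C * ‖x‖ := fun x => le_of_tendsto' (hA x).norm fun n => hC n x
  rw [Metric.tendstoUniformlyOn_iff] at hF ⊢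
  intro ε hε
  set B := max C 1 with hB
  have hB0 : 0 < B := lt_of_lt_of_le one_pos (le_max_right _ _)
  have hle : ∀ x : H, C * ‖x‖ ≤ B * ‖x‖ := fun x => by gcongr; exact le_max_left _ _
  -- The image of the compact set has a finite δ-net, on which strong convergence is uniform. Four
  -- errors of size ε/4 arise: two moves to the net, the operator error there, and the replacement
  -- of f by `F n`.
  set δ := ε / (4 * B) with hδ
  have hδ0 : 0 < δ := by positivity
  have hBδ : B * δ = ε / 4 := by rw [hδ]; field_simp
  obtain ⟨s, hs, hcover⟩ := Metric.totallyBounded_iff.mp (hK.image_of_continuousOn hf).totallyBounded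
    δ hδ0
  have hfin : ∀ᶠ n in atTop, ∀ y ∈ s, ‖A n y - A' y‖ < ε / 4 := by
    rw [eventually_all_finite hs]
    intro y _
    have := (tendsto_iff_norm_sub_tendsto_zero.mp (hA y))
    exact this.eventually (gt_mem_nhds (by positivity))
  filter_upwards [hF δ hδ0, hfin] with n h1 h2 t ht
  obtain ⟨y, hy, hyt⟩ := mem_iUnion₂.mp (hcover (mem_image_of_mem f ht))
  have h3 := h1 t ht
  have h4 := h2 y hy
  rw [Metric.mem_ball, dist_eq_norm] at hyt
  rw [dist_eq_norm] at h3 ⊢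
  have e : A' (f t) - A n (F n t) = A' (f t - y) - (A n y - A' y) - A n (f t - y)
      + A n (f t - F n t) := by
    simp only [map_sub]
    abel
  have b1 := (hA' (f t - y)).trans (hle _)
  have b2 := (hC n (f t - y)).trans (hle _)
  have b3 := (hC n (f t - F n t)).trans (hle _)
  have b4 : B * ‖f t - y‖ < ε / 4 := by rw [← hBδ]; gcongr
  have b5 : B * ‖f t - F n t‖ < ε / 4 := by rw [← hBδ]; gcongr
  rw [e]
  calc _ ≤ ‖A' (f t - y)‖ + ‖A n y - A' y‖ + ‖A n (f t - y)‖ + ‖A n (f t - F n t)‖ :=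
        (norm_add_le _ _).trans (by gcongr; exact (norm_sub_le _ _).trans (by
          gcongr; exact norm_sub_le _ _))
    _ < ε := by linarith

end StrongConvergence

/-! ### Interpolation and convergence of the discrete Riesz operators. -/

section Discrete

variable {L E : Type*} [NormedAddCommGroup L] [InnerProductSpace ℝ L]
  [NormedAddCommGroup E] [InnerProductSpace ℝ E]

namespace GradientDiscretisation

/-- The linear interpolation that realises the infimum defining `sigma`. -/
theorem exists_interpolation (D : GradientDiscretisation.{v} L E) (G : GradientOperator L E) :
    ∃ I : G.Space →ₗ[ℝ] D.X, ∀ φ,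
      √(‖D.P (I φ) - G.incl φ‖ ^ 2 + ‖D.Gr (I φ) - G.grad φ‖ ^ 2) ≤ D.sigma G φ := by
  let e := (WithLp.linearEquiv 2 ℝ (L × E)).symm
  let Q : D.X →ₗ[ℝ] WithLp 2 (L × E) := e.toLinearMap.comp (D.P.prod D.Gr)
  let j : G.Space →ₗ[ℝ] WithLp 2 (L × E) :=
    e.toLinearMap.comp (G.incl.toLinearMap.prod G.grad.toLinearMap)
  have hQ : LinearMap.ker Q = ⊥ := by
    rw [LinearMap.ker_eq_bot]
    intro z w h
    have h1 : (D.P.prod D.Gr) z = (D.P.prod D.Gr) w := e.injective h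
    exact D.Gr_injective (congrArg Prod.snd h1)
  -- The best approximation is the orthogonal projection of (φ, G φ) onto the range of (P, Gr),
  -- pulled back to X; the Hilbert norm on the product is what makes it linear in φ.
  obtain ⟨B, hB⟩ := Q.exists_leftInverse_of_injective hQ
  let p := (LinearMap.range Q).starProjection
  refine ⟨B.comp (p.toLinearMap.comp j), fun φ => ?_⟩
  have hnorm : ∀ z : D.X, ‖j φ - Q z‖ = √(‖D.P z - G.incl φ‖ ^ 2 + ‖D.Gr z - G.grad φ‖ ^ 2) := by
    intro z
    rw [norm_sub_rev, WithLp.prod_norm_eq_of_L2]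
    rfl
  obtain ⟨z, hz⟩ : p (j φ) ∈ LinearMap.range Q := Submodule.starProjection_apply_mem _ _
  have hBz : B.comp (p.toLinearMap.comp j) φ = z := by
    change B (p (j φ)) = z
    rw [← hz]
    exact LinearMap.congr_fun hB z
  rw [hBz, ← hnorm]
  refine le_ciInf fun y => ?_
  rw [← hnorm, hz, Submodule.starProjection_minimal]
  exact ciInf_le ⟨0, by rintro _ ⟨x, rfl⟩; exact norm_nonneg _⟩
    (⟨Q y, LinearMap.mem_range_self Q y⟩ : LinearMap.range Q)

theorem sigma_le (D : GradientDiscretisation.{v} L E) (G : GradientOperator L E) (φ : G.Space) :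
    D.sigma G φ ≤ ‖G.incl φ‖ + ‖G.grad φ‖ := by
  have h : D.sigma G φ ≤ √(‖D.P 0 - G.incl φ‖ ^ 2 + ‖D.Gr 0 - G.grad φ‖ ^ 2) :=
    ciInf_le ⟨0, by rintro _ ⟨x, rfl⟩; exact Real.sqrt_nonneg _⟩ 0
  refine h.trans ?_
  rw [map_zero, map_zero, zero_sub, zero_sub, norm_neg, norm_neg]
  exact Real.sqrt_le_iff.mpr ⟨by positivity,
    by nlinarith [mul_nonneg (norm_nonneg (G.incl φ)) (norm_nonneg (G.grad φ))]⟩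

theorem rieszDisc_eq (D : GradientDiscretisation.{v} L E) {S : E ≃L[ℝ] E}
    (hS : (S : E →L[ℝ] E).IsPositive) {z r : D.X}
    (h : ∀ y, ⟪S (D.Gr r), D.Gr y⟫ = ⟪D.P z, D.P y⟫) : D.rieszDisc S z = r := by
  obtain ⟨c, hc, hcoer⟩ := coercive_of_isPositive hS
  have h1 := hcoer (D.Gr (D.rieszDisc S z - r))
  have h2 : ⟪S (D.Gr (D.rieszDisc S z - r)), D.Gr (D.rieszDisc S z - r)⟫ = 0 := by
    rw [map_sub D.Gr, map_sub S, inner_sub_left, ← map_sub D.Gr, D.inner_rieszDisc hS, h, sub_self]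
  rw [h2] at h1
  have h3 : ‖D.Gr (D.rieszDisc S z - r)‖ ^ 2 ≤ 0 := by
    by_contra hcon
    push Not at hcon
    have := mul_pos hc hcon
    linarith
  have h4 : ‖D.Gr (D.rieszDisc S z - r)‖ = 0 :=
    pow_eq_zero_iff (two_ne_zero) |>.mp (le_antisymm h3 (by positivity))
  exact sub_eq_zero.mp (D.eq_zero_of_norm_Gr _ h4)

/-- The discrete Riesz operator as a linear map. -/
def rieszDiscₗ (D : GradientDiscretisation.{v} L E) {S : E ≃L[ℝ] E}
    (hS : (S : E →L[ℝ] E).IsPositive) : D.X →ₗ[ℝ] D.X where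
  toFun := D.rieszDisc S
  map_add' z w := D.rieszDisc_eq hS fun y => by
    rw [map_add, map_add, map_add, inner_add_left, inner_add_left, D.inner_rieszDisc hS,
      D.inner_rieszDisc hS]
  map_smul' a z := D.rieszDisc_eq hS fun y => by
    rw [map_smul, map_smul, map_smul, inner_smul_left, inner_smul_left, D.inner_rieszDisc hS,
      RingHom.id_apply]

theorem norm_Gr_rieszDisc_le (D : GradientDiscretisation.{v} L E) {S : E ≃L[ℝ] E}
    (hS : (S : E →L[ℝ] E).IsPositive) {c C : ℝ} (hc : 0 < c) (hC : 0 < C)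
    (hcoer : ∀ ξ : E, c * ‖ξ‖ ^ 2 ≤ ⟪S ξ, ξ⟫) (hP : ∀ z, ‖D.P z‖ ≤ C * ‖D.Gr z‖) (z : D.X) :
    ‖D.Gr (D.rieszDisc S z)‖ ≤ C / c * ‖D.P z‖ := by
  have h : ‖D.Gr (D.rieszDisc S z)‖ ≤ C * ‖D.P z‖ / c := by
    refine le_div_of_mul_sq_le hc (by positivity) (norm_nonneg _) ?_
    calc _ ≤ _ := hcoer _
      _ = ⟪D.P z, D.P (D.rieszDisc S z)⟫ := D.inner_rieszDisc hS _ _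
      _ ≤ ‖D.P z‖ * ‖D.P (D.rieszDisc S z)‖ := real_inner_le_norm _ _
      _ ≤ ‖D.P z‖ * (C * ‖D.Gr (D.rieszDisc S z)‖) := by gcongr; exact hP _
      _ = _ := by ring
  refine h.trans (le_of_eq ?_)
  ring

variable [CompleteSpace L] [CompleteSpace E]

/-- Convergence of the discrete Riesz operators. -/
theorem tendsto_Gr_rieszDisc (G : GradientOperator L E) {S : E ≃L[ℝ] E}
    (hS : (S : E →L[ℝ] E).IsPositive) {D : ℕ → GradientDiscretisation.{v} L E}
    (hconf : ∀ φ ∈ G.HD, Tendsto (fun n => (D n).zeta G S φ) atTop (𝓝 0))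
    {C : ℝ} (hC : 0 ≤ C) (hP : ∀ n z, ‖(D n).P z‖ ≤ C * ‖(D n).Gr z‖)
    {I : (n : ℕ) → G.Space →ₗ[ℝ] (D n).X}
    (hIP : ∀ x, Tendsto (fun n => (D n).P (I n x)) atTop (𝓝 (G.incl x)))
    (hIG : ∀ x, Tendsto (fun n => (D n).Gr (I n x)) atTop (𝓝 (G.grad x)))
    {A : G.Space →L[ℝ] G.Space} (hA : ∀ z x, ⟪S (G.grad (A z)), G.grad x⟫ = ⟪z, x⟫)
    (x : G.Space) :
    Tendsto (fun n => (D n).Gr ((D n).rieszDisc S (I n x))) atTop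
      (𝓝 (G.grad (A (gram G.incl x)))) := by
  obtain ⟨c, hc, hcoer⟩ := coercive_of_isPositive hS
  set r := A (gram G.incl x) with hr
  set ψ := S (G.grad r) with hψ
  have hdiv : G.IsDiv ψ (-G.incl x) := G.isDiv_of_gram hA x
  have hζ := hconf ψ ⟨_, hdiv⟩
  -- The three sources of error between R_h(I x) and I r: interpolation of x, conformity of the flux
  -- ψ, interpolation of r.
  set b : ℕ → ℝ := fun n => C * ‖(D n).P (I n x) - G.incl x‖ +
    ((D n).zeta G S ψ).toReal * √‖(S : E →L[ℝ] E)‖ +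
    ‖(S : E →L[ℝ] E)‖ * ‖(D n).Gr (I n r) - G.grad r‖ with hb
  have hblim : Tendsto (fun n => b n / c) atTop (𝓝 0) := by
    have h1 := (tendsto_iff_norm_sub_tendsto_zero.mp (hIP x)).const_mul C
    have h2 := ((ENNReal.tendsto_toReal ENNReal.zero_ne_top).comp hζ).mul_const
      √‖(S : E →L[ℝ] E)‖
    have h3 := (tendsto_iff_norm_sub_tendsto_zero.mp (hIG r)).const_mul ‖(S : E →L[ℝ] E)‖
    have := ((h1.add h2).add h3).div_const c
    simpa [hb] using this
  have hz : Tendsto (fun n => (D n).Gr ((D n).rieszDisc S (I n x) - I n r)) atTop (𝓝 0) := by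
    rw [tendsto_zero_iff_norm_tendsto_zero]
    refine squeeze_zero' (Eventually.of_forall fun n => norm_nonneg _) ?_ hblim
    filter_upwards [hζ.eventually (ge_mem_nhds (show (0 : ℝ≥0∞) < 1 by norm_num))] with n hn
    set z := (D n).rieszDisc S (I n x) - I n r with hzdef
    have hq := (D n).abs_le_zeta_mul G hS (ne_top_of_le_ne_top ENNReal.one_ne_top hn) z
    rw [hdiv.div_eq, inner_neg_left] at hq
    have hq' : ⟪G.incl x, (D n).P z⟫ - ⟪ψ, (D n).Gr z⟫ ≤
        ((D n).zeta G S ψ).toReal * (√‖(S : E →L[ℝ] E)‖ * ‖(D n).Gr z‖) := by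
      have h1 := (neg_abs_le _).trans' (neg_le_neg hq)
      have h2 := weightedNorm_le (S : E →L[ℝ] E) ((D n).Gr z)
      have h3 : 0 ≤ ((D n).zeta G S ψ).toReal := ENNReal.toReal_nonneg
      have := mul_le_mul_of_nonneg_left h2 h3
      linarith
    have hP0 := hP n z
    -- The middle bracket is minus the conformity defect of ψ, whose divergence is -x in L; each
    -- term on the right is linear in z, so coercivity leaves a bound for ‖Gr z‖.
    have e1 : ⟪S ((D n).Gr z), (D n).Gr z⟫ =
        ⟪(D n).P (I n x) - G.incl x, (D n).P z⟫ +
          (⟪G.incl x, (D n).P z⟫ - ⟪ψ, (D n).Gr z⟫) -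
          ⟪S ((D n).Gr (I n r) - G.grad r), (D n).Gr z⟫ := by
      have e0 : S ((D n).Gr z) = S ((D n).Gr ((D n).rieszDisc S (I n x))) -
          S ((D n).Gr (I n r)) := by
        rw [hzdef, map_sub, map_sub]
      rw [e0, inner_sub_left, (D n).inner_rieszDisc hS, map_sub S, inner_sub_left,
        inner_sub_left]
      ring
    have t1 : ⟪(D n).P (I n x) - G.incl x, (D n).P z⟫ ≤
        ‖(D n).P (I n x) - G.incl x‖ * (C * ‖(D n).Gr z‖) :=
      (real_inner_le_norm _ _).trans (by gcongr)
    have t3 : -⟪S ((D n).Gr (I n r) - G.grad r), (D n).Gr z⟫ ≤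
        ‖(S : E →L[ℝ] E)‖ * ‖(D n).Gr (I n r) - G.grad r‖ * ‖(D n).Gr z‖ := by
      refine (neg_le_abs _).trans ((abs_real_inner_le_norm _ _).trans ?_)
      gcongr
      exact (S : E →L[ℝ] E).le_opNorm _
    have hle : c * ‖(D n).Gr z‖ ^ 2 ≤ b n * ‖(D n).Gr z‖ := by
      refine (hcoer _).trans ?_
      rw [e1, hb]
      linarith
    exact le_div_of_mul_sq_le hc (by positivity) (norm_nonneg _) hle
  have := hz.add (hIG r)
  simpa using this

end GradientDiscretisation

end Discrete

/-! ### Piecewise constant functions on the time grid. -/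

section Steps

variable {X Z : Type*} [AddCommGroup X] {N : ℕ} {k T : ℝ}

theorem eq_of_mem_Ioc_step {m n : ℕ} {t : ℝ} (hk : 0 < k)
    (hm : t ∈ Ioc ((m : ℝ) * k) (((m : ℝ) + 1) * k))
    (hn : t ∈ Ioc ((n : ℝ) * k) (((n : ℝ) + 1) * k)) : m = n := by
  have h1 : (m : ℝ) * k < ((n : ℝ) + 1) * k := hm.1.trans_le hn.2
  have h2 : (n : ℝ) * k < ((m : ℝ) + 1) * k := hn.1.trans_le hm.2
  have h3 := lt_of_mul_lt_mul_right h1 hk.le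
  have h4 := lt_of_mul_lt_mul_right h2 hk.le
  have h5 : m < n + 1 := by exact_mod_cast h3
  have h6 : n < m + 1 := by exact_mod_cast h4
  omega

theorem stepV_of_mem (hk : 0 < k) (y : Fin N → X) {m : Fin N} {t : ℝ}
    (ht : t ∈ Ioo ((m : ℝ) * k) (((m : ℝ) + 1) * k)) : stepV k y t = y m := by
  rw [stepV, Finset.sum_eq_single m]
  · rw [indicator_of_mem ht]
  · intro n _ hn
    refine indicator_of_notMem (fun h => hn ?_) _
    exact Fin.ext (eq_of_mem_Ioc_step hk (Ioo_subset_Ioc_self h) (Ioo_subset_Ioc_self ht))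
  · simp

theorem stepW_of_mem (hk : 0 < k) (w : Fin (N + 1) → X) {m : Fin N} {t : ℝ}
    (ht : t ∈ Ioc ((m : ℝ) * k) (((m : ℝ) + 1) * k)) : stepW k w t = w m.succ := by
  have h0 : t ∉ ({0} : Set ℝ) := by
    have : (0 : ℝ) ≤ m * k := by positivity
    exact fun h => (this.trans_lt ht.1).ne' h
  rw [stepW, indicator_of_notMem h0, zero_add, Finset.sum_eq_single m]
  · rw [indicator_of_mem ht]
  · intro n _ hn
    exact indicator_of_notMem (fun h => hn (Fin.ext (eq_of_mem_Ioc_step hk h ht))) _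
  · simp

theorem stepW_zero (hk : 0 < k) (w : Fin (N + 1) → X) : stepW k w 0 = w 0 := by
  rw [stepW, indicator_of_mem (mem_singleton _), Finset.sum_eq_zero, add_zero]
  intro n _
  refine indicator_of_notMem (fun h => ?_) _
  have : (0 : ℝ) ≤ n * k := by positivity
  exact absurd h.1 (not_lt.mpr this)

theorem map_stepV {Y : Type*} [AddCommGroup Y] {F : Type*} [FunLike F X Y]
    [AddMonoidHomClass F X Y] (f : F) (y : Fin N → X) (t : ℝ) :
    f (stepV k y t) = stepV k (fun m => f (y m)) t := by
  simp only [stepV, map_sum, indicator]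
  refine Finset.sum_congr rfl fun m _ => ?_
  split_ifs <;> simp

theorem map_stepW {Y : Type*} [AddCommGroup Y] {F : Type*} [FunLike F X Y]
    [AddMonoidHomClass F X Y] (f : F) (w : Fin (N + 1) → X) (t : ℝ) :
    f (stepW k w t) = stepW k (fun m => f (w m)) t := by
  simp only [stepW, map_add, map_sum, indicator]
  congr 1
  · split_ifs <;> simp
  · refine Finset.sum_congr rfl fun m _ => ?_
    split_ifs <;> simp

variable [NormedAddCommGroup Z]

theorem memLp_stepV (y : Fin N → Z) : MemLp (stepV k y) 2 (timeMeasure T) := by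
  refine memLp_finsetSum _ fun m _ => ?_
  exact (memLp_const _).indicator measurableSet_Ioo

theorem memLp_stepW (w : Fin (N + 1) → Z) : MemLp (stepW k w) 2 (timeMeasure T) := by
  refine MemLp.add ((memLp_const (w 0)).indicator (measurableSet_singleton 0)) ?_
  refine memLp_finsetSum _ fun m _ => ?_
  exact (memLp_const _).indicator measurableSet_Ioc

theorem memLp_map_stepV [Module ℝ X] [NormedSpace ℝ Z] (f : X →ₗ[ℝ] Z) (y : Fin N → X) :
    MemLp (fun t => f (stepV k y t)) 2 (timeMeasure T) := by
  simp_rw [map_stepV]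
  exact memLp_stepV _

theorem memLp_map_stepW [Module ℝ X] [NormedSpace ℝ Z] (f : X →ₗ[ℝ] Z) (w : Fin (N + 1) → X) :
    MemLp (fun t => f (stepW k w t)) 2 (timeMeasure T) := by
  simp_rw [map_stepW]
  exact memLp_stepW _

theorem exists_mem_Ioc_step (hT : 0 < T) (hN : 0 < N) {t : ℝ} (ht : t ∈ Ioc 0 T) :
    ∃ m : Fin N, t ∈ Ioc ((m : ℝ) * (T / N)) (((m : ℝ) + 1) * (T / N)) := by
  have hN' : (0 : ℝ) < N := by exact_mod_cast hN
  have hk : 0 < T / N := by positivity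
  -- The intervals are closed on the right, hence the ceiling; their index starts at 0, hence j - 1.
  set j := ⌈t / (T / N)⌉₊ with hj
  have hj1 : 0 < j := Nat.ceil_pos.mpr (div_pos ht.1 hk)
  have hjN : j ≤ N := by
    refine Nat.ceil_le.mpr ?_
    rw [div_le_iff₀ hk]
    have : (N : ℝ) * (T / N) = T := by field_simp
    rw [this]
    exact ht.2
  refine ⟨⟨j - 1, by omega⟩, ?_, ?_⟩
  · have : j - 1 < j := by omega
    have h := Nat.lt_ceil.mp (hj ▸ this)
    rwa [lt_div_iff₀ hk] at h
  · have h := Nat.le_ceil (t / (T / N))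
    rw [div_le_iff₀ hk, ← hj] at h
    have e : ((j - 1 : ℕ) : ℝ) + 1 = j := by
      rw [Nat.cast_sub hj1]
      simp
    simpa [e] using h

theorem ae_exists_mem_Ioo_step (hT : 0 < T) (hN : 0 < N) :
    ∀ᵐ t ∂timeMeasure T, ∃ m : Fin N, t ∈ Ioo ((m : ℝ) * (T / N)) (((m : ℝ) + 1) * (T / N)) := by
  have hcount : (range fun m : Fin N => ((m : ℝ) + 1) * (T / N)).Countable := countable_range _
  have h0 : ∀ᵐ t ∂timeMeasure T, t ∉ range fun m : Fin N => ((m : ℝ) + 1) * (T / N) :=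
    ae_restrict_of_ae (hcount.ae_notMem volume)
  filter_upwards [h0, ae_mem_Ioo T] with t h1 h2
  obtain ⟨m, hm⟩ := exists_mem_Ioc_step hT hN (Ioo_subset_Ioc_self h2)
  exact ⟨m, hm.1, lt_of_le_of_ne hm.2 fun h => h1 ⟨m, h.symm⟩⟩

theorem step_mem_Icc (hT : 0 < T) (hN : 0 < N) {m : ℕ} (hm : m ≤ N) :
    (m : ℝ) * (T / N) ∈ Icc 0 T := by
  have hN' : (0 : ℝ) < N := by exact_mod_cast hN
  refine ⟨by positivity, ?_⟩
  rw [mul_div_assoc', div_le_iff₀ hN', mul_comm]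
  gcongr

theorem integral_timeMeasure_eq_sum [NormedSpace ℝ Z] (hT : 0 < T) (hN : 0 < N) {f : ℝ → Z}
    (hf : Integrable f (timeMeasure T)) :
    ∫ t, f t ∂timeMeasure T =
      ∑ m : Fin N, ∫ t in ((m : ℝ) * (T / N))..(((m : ℝ) + 1) * (T / N)), f t := by
  have hN' : (0 : ℝ) < N := by exact_mod_cast hN
  have hIcc : IntegrableOn f (Icc 0 T) := by
    rw [integrableOn_Icc_iff_integrableOn_Ioo]
    exact hf
  have h := intervalIntegral.sum_integral_adjacent_intervals (f := f) (μ := volume)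
    (a := fun m : ℕ => (m : ℝ) * (T / N)) (n := N) fun m hm => by
      refine intervalIntegrable_iff.mpr (hIcc.mono_set ?_)
      refine uIoc_subset_uIcc.trans (uIcc_subset_Icc ?_ ?_)
      · exact step_mem_Icc hT hN hm.le
      · exact step_mem_Icc hT hN hm
  rw [Nat.cast_zero, zero_mul, mul_div_cancel₀ T hN'.ne', Finset.sum_range] at h
  rw [timeMeasure, ← integral_Ioc_eq_integral_Ioo, ← intervalIntegral.integral_of_le hT.le, ← h]
  simp

theorem intervalIntegral_step_congr [NormedSpace ℝ Z] (hk : 0 < k) {f g : ℝ → Z} (m : ℕ)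
    (h : ∀ t ∈ Ioo ((m : ℝ) * k) (((m : ℝ) + 1) * k), f t = g t) :
    ∫ t in ((m : ℝ) * k)..(((m : ℝ) + 1) * k), f t =
      ∫ t in ((m : ℝ) * k)..(((m : ℝ) + 1) * k), g t := by
  have hle : (m : ℝ) * k ≤ ((m : ℝ) + 1) * k := by gcongr; linarith
  rw [intervalIntegral.integral_of_le hle, intervalIntegral.integral_of_le hle,
    integral_Ioc_eq_integral_Ioo, integral_Ioc_eq_integral_Ioo]
  exact setIntegral_congr_fun measurableSet_Ioo h

end Steps

/-! ### Space-time conformity. -/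

section ConformityInTime

variable {L E : Type*} [NormedAddCommGroup L] [InnerProductSpace ℝ L]
  [NormedAddCommGroup E] [InnerProductSpace ℝ E]

namespace GradientDiscretisation

/-- The conformity error of a pair `(φ, y)`, in which `y` stands for the divergence of `φ`. -/
def zetaPair (D : GradientDiscretisation.{v} L E) (S : E ≃L[ℝ] E) (p : E × L) : ℝ≥0∞ :=
  ⨆ (z : D.X) (_ : z ≠ 0),
    ENNReal.ofReal (|⟪p.1, D.Gr z⟫ + ⟪p.2, D.P z⟫| / weightedNorm (S : E →L[ℝ] E) (D.Gr z))

/-- Measurability of t ↦ ζ(φ(t)) is obtained here: a supremum of continuous functions, even an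
uncountable one, is lower semicontinuous. Treating the divergence as a second variable is essential,
since it does not depend continuously on φ in E. -/
theorem lowerSemicontinuous_zetaPair (D : GradientDiscretisation.{v} L E) (S : E ≃L[ℝ] E) :
    LowerSemicontinuous (D.zetaPair S) := by
  refine lowerSemicontinuous_iSup fun z => lowerSemicontinuous_iSup fun _ => ?_
  refine Continuous.lowerSemicontinuous ?_
  refine ENNReal.continuous_ofReal.comp ?_
  fun_prop

/-- With the uniform Poincaré constant this is the dominating function for the passage to the limit.
-/
theorem zetaPair_le (D : GradientDiscretisation.{v} L E) {S : E ≃L[ℝ] E} {c C : ℝ} (hc : 0 < c)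
    (hC : 0 ≤ C) (hcoer : ∀ ξ : E, c * ‖ξ‖ ^ 2 ≤ ⟪S ξ, ξ⟫) (hP : ∀ z, ‖D.P z‖ ≤ C * ‖D.Gr z‖)
    (p : E × L) : D.zetaPair S p ≤ ENNReal.ofReal ((‖p.1‖ + C * ‖p.2‖) / √c) := by
  refine iSup₂_le fun z hz => ENNReal.ofReal_le_ofReal ?_
  have hGz : 0 < ‖D.Gr z‖ :=
    lt_of_le_of_ne (norm_nonneg _) fun h => hz (D.eq_zero_of_norm_Gr z h.symm)
  have hsc : 0 < √c := Real.sqrt_pos.mpr hc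
  have hw := le_weightedNorm (S := (S : E →L[ℝ] E)) hc.le hcoer (D.Gr z)
  rw [div_le_div_iff₀ (lt_of_lt_of_le (mul_pos hsc hGz) hw) hsc]
  calc |⟪p.1, D.Gr z⟫ + ⟪p.2, D.P z⟫| * √c
      ≤ (‖p.1‖ * ‖D.Gr z‖ + ‖p.2‖ * (C * ‖D.Gr z‖)) * √c := by
        gcongr
        refine (abs_add_le _ _).trans (add_le_add (abs_real_inner_le_norm _ _) ?_)
        refine (abs_real_inner_le_norm _ _).trans ?_
        gcongr
        exact hP z
    _ = (‖p.1‖ + C * ‖p.2‖) * (√c * ‖D.Gr z‖) := by ring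
    _ ≤ _ := by gcongr

theorem abs_le_zetaPair_mul (D : GradientDiscretisation.{v} L E) {S : E ≃L[ℝ] E}
    (hS : (S : E →L[ℝ] E).IsPositive) (p : E × L) (z : D.X) :
    ENNReal.ofReal |⟪p.1, D.Gr z⟫ + ⟪p.2, D.P z⟫| ≤
      D.zetaPair S p * ENNReal.ofReal (weightedNorm (S : E →L[ℝ] E) (D.Gr z)) := by
  obtain ⟨c, hc, hcoer⟩ := coercive_of_isPositive hS
  by_cases hz : z = 0
  · simp [hz]
  have hGz : 0 < ‖D.Gr z‖ :=
    lt_of_le_of_ne (norm_nonneg _) fun h => hz (D.eq_zero_of_norm_Gr z h.symm)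
  have hpos : 0 < weightedNorm (S : E →L[ℝ] E) (D.Gr z) :=
    lt_of_lt_of_le (mul_pos (Real.sqrt_pos.mpr hc) hGz)
      (le_weightedNorm (S := (S : E →L[ℝ] E)) hc.le hcoer _)
  have h := le_iSup₂ (f := fun (z : D.X) (_ : z ≠ 0) => ENNReal.ofReal
    (|⟪p.1, D.Gr z⟫ + ⟪p.2, D.P z⟫| / weightedNorm (S : E →L[ℝ] E) (D.Gr z))) z hz
  calc _ = ENNReal.ofReal (|⟪p.1, D.Gr z⟫ + ⟪p.2, D.P z⟫| /
        weightedNorm (S : E →L[ℝ] E) (D.Gr z)) *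
          ENNReal.ofReal (weightedNorm (S : E →L[ℝ] E) (D.Gr z)) := by
        rw [← ENNReal.ofReal_mul (by positivity), div_mul_cancel₀ _ hpos.ne']
    _ ≤ _ := by gcongr; exact h

/-- The pointwise conformity estimate holds at each time, and Cauchy-Schwarz in time does the rest;
piecewise constancy of the test functions only provides integrability, so the bound does not depend
on N. -/
theorem zetaT_le (D : GradientDiscretisation.{v} L E) (G : GradientOperator L E) {S : E ≃L[ℝ] E}
    (hS : (S : E →L[ℝ] E).IsPositive) {T : ℝ} (N : ℕ) {φ : ℝ → E} (hφ : MemL2HD G T φ)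
    (hmeas : AEMeasurable (fun t => D.zetaPair S (φ t, G.div (φ t))) (timeMeasure T)) :
    D.zetaT G S T N φ ≤ (∫⁻ t, D.zetaPair S (φ t, G.div (φ t)) ^ (2 : ℝ) ∂timeMeasure T) ^
      (1 / (2 : ℝ)) := by
  refine iSup₂_le fun y _ => ENNReal.div_le_of_le_mul ?_
  have hG : MemLp (fun t => D.Gr (stepV (T / N) y t)) 2 (timeMeasure T) := memLp_map_stepV _ _
  have hP : MemLp (fun t => D.P (stepV (T / N) y t)) 2 (timeMeasure T) := memLp_map_stepV _ _
  rw [← integral_add (integrable_inner_of_memLp hφ.1 hG) (integrable_inner_of_memLp hφ.2.2 hP)]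
  have hw : AEStronglyMeasurable
      (fun t => weightedNorm (S : E →L[ℝ] E) (D.Gr (stepV (T / N) y t))) (timeMeasure T) := by
    have hcont : Continuous fun ξ : E => weightedNorm (S : E →L[ℝ] E) ξ := by
      unfold weightedNorm
      fun_prop
    exact hcont.comp_aestronglyMeasurable hG.1
  have h2 : (2 : ℝ≥0∞).toReal = 2 := by norm_num
  rw [eLpNorm_eq_lintegral_rpow_enorm_toReal (by norm_num) (by norm_num), h2]
  refine le_trans ?_ (ENNReal.lintegral_mul_le_Lp_mul_Lq (timeMeasure T)
    (Real.HolderConjugate.two_two) hmeas hw.enorm)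
  rw [← Real.enorm_eq_ofReal_abs]
  refine (enorm_integral_le_lintegral_enorm _).trans (lintegral_mono fun t => ?_)
  rw [Pi.mul_apply, Real.enorm_eq_ofReal_abs, Real.enorm_of_nonneg (weightedNorm_nonneg _ _)]
  exact D.abs_le_zetaPair_mul hS (φ t, G.div (φ t)) _

variable [CompleteSpace L] [CompleteSpace E]

/-- The space-time conformity errors tend to zero. -/
theorem tendsto_zetaT (G : GradientOperator L E) {S : E ≃L[ℝ] E}
    (hS : (S : E →L[ℝ] E).IsPositive) {D : ℕ → GradientDiscretisation.{v} L E}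
    (hconf : ∀ φ ∈ G.HD, Tendsto (fun n => (D n).zeta G S φ) atTop (𝓝 0)) {T : ℝ} (N : ℕ → ℕ)
    {φ : ℝ → E} (hφ : MemL2HD G T φ) :
    Tendsto (fun n => (D n).zetaT G S T (N n) φ) atTop (𝓝 0) := by
  obtain ⟨c, hc, hcoer⟩ := coercive_of_isPositive hS
  obtain ⟨C, hC, hP⟩ := exists_poincare G hS hconf
  have hmeas : ∀ n, AEMeasurable (fun t => (D n).zetaPair S (φ t, G.div (φ t)))
      (timeMeasure T) := by
    intro n
    borelize (E × L)
    exact ((D n).lowerSemicontinuous_zetaPair S).measurable.comp_aemeasurable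
      (hφ.1.1.prodMk hφ.2.2.1).aemeasurable
  set g : ℝ → ℝ := fun t => (‖φ t‖ + C * ‖G.div (φ t)‖) / √c with hg
  have hgL : MemLp g 2 (timeMeasure T) := by
    have := (hφ.1.norm.add (hφ.2.2.norm.const_mul C)).const_mul (√c)⁻¹
    refine this.ae_eq (Eventually.of_forall fun t => ?_)
    simp [hg, div_eq_inv_mul]
  have key : Tendsto (fun n => ∫⁻ t, (D n).zetaPair S (φ t, G.div (φ t)) ^ (2 : ℝ) ∂timeMeasure T)
      atTop (𝓝 (∫⁻ _, 0 ∂timeMeasure T)) := by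
    refine tendsto_lintegral_of_dominated_convergence' (fun t => ‖g t‖ₑ ^ (2 : ℝ))
      (fun n => (hmeas n).pow_const _) (fun n => ?_) ?_ ?_
    · refine Eventually.of_forall fun t => ?_
      simp only
      gcongr
      refine ((D n).zetaPair_le hc hC.le hcoer (hP n) _).trans (le_of_eq ?_)
      rw [Real.enorm_of_nonneg (by positivity)]
    · have := (lintegral_rpow_enorm_lt_top_of_eLpNorm_lt_top (by norm_num) (by norm_num) hgL.2).ne
      simpa using this
    · filter_upwards [hφ.2.1] with t ht
      have := (hconf _ ht).ennrpow_const (2 : ℝ)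
      rwa [ENNReal.zero_rpow_of_pos (by norm_num)] at this
  rw [lintegral_zero] at key
  have h0 := key.ennrpow_const (1 / (2 : ℝ))
  rw [ENNReal.zero_rpow_of_pos (by norm_num)] at h0
  exact tendsto_of_tendsto_of_tendsto_of_le_of_le tendsto_const_nhds h0 (fun n => zero_le)
    fun n => (D n).zetaT_le G hS (N n) hφ (hmeas n)

end GradientDiscretisation
end ConformityInTime

/-! ### Uniform convergence of step interpolants and difference quotients. -/

section UniformSteps

variable {Z : Type*} [NormedAddCommGroup Z] {T : ℝ}

theorem tendsto_eLpNorm_of_tendstoUniformlyOn {f : ℝ → Z} {F : ℕ → ℝ → Z}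
    (h : TendstoUniformlyOn F f atTop (Icc 0 T)) :
    Tendsto (fun n => eLpNorm (fun t => f t - F n t) 2 (timeMeasure T)) atTop (𝓝 0) := by
  have hμ : timeMeasure T univ ^ (2⁻¹ : ℝ) ≠ ∞ :=
    ENNReal.rpow_ne_top_of_nonneg (by norm_num) (measure_ne_top _ _)
  have hlim : Tendsto (fun j : ℕ => timeMeasure T univ ^ (2⁻¹ : ℝ) *
      ENNReal.ofReal (1 / ((j : ℝ) + 1))) atTop (𝓝 0) := by
    have h1 : Tendsto (fun j : ℕ => ENNReal.ofReal (1 / ((j : ℝ) + 1))) atTop (𝓝 0) := by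
      simpa using ENNReal.tendsto_ofReal tendsto_one_div_add_atTop_nhds_zero_nat
    simpa using ENNReal.Tendsto.const_mul h1 (Or.inr hμ)
  rw [ENNReal.tendsto_nhds_zero]
  intro ε hε
  obtain ⟨j, hj⟩ := (hlim.eventually (ge_mem_nhds hε)).exists
  rw [Metric.tendstoUniformlyOn_iff] at h
  filter_upwards [h _ (Nat.one_div_pos_of_nat (n := j) (α := ℝ))] with n hn
  refine le_trans (eLpNorm_two_le_of_bound ?_) hj
  filter_upwards [ae_mem_Ioo T] with t ht
  rw [← dist_eq_norm]
  exact (hn t (Ioo_subset_Icc_self ht)).le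

theorem tendsto_iSup_of_tendstoUniformlyOn {f : ℝ → Z} {F : ℕ → ℝ → Z} {K : Set ℝ}
    (h : TendstoUniformlyOn F f atTop K) :
    Tendsto (fun n => ⨆ t ∈ K, ‖f t - F n t‖ₑ) atTop (𝓝 0) := by
  rw [ENNReal.tendsto_nhds_zero]
  intro ε hε
  rw [EMetric.tendstoUniformlyOn_iff] at h
  filter_upwards [h ε hε] with n hn
  refine iSup₂_le fun t ht => ?_
  rw [← edist_eq_enorm_sub]
  exact (hn t ht).le

theorem tendstoUniformlyOn_stepW (hT : 0 < T) {N : ℕ → ℕ} (hN : ∀ n, 0 < N n) {f : ℝ → Z}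
    {W : (n : ℕ) → Fin (N n + 1) → Z}
    (h : ∀ ε > 0, ∀ᶠ n in atTop, ‖f 0 - W n 0‖ < ε ∧ ∀ m : Fin (N n),
      ∀ t ∈ Ioc ((m : ℝ) * (T / N n)) (((m : ℝ) + 1) * (T / N n)), ‖f t - W n m.succ‖ < ε) :
    TendstoUniformlyOn (fun n t => stepW (T / N n) (W n) t) f atTop (Icc 0 T) := by
  rw [Metric.tendstoUniformlyOn_iff]
  intro ε hε
  filter_upwards [h ε hε] with n hn t ht
  have hN' : (0 : ℝ) < N n := by exact_mod_cast hN n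
  have hk : 0 < T / N n := by positivity
  rw [dist_eq_norm]
  rcases ht.1.eq_or_lt with h0 | h0
  · rw [← h0, stepW_zero hk]
    exact hn.1
  · obtain ⟨m, hm⟩ := exists_mem_Ioc_step hT (hN n) ⟨h0, ht.2⟩
    rw [stepW_of_mem hk _ hm]
    exact hn.2 m t hm

theorem tendsto_timeStep {N : ℕ → ℕ} (hNtop : Tendsto N atTop atTop) (T : ℝ) :
    Tendsto (fun n => T / N n) atTop (𝓝 0) :=
  (tendsto_const_div_atTop_nhds_zero_nat T).comp hNtop

theorem tendstoUniformlyOn_stepW_comp (hT : 0 < T) {N : ℕ → ℕ} (hN : ∀ n, 0 < N n)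
    (hNtop : Tendsto N atTop atTop) {f : ℝ → Z} (hf : ContinuousOn f (Icc 0 T)) :
    TendstoUniformlyOn (fun n t => stepW (T / N n) (fun m : Fin (N n + 1) =>
      f ((m : ℕ) * (T / N n))) t) f atTop (Icc 0 T) := by
  refine tendstoUniformlyOn_stepW hT hN fun ε hε => ?_
  obtain ⟨δ, hδ, h⟩ := Metric.uniformContinuousOn_iff.mp
    (isCompact_Icc.uniformContinuousOn_of_continuous hf) ε hε
  filter_upwards [(tendsto_timeStep hNtop T).eventually (gt_mem_nhds hδ)] with n hn
  refine ⟨by simpa using hε, fun m t ht => ?_⟩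
  have h1 := step_mem_Icc hT (hN n) (m := m) m.2.le
  have h2 := step_mem_Icc hT (hN n) (m := m + 1) m.2
  rw [← dist_eq_norm]
  have e : (((m.succ : Fin (N n + 1)) : ℕ) : ℝ) = (m : ℝ) + 1 := by simp
  rw [e]
  rw [Nat.cast_add, Nat.cast_one] at h2
  refine h t ⟨h1.1.trans ht.1.le, ht.2.trans h2.2⟩ _ h2 ?_
  rw [Real.dist_eq, abs_sub_comm, abs_of_nonneg (by linarith [ht.2])]
  linarith [ht.1]

variable [NormedSpace ℝ Z]

/-- The mean value inequality for s ↦ s v'(t) - v(s). -/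
theorem norm_deriv_sub_slope_le {v : ℝ → Z} (hv : ContDiff ℝ 1 v) {a b t ε : ℝ} (hab : a < b)
    (h : ∀ s ∈ Icc a b, ‖deriv v t - deriv v s‖ ≤ ε) :
    ‖deriv v t - (b - a)⁻¹ • (v b - v a)‖ ≤ ε := by
  have hd : ∀ s ∈ Icc a b, HasDerivWithinAt (fun s => s • deriv v t - v s)
      (deriv v t - deriv v s) (Icc a b) s := by
    intro s _
    have h1 : HasDerivAt (fun s : ℝ => s • deriv v t) ((1 : ℝ) • deriv v t) s :=
      (hasDerivAt_id s).smul_const _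
    rw [one_smul] at h1
    exact (h1.sub ((hv.differentiable one_ne_zero) s).hasDerivAt).hasDerivWithinAt
  have key := Convex.norm_image_sub_le_of_norm_hasDerivWithin_le hd h (convex_Icc a b)
    (left_mem_Icc.mpr hab.le) (right_mem_Icc.mpr hab.le)
  have hba : 0 < b - a := by linarith
  have e : deriv v t - (b - a)⁻¹ • (v b - v a) =
      (b - a)⁻¹ • (b • deriv v t - v b - (a • deriv v t - v a)) := by
    have : deriv v t = (b - a)⁻¹ • ((b - a) • deriv v t) := by
      rw [smul_smul, inv_mul_cancel₀ hba.ne', one_smul]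
    nth_rewrite 1 [this]
    rw [← smul_sub]
    congr 1
    module
  rw [e, norm_smul, norm_inv, Real.norm_of_nonneg hba.le, inv_mul_le_iff₀ hba]
  rw [Real.norm_of_nonneg hba.le] at key
  linarith

/-- The difference quotients fill only the N intervals. The value v'(0) is put in front to have
convergence at t = 0 too, so that uniform convergence is available on the compact interval. -/
theorem tendstoUniformlyOn_stepW_deriv (hT : 0 < T) {N : ℕ → ℕ} (hN : ∀ n, 0 < N n)
    (hNtop : Tendsto N atTop atTop) {v : ℝ → Z} (hv : ContDiff ℝ 1 v) :
    TendstoUniformlyOn (fun n t => stepW (T / N n) (Fin.cons (α := fun _ => Z) (deriv v 0)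
      (discDeriv (N := N n) (T / N n) fun m : Fin (N n + 1) => v ((m : ℕ) * (T / N n)))) t)
      (deriv v) atTop (Icc 0 T) := by
  refine tendstoUniformlyOn_stepW hT hN fun ε hε => ?_
  obtain ⟨δ, hδ, h⟩ := Metric.uniformContinuousOn_iff.mp
    (isCompact_Icc.uniformContinuousOn_of_continuous
      (hv.continuous_deriv le_rfl).continuousOn (s := Icc 0 T)) (ε / 2) (half_pos hε)
  filter_upwards [(tendsto_timeStep hNtop T).eventually (gt_mem_nhds hδ)] with n hn
  refine ⟨by simpa using hε, fun m t ht => ?_⟩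
  have hN' : (0 : ℝ) < N n := by exact_mod_cast hN n
  have hk : 0 < T / N n := by positivity
  have h1 := step_mem_Icc hT (hN n) (m := m) m.2.le
  have h2 := step_mem_Icc hT (hN n) (m := m + 1) m.2
  rw [Nat.cast_add, Nat.cast_one] at h2
  refine lt_of_le_of_lt ?_ (half_lt_self hε)
  rw [Fin.cons_succ, discDeriv]
  have e1 : (((m.succ : Fin (N n + 1)) : ℕ) : ℝ) = (m : ℝ) + 1 := by simp
  have e2 : (((m.castSucc : Fin (N n + 1)) : ℕ) : ℝ) = (m : ℝ) := by simp
  have e3 : T / N n = ((m : ℝ) + 1) * (T / N n) - (m : ℝ) * (T / N n) := by ring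
  rw [e1, e2]
  nth_rewrite 1 [e3]
  refine norm_deriv_sub_slope_le hv (ht.1.trans_le ht.2) fun s hs => ?_
  rw [← dist_eq_norm]
  refine (h t ⟨h1.1.trans ht.1.le, ht.2.trans h2.2⟩ s ⟨h1.1.trans hs.1, hs.2.trans h2.2⟩ ?_).le
  rw [Real.dist_eq, abs_lt]
  constructor <;> linarith [ht.1, ht.2, hs.1, hs.2]

end UniformSteps

/-! ### Discrete interpolation of C¹ functions of time. -/

section Interpolation

variable {L E : Type*} [NormedAddCommGroup L] [InnerProductSpace ℝ L]
  [NormedAddCommGroup E] [InnerProductSpace ℝ E] [CompleteSpace L] [CompleteSpace E]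

namespace GradientDiscretisation

theorem exists_interpolation_contDiff (G : GradientOperator L E) {S : E ≃L[ℝ] E}
    (hS : (S : E →L[ℝ] E).IsPositive) {D : ℕ → GradientDiscretisation.{v} L E}
    (hcons : ∀ φ : G.Space, Tendsto (fun n => (D n).sigma G φ) atTop (𝓝 0))
    (hconf : ∀ φ ∈ G.HD, Tendsto (fun n => (D n).zeta G S φ) atTop (𝓝 0)) {T : ℝ} (hT : 0 < T)
    {N : ℕ → ℕ} (hN : ∀ n, 0 < N n) (hNtop : Tendsto N atTop atTop)
    {A : G.Space →L[ℝ] G.Space} (hA : ∀ z x, ⟪S (G.grad (A z)), G.grad x⟫ = ⟪z, x⟫)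
    {v : ℝ → G.Space} (hv : ContDiff ℝ 1 v) :
    ∃ w : (n : ℕ) → Fin (N n + 1) → (D n).X,
      Tendsto (fun n => eLpNorm (fun t => G.grad (A (gram G.incl (deriv v t))) -
        (D n).Gr ((D n).rieszDisc S (stepV (T / N n) (discDeriv (T / N n) (w n)) t))) 2
        (timeMeasure T)) atTop (𝓝 0) ∧
      Tendsto (fun n => eLpNorm (fun t => G.grad (v t) - (D n).Gr (stepW (T / N n) (w n) t)) 2
        (timeMeasure T)) atTop (𝓝 0) ∧
      Tendsto (fun n => ⨆ t ∈ Icc 0 T, ‖G.incl (v t) - (D n).P (stepW (T / N n) (w n) t)‖ₑ)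
        atTop (𝓝 0) := by
  obtain ⟨c, hc, hcoer⟩ := coercive_of_isPositive hS
  obtain ⟨C, hC, hP⟩ := exists_poincare G hS hconf
  choose I hI using fun n => (D n).exists_interpolation G
  have hIP0 : ∀ n x, ‖(D n).P (I n x) - G.incl x‖ ≤ (D n).sigma G x := fun n x =>
    ((Real.le_sqrt (norm_nonneg _) (by positivity)).mpr (by nlinarith [sq_nonneg ‖(D n).Gr (I n x) - G.grad x‖])
      : ‖(D n).P (I n x) - G.incl x‖ ≤ _).trans (hI n x)
  have hIG0 : ∀ n x, ‖(D n).Gr (I n x) - G.grad x‖ ≤ (D n).sigma G x := fun n x =>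
    ((Real.le_sqrt (norm_nonneg _) (by positivity)).mpr (by nlinarith [sq_nonneg ‖(D n).P (I n x) - G.incl x‖])
      : ‖(D n).Gr (I n x) - G.grad x‖ ≤ _).trans (hI n x)
  have hIP : ∀ x, Tendsto (fun n => (D n).P (I n x)) atTop (𝓝 (G.incl x)) := fun x =>
    tendsto_iff_norm_sub_tendsto_zero.mpr
      (squeeze_zero (fun n => norm_nonneg _) (fun n => hIP0 n x) (hcons x))
  have hIG : ∀ x, Tendsto (fun n => (D n).Gr (I n x)) atTop (𝓝 (G.grad x)) := fun x =>
    tendsto_iff_norm_sub_tendsto_zero.mpr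
      (squeeze_zero (fun n => norm_nonneg _) (fun n => hIG0 n x) (hcons x))
  -- Covers both reconstructions: σ(x) ≤ (‖ι‖ + 1)‖x‖, plus ‖ι x‖ ≤ ‖ι‖ ‖x‖ or ‖G x‖ = ‖x‖.
  set B := 2 * ‖G.incl‖ + 2 with hB
  have hσ : ∀ n x, (D n).sigma G x ≤ ‖G.incl‖ * ‖x‖ + ‖x‖ := fun n x => by
    refine ((D n).sigma_le G x).trans ?_
    rw [G.norm_grad]
    gcongr
    exact G.incl.le_opNorm x
  have hPb : ∀ n x, ‖(D n).P (I n x)‖ ≤ B * ‖x‖ := fun n x => by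
    have h1 := norm_le_norm_sub_add ((D n).P (I n x)) (G.incl x)
    have h2 := G.incl.le_opNorm x
    have h3 := norm_nonneg x
    rw [hB]
    linarith [hIP0 n x, hσ n x]
  have hGb : ∀ n x, ‖(D n).Gr (I n x)‖ ≤ B * ‖x‖ := fun n x => by
    have h1 := norm_le_norm_sub_add ((D n).Gr (I n x)) (G.grad x)
    rw [G.norm_grad] at h1
    have h3 : 0 ≤ ‖G.incl‖ * ‖x‖ := by positivity
    rw [hB]
    linarith [hIG0 n x, hσ n x]
  have hRb : ∀ n x, ‖(D n).Gr ((D n).rieszDisc S (I n x))‖ ≤ C / c * B * ‖x‖ := fun n x => by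
    refine ((D n).norm_Gr_rieszDisc_le hS hc hC hcoer (hP n) _).trans ?_
    rw [mul_assoc]
    gcongr
    exact hPb n x
  have hR := fun x => tendsto_Gr_rieszDisc G hS hconf hC.le hP hIP hIG hA x
  have uv := tendstoUniformlyOn_stepW_comp hT hN hNtop (hv.continuous.continuousOn (s := Icc 0 T))
  have ud := tendstoUniformlyOn_stepW_deriv hT hN hNtop hv
  have U1 := tendstoUniformlyOn_of_strong (A := fun n => (D n).Gr.comp (I n))
    (A' := G.grad.toLinearMap) hGb hIG isCompact_Icc hv.continuous.continuousOn uv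
  have U2 := tendstoUniformlyOn_of_strong (A := fun n => (D n).P.comp (I n))
    (A' := G.incl.toLinearMap) hPb hIP isCompact_Icc hv.continuous.continuousOn uv
  have U3 := tendstoUniformlyOn_of_strong
    (A := fun n => (D n).Gr.comp (((D n).rieszDiscₗ hS).comp (I n)))
    (A' := (G.grad.comp (A.comp (gram G.incl))).toLinearMap) hRb hR isCompact_Icc
    (hv.continuous_deriv le_rfl).continuousOn ud
  have hmap : ∀ n t, I n (stepW (T / N n) (fun m : Fin (N n + 1) => v ((m : ℕ) * (T / N n))) t) =
      stepW (T / N n) (fun m : Fin (N n + 1) => I n (v ((m : ℕ) * (T / N n)))) t :=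
    fun n t => map_stepW _ _ _
  -- Nodal values in time, best approximation in space; linearity of I makes it commute with the
  -- difference quotient.
  refine ⟨fun n m => I n (v ((m : ℕ) * (T / N n))), ?_, ?_, ?_⟩
  · refine (tendsto_eLpNorm_of_tendstoUniformlyOn U3).congr fun n => eLpNorm_congr_ae ?_
    filter_upwards [ae_exists_mem_Ioo_step hT (hN n)] with t ⟨m, hm⟩
    have hN' : (0 : ℝ) < N n := by exact_mod_cast hN n
    have hk : 0 < T / N n := by positivity
    rw [stepW_of_mem hk _ (Ioo_subset_Ioc_self hm), stepV_of_mem hk _ hm, Fin.cons_succ]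
    change G.grad (A (gram G.incl (deriv v t))) - (D n).Gr ((D n).rieszDisc S (I n _)) = _
    congr 3
    simp only [discDeriv, map_smul, map_sub]
  · refine (tendsto_eLpNorm_of_tendstoUniformlyOn U1).congr fun n => ?_
    simp_rw [← hmap]
    rfl
  · refine (tendsto_iSup_of_tendstoUniformlyOn U2).congr fun n => ?_
    simp_rw [← hmap]
    rfl

end GradientDiscretisation
end Interpolation

/-! ### Approximation of the elements of W. -/

section Approximation

variable {L E : Type*} [NormedAddCommGroup L] [InnerProductSpace ℝ L]
  [NormedAddCommGroup E] [InnerProductSpace ℝ E]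

namespace GradientDiscretisation

/-- The `L²` distance between `G R u'` and `Gr R_h ∂w`. -/
def derivError (D : GradientDiscretisation.{v} L E) (G : GradientOperator L E) (S : E ≃L[ℝ] E)
    (T : ℝ) (N : ℕ) (u : ℝ → G.Space) (w : Fin (N + 1) → D.X) : ℝ≥0∞ :=
  eLpNorm (fun t => G.grad (G.riesz S (timeDeriv G T u t)) -
    D.Gr (D.rieszDisc S (stepV (T / N) (discDeriv (T / N) w) t))) 2 (timeMeasure T)

/-- The `L²` distance between `G u` and `Gr w`. -/
def gradError (D : GradientDiscretisation.{v} L E) (G : GradientOperator L E)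
    (T : ℝ) (N : ℕ) (u : ℝ → G.Space) (w : Fin (N + 1) → D.X) : ℝ≥0∞ :=
  eLpNorm (fun t => G.grad (u t) - D.Gr (stepW (T / N) w t)) 2 (timeMeasure T)

/-- The uniform distance in `L` between `u` and `P w`. -/
def supError (D : GradientDiscretisation.{v} L E) (G : GradientOperator L E)
    (T : ℝ) (N : ℕ) (u : ℝ → G.Space) (w : Fin (N + 1) → D.X) : ℝ≥0∞ :=
  ⨆ t ∈ Icc 0 T, ‖contRep G T u t - D.P (stepW (T / N) w t)‖ₑ

/-- The unweighted version of the distance `deltaT`. -/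
def approxError (D : GradientDiscretisation.{v} L E) (G : GradientOperator L E) (S : E ≃L[ℝ] E)
    (T : ℝ) (N : ℕ) (u : ℝ → G.Space) (w : Fin (N + 1) → D.X) : ℝ≥0∞ :=
  D.derivError G S T N u w + D.gradError G T N u w + D.supError G T N u w

/-- Weights and coefficients are bounded operators, so it is enough to make the unweighted distance
small; K depends neither on the discretisation nor on N. -/
theorem exists_deltaT_le (G : GradientOperator L E) (S : E ≃L[ℝ] E) {Λ : ℝ → E →L[ℝ] E} {T M : ℝ}
    (hM : ∀ᵐ t ∂timeMeasure T, ‖(S.symm : E →L[ℝ] E).comp (Λ t)‖ ≤ M) :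
    ∃ K : ℝ≥0∞, K ≠ ∞ ∧ ∀ (D : GradientDiscretisation.{v} L E) (N : ℕ) (u : ℝ → G.Space)
      (w : Fin (N + 1) → D.X), D.deltaT G S Λ T N u w ≤ K * D.approxError G S T N u w := by
  set K₁ := √‖(S : E →L[ℝ] E)‖ with hK₁
  set K₂ := √‖(S.symm : E →L[ℝ] E)‖ * (‖(S : E →L[ℝ] E)‖ * M) with hK₂
  set K : ℝ≥0∞ := max (max (ENNReal.ofReal K₁) (ENNReal.ofReal K₂)) 1 with hK
  refine ⟨K, by simp [hK], fun D N u w => ?_⟩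
  rw [deltaT, approxError, mul_add, mul_add]
  gcongr ?_ + ?_ + ?_
  · refine (eLpNorm_le_mul_eLpNorm_of_ae_le_mul (c := K₁) (Eventually.of_forall fun t => ?_) 2).trans
      (mul_le_mul_left ((le_max_left _ _).trans (le_max_left _ _)) _)
    rw [Real.norm_of_nonneg (weightedNorm_nonneg _ _)]
    exact weightedNorm_le _ _
  · refine (eLpNorm_le_mul_eLpNorm_of_ae_le_mul (c := K₂) ?_ 2).trans
      (mul_le_mul_left ((le_max_right _ _).trans (le_max_left _ _)) _)
    filter_upwards [hM] with t ht
    rw [Real.norm_of_nonneg (weightedNorm_nonneg _ _)]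
    refine (weightedNorm_le _ _).trans ?_
    rw [hK₂, mul_assoc]
    gcongr
    set ξ := G.grad (u t) - D.Gr (stepW (T / N) w t)
    have h1 : Λ t ξ = (S : E →L[ℝ] E) ((S.symm : E →L[ℝ] E).comp (Λ t) ξ) := by simp
    calc ‖Λ t ξ‖ = ‖(S : E →L[ℝ] E) ((S.symm : E →L[ℝ] E).comp (Λ t) ξ)‖ := by rw [← h1]
      _ ≤ ‖(S : E →L[ℝ] E)‖ * (‖(S.symm : E →L[ℝ] E).comp (Λ t)‖ * ‖ξ‖) := by
          refine ((S : E →L[ℝ] E).le_opNorm _).trans ?_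
          gcongr
          exact ContinuousLinearMap.le_opNorm _ _
      _ ≤ ‖(S : E →L[ℝ] E)‖ * (M * ‖ξ‖) := by gcongr
      _ = _ := by ring
  · calc _ = 1 * D.supError G T N u w := (one_mul _).symm
      _ ≤ _ := mul_le_mul_left (le_max_right _ _) _

variable [CompleteSpace L] [CompleteSpace E]

theorem tendsto_iInf_approxError (G : GradientOperator L E) {S : E ≃L[ℝ] E}
    (hS : (S : E →L[ℝ] E).IsPositive) {D : ℕ → GradientDiscretisation.{v} L E}
    (hcons : ∀ φ : G.Space, Tendsto (fun n => (D n).sigma G φ) atTop (𝓝 0))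
    (hconf : ∀ φ ∈ G.HD, Tendsto (fun n => (D n).zeta G S φ) atTop (𝓝 0)) {T : ℝ} (hT : 0 < T)
    {N : ℕ → ℕ} (hN : ∀ n, 0 < N n) (hNtop : Tendsto N atTop atTop) {u : ℝ → G.Space}
    (hu : MemW G T u) :
    Tendsto (fun n => ⨅ w : Fin (N n + 1) → (D n).X, (D n).approxError G S T (N n) u w) atTop
      (𝓝 0) := by
  obtain ⟨A, hA, hAr⟩ := G.exists_rieszMap hS
  have hlim : Tendsto (fun j : ℕ => ENNReal.ofReal (‖A‖ * (1 / ((j : ℝ) + 1))) +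
      ENNReal.ofReal (1 / ((j : ℝ) + 1)) + ENNReal.ofReal (1 / ((j : ℝ) + 1))) atTop (𝓝 0) := by
    have h0 := tendsto_one_div_add_atTop_nhds_zero_nat (𝕜 := ℝ)
    have h1 := ENNReal.tendsto_ofReal h0
    have h2 := ENNReal.tendsto_ofReal (h0.const_mul ‖A‖)
    simpa using (h2.add h1).add h1
  rw [ENNReal.tendsto_nhds_zero]
  intro ε hε
  have hε2 : 0 < ε / 2 := ENNReal.div_pos hε.ne' (by norm_num)
  obtain ⟨j, hj⟩ := (hlim.eventually (ge_mem_nhds hε2)).exists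
  set δ : ℝ := 1 / ((j : ℝ) + 1) with hδ
  have hδ0 : 0 < δ := Nat.one_div_pos_of_nat
  -- The C¹ function is fixed first, at cost ε/2; only then does n grow, so no rate of interpolation
  -- is needed.
  obtain ⟨v, hv, hvu, hvz, hvs⟩ := hu.exists_contDiff_approx hT hδ0
  obtain ⟨w, hw1, hw2, hw3⟩ := exists_interpolation_contDiff G hS hcons hconf hT hN hNtop hA hv
  have hsum := (hw1.add hw2).add hw3
  rw [add_zero, add_zero] at hsum
  have hvc := hv.continuous
  have hvL : MemLp v 2 (timeMeasure T) := memLp_timeMeasure_of_continuousOn hvc.continuousOn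
  have hKc : Continuous fun t => gram G.incl (deriv v t) :=
    (gram G.incl).continuous.comp (hv.continuous_deriv le_rfl)
  filter_upwards [hsum.eventually (ge_mem_nhds hε2)] with n hn
  refine (iInf_le _ (w n)).trans ?_
  have b1 : (D n).derivError G S T (N n) u (w n) ≤ ENNReal.ofReal (‖A‖ * δ) +
      eLpNorm (fun t => G.grad (A (gram G.incl (deriv v t))) -
        (D n).Gr ((D n).rieszDisc S (stepV (T / N n) (discDeriv (T / N n) (w n)) t))) 2
        (timeMeasure T) := by
    have e : (fun t => G.grad (G.riesz S (timeDeriv G T u t)) -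
        (D n).Gr ((D n).rieszDisc S (stepV (T / N n) (discDeriv (T / N n) (w n)) t))) =
        (fun t => G.grad (A (rieszDeriv G T u t - gram G.incl (deriv v t)))) +
        fun t => G.grad (A (gram G.incl (deriv v t))) -
        (D n).Gr ((D n).rieszDisc S (stepV (T / N n) (discDeriv (T / N n) (w n)) t)) := by
      funext t
      rw [Pi.add_apply, hAr, map_sub, map_sub]
      change _ = G.grad (A ((InnerProductSpace.toDual ℝ G.Space).symm (timeDeriv G T u t))) - _ + _
      abel
    rw [derivError, e]
    refine (eLpNorm_add_le ?_ ?_ (by norm_num)).trans (add_le_add_left ?_ _)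
    · exact (G.grad.comp A).continuous.comp_aestronglyMeasurable
        (hu.memLp_rieszDeriv.1.sub hKc.aestronglyMeasurable)
    · refine (((G.grad.comp A).continuous.comp hKc).aestronglyMeasurable).sub ?_
      exact (memLp_map_stepV ((D n).Gr.comp ((D n).rieszDiscₗ hS)) _).1
    · refine (eLpNorm_le_mul_eLpNorm_of_ae_le_mul
        (g := fun t => gram G.incl (deriv v t) - rieszDeriv G T u t) (c := ‖A‖)
        (Eventually.of_forall fun t => ?_) 2).trans ?_
      · rw [G.norm_grad, norm_sub_rev (gram G.incl (deriv v t))]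
        exact A.le_opNorm _
      · rw [ENNReal.ofReal_mul (A.opNorm_nonneg)]
        gcongr
  have b2 : (D n).gradError G T (N n) u (w n) ≤ ENNReal.ofReal δ +
      eLpNorm (fun t => G.grad (v t) - (D n).Gr (stepW (T / N n) (w n) t)) 2 (timeMeasure T) := by
    have e : (fun t => G.grad (u t) - (D n).Gr (stepW (T / N n) (w n) t)) =
        (fun t => G.grad (u t - v t)) +
          fun t => G.grad (v t) - (D n).Gr (stepW (T / N n) (w n) t) := by
      funext t
      rw [Pi.add_apply, map_sub]
      abel
    rw [gradError, e]
    refine (eLpNorm_add_le ?_ ?_ (by norm_num)).trans (add_le_add_left ?_ _)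
    · exact G.grad.continuous.comp_aestronglyMeasurable (hu.1.1.sub hvL.1)
    · exact (G.grad.continuous.comp_aestronglyMeasurable hvL.1).sub (memLp_map_stepW _ _).1
    · refine (eLpNorm_mono fun t => ?_).trans hvu
      rw [G.norm_grad, norm_sub_rev]
  have b3 : (D n).supError G T (N n) u (w n) ≤ ENNReal.ofReal δ +
      ⨆ t ∈ Icc 0 T, ‖G.incl (v t) - (D n).P (stepW (T / N n) (w n) t)‖ₑ := by
    refine iSup₂_le fun t ht => ?_
    have e : contRep G T u t - (D n).P (stepW (T / N n) (w n) t) =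
        (contRep G T u t - G.incl (v t)) +
          (G.incl (v t) - (D n).P (stepW (T / N n) (w n) t)) := by abel
    rw [e]
    refine (enorm_add_le _ _).trans (add_le_add ?_ ?_)
    · rw [← ofReal_norm]
      exact ENNReal.ofReal_le_ofReal (hvs t ht)
    · exact le_iSup₂ (f := fun t (_ : t ∈ Icc 0 T) =>
        ‖G.incl (v t) - (D n).P (stepW (T / N n) (w n) t)‖ₑ) t ht
  rw [approxError, ← ENNReal.add_halves ε]
  refine (add_le_add (add_le_add b1 b2) b3).trans ((le_of_eq ?_).trans (add_le_add hj hn))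
  ring

/-- Every element of `W` is the limit of discrete functions. -/
theorem exists_tendsto_approxError (G : GradientOperator L E) {S : E ≃L[ℝ] E}
    (hS : (S : E →L[ℝ] E).IsPositive) {D : ℕ → GradientDiscretisation.{v} L E}
    (hcons : ∀ φ : G.Space, Tendsto (fun n => (D n).sigma G φ) atTop (𝓝 0))
    (hconf : ∀ φ ∈ G.HD, Tendsto (fun n => (D n).zeta G S φ) atTop (𝓝 0)) {T : ℝ} (hT : 0 < T)
    {N : ℕ → ℕ} (hN : ∀ n, 0 < N n) (hNtop : Tendsto N atTop atTop) {u : ℝ → G.Space}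
    (hu : MemW G T u) :
    ∃ w : (n : ℕ) → Fin (N n + 1) → (D n).X,
      Tendsto (fun n => (D n).approxError G S T (N n) u (w n)) atTop (𝓝 0) := by
  have h := tendsto_iInf_approxError G hS hcons hconf hT hN hNtop hu
  have hex : ∀ n, ∃ w : Fin (N n + 1) → (D n).X, (D n).approxError G S T (N n) u w ≤
      (⨅ w : Fin (N n + 1) → (D n).X, (D n).approxError G S T (N n) u w) +
        ENNReal.ofReal (1 / ((n : ℝ) + 1)) := by
    intro n
    set a := ⨅ w : Fin (N n + 1) → (D n).X, (D n).approxError G S T (N n) u w with ha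
    by_cases hatop : a = ∞
    · exact ⟨0, by rw [hatop, top_add]; exact le_top⟩
    · have hpos : 0 < ENNReal.ofReal (1 / ((n : ℝ) + 1)) :=
        ENNReal.ofReal_pos.mpr Nat.one_div_pos_of_nat
      obtain ⟨w, hw⟩ := iInf_lt_iff.mp (ENNReal.lt_add_right hatop hpos.ne')
      exact ⟨w, hw.le⟩
  choose w hw using hex
  refine ⟨w, ?_⟩
  have h1 := ENNReal.tendsto_ofReal (tendsto_one_div_add_atTop_nhds_zero_nat (𝕜 := ℝ))
  have h2 := h.add h1
  rw [ENNReal.ofReal_zero, add_zero] at h2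
  exact tendsto_of_tendsto_of_tendsto_of_le_of_le tendsto_const_nhds h2 (fun n => zero_le) hw

end GradientDiscretisation
end Approximation

/-! ### Strongly measurable operator coefficients. -/

section OperatorMeasurability

variable {E : Type*} [NormedAddCommGroup E] [InnerProductSpace ℝ E] {α : Type*}
  {mα : MeasurableSpace α} {μ : Measure α}

/-- Λ is not assumed measurable in operator norm. For a simple g the product is a finite sum of
pieces Λ(·)x on measurable sets; the general case is a pointwise limit by continuity of each Λ(t).
-/
theorem aestronglyMeasurable_apply {Λ : α → E →L[ℝ] E}
    (hΛ : ∀ ξ : E, AEStronglyMeasurable (fun t => Λ t ξ) μ) {g : α → E}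
    (hg : AEStronglyMeasurable g μ) : AEStronglyMeasurable (fun t => Λ t (g t)) μ := by
  have hsimple : ∀ s : SimpleFunc α E, AEStronglyMeasurable (fun t => Λ t (s t)) μ := by
    intro s
    have e : (fun t => Λ t (s t)) =
        ∑ x ∈ s.range, (s ⁻¹' {x}).indicator fun t => Λ t x := by
      funext t
      rw [Finset.sum_apply, Finset.sum_eq_single (s t)]
      · rw [indicator_of_mem (by simp)]
      · intro x _ hx
        exact indicator_of_notMem (fun h => hx h.symm) _
      · intro h
        exact absurd (s.mem_range_self t) h
    rw [e]
    exact Finset.aestronglyMeasurable_sum _ fun x _ => (hΛ x).indicator (s.measurableSet_fiber x)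
  have h1 : AEStronglyMeasurable (fun t => Λ t (hg.mk g t)) μ := by
    refine aestronglyMeasurable_of_tendsto_ae atTop
      (fun n => hsimple (hg.stronglyMeasurable_mk.approx n)) (Eventually.of_forall fun t => ?_)
    exact ((Λ t).continuous.tendsto _).comp (hg.stronglyMeasurable_mk.tendsto_approx t)
  refine h1.congr ?_
  filter_upwards [hg.ae_eq_mk] with t ht
  rw [← ht]

theorem memLp_apply {Λ : α → E →L[ℝ] E}
    (hΛ : ∀ ξ : E, AEStronglyMeasurable (fun t => Λ t ξ) μ) {B : ℝ}
    (hB : ∀ᵐ t ∂μ, ∀ ξ, ‖Λ t ξ‖ ≤ B * ‖ξ‖) {g : α → E} (hg : MemLp g 2 μ) :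
    MemLp (fun t => Λ t (g t)) 2 μ :=
  hg.of_le_mul (aestronglyMeasurable_apply hΛ hg.1) (hB.mono fun t ht => ht (g t))

theorem toReal_eLpNorm_apply_le {Λ : α → E →L[ℝ] E} {B : ℝ} (hB0 : 0 ≤ B)
    (hB : ∀ᵐ t ∂μ, ∀ ξ, ‖Λ t ξ‖ ≤ B * ‖ξ‖) {g : α → E} (hg : MemLp g 2 μ) :
    (eLpNorm (fun t => Λ t (g t)) 2 μ).toReal ≤ B * (eLpNorm g 2 μ).toReal := by
  have h := eLpNorm_le_mul_eLpNorm_of_ae_le_mul (hB.mono fun t ht => ht (g t)) 2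
  have h2 := ENNReal.toReal_mono (ENNReal.mul_ne_top ENNReal.ofReal_ne_top hg.2.ne) h
  rwa [ENNReal.toReal_mul, ENNReal.toReal_ofReal hB0] at h2

end OperatorMeasurability

/-! ### Linearity and end values of step functions. -/

section StepLinearity

variable {X : Type*} [AddCommGroup X] {N : ℕ} {k T : ℝ}

theorem stepV_discDeriv_sub [Module ℝ X] (w v : Fin (N + 1) → X) (t : ℝ) :
    stepV k (discDeriv k (w - v)) t = stepV k (discDeriv k w) t - stepV k (discDeriv k v) t := by
  rw [stepV, stepV, stepV, ← Finset.sum_sub_distrib]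
  refine Finset.sum_congr rfl fun m _ => ?_
  by_cases ht : t ∈ Ioo ((m : ℝ) * k) (((m : ℝ) + 1) * k)
  · simp only [indicator_of_mem ht, discDeriv, Pi.sub_apply, ← smul_sub]
    congr 1
    abel
  · simp only [indicator_of_notMem ht, sub_zero]

theorem stepW_sub (w v : Fin (N + 1) → X) (t : ℝ) :
    stepW k (w - v) t = stepW k w t - stepW k v t := by
  rw [stepW, stepW, stepW, add_sub_add_comm, ← Finset.sum_sub_distrib]
  congr 1
  · by_cases ht : t ∈ ({0} : Set ℝ)
    · simp only [indicator_of_mem ht, Pi.sub_apply]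
    · simp only [indicator_of_notMem ht, sub_zero]
  · refine Finset.sum_congr rfl fun m _ => ?_
    by_cases ht : t ∈ Ioc ((m : ℝ) * k) (((m : ℝ) + 1) * k)
    · simp only [indicator_of_mem ht, Pi.sub_apply]
    · simp only [indicator_of_notMem ht, sub_zero]

theorem exists_stepW_eq (hT : 0 < T) (hN : 0 < N) (w : Fin (N + 1) → X) {t : ℝ}
    (ht : t ∈ Icc 0 T) : ∃ m, stepW (T / N) w t = w m := by
  have hN' : (0 : ℝ) < N := by exact_mod_cast hN
  have hk : 0 < T / N := by positivity
  rcases ht.1.eq_or_lt with h0 | h0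
  · exact ⟨0, by rw [← h0, stepW_zero hk]⟩
  · obtain ⟨m, hm⟩ := exists_mem_Ioc_step hT hN ⟨h0, ht.2⟩
    exact ⟨m.succ, stepW_of_mem hk w hm⟩

theorem stepW_last (hT : 0 < T) (hN : 0 < N) (w : Fin (N + 1) → X) :
    stepW (T / N) w T = w (Fin.last N) := by
  have hN' : (0 : ℝ) < N := by exact_mod_cast hN
  have hk : 0 < T / N := by positivity
  obtain ⟨j, rfl⟩ := Nat.exists_eq_succ_of_ne_zero hN.ne'
  have e : T = ((j : ℝ) + 1) * (T / (j.succ : ℕ)) := by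
    rw [Nat.cast_succ]
    field_simp
  have hm : T ∈ Ioc (((Fin.last j : Fin (j + 1)) : ℕ) * (T / (j.succ : ℕ)))
      ((((Fin.last j : Fin (j + 1)) : ℕ) + 1) * (T / (j.succ : ℕ))) := by
    rw [Fin.val_last]
    refine ⟨?_, e.le⟩
    nth_rewrite 2 [e]
    nlinarith
  rw [stepW_of_mem hk w hm]
  rfl

theorem stepV_succ_ae_eq_stepW (hT : 0 < T) (hN : 0 < N) (w : Fin (N + 1) → X) :
    ∀ᵐ t ∂timeMeasure T, stepV (T / N) (fun m => w m.succ) t = stepW (T / N) w t := by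
  have hN' : (0 : ℝ) < N := by exact_mod_cast hN
  have hk : 0 < T / N := by positivity
  filter_upwards [ae_exists_mem_Ioo_step hT hN] with t ⟨m, hm⟩
  rw [stepV_of_mem hk _ hm, stepW_of_mem hk w (Ioo_subset_Ioc_self hm)]

end StepLinearity

/-! ### Consistency error of the scheme. -/

section Residual

variable {L E : Type*} [NormedAddCommGroup L] [InnerProductSpace ℝ L]
  [NormedAddCommGroup E] [InnerProductSpace ℝ E]

theorem intervalIntegral_inner_const {Z : Type*} [NormedAddCommGroup Z] [InnerProductSpace ℝ Z]
    [CompleteSpace Z] {f : ℝ → Z} {a b : ℝ} (hf : IntervalIntegrable f volume a b) (x : Z) :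
    ∫ t in a..b, ⟪f t, x⟫ = ⟪∫ t in a..b, f t, x⟫ := by
  have h := ((innerSL ℝ).flip x).intervalIntegral_comp_comm hf
  exact h

namespace GradientDiscretisation

/-- The norm `‖Gr y‖` in `L²(0,T;E)` of an element of `V_h`. -/
def gradNorm (D : GradientDiscretisation.{v} L E) (T : ℝ) (N : ℕ) (y : Fin N → D.X) : ℝ :=
  (eLpNorm (fun t => D.Gr (stepV (T / N) y t)) 2 (timeMeasure T)).toReal

/-- The bilinear form of the implicit Euler scheme. -/
def eulerForm (D : GradientDiscretisation.{v} L E) (Λ : ℝ → E →L[ℝ] E) (T : ℝ) (N : ℕ)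
    (w : Fin (N + 1) → D.X) (y : Fin N → D.X) : ℝ :=
  (∫ t, ⟪D.P (stepV (T / N) (discDeriv (T / N) w) t), D.P (stepV (T / N) y t)⟫ ∂timeMeasure T) +
    ∫ t, ⟪Λ t (D.Gr (stepW (T / N) w t)), D.Gr (stepV (T / N) y t)⟫ ∂timeMeasure T

theorem gradNorm_nonneg (D : GradientDiscretisation.{v} L E) (T : ℝ) (N : ℕ) (y : Fin N → D.X) :
    0 ≤ D.gradNorm T N y := ENNReal.toReal_nonneg

theorem integral_inner_stepV {X Z : Type*} [AddCommGroup X] [Module ℝ X] [NormedAddCommGroup Z]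
    [InnerProductSpace ℝ Z] {T : ℝ} {N : ℕ} (hT : 0 < T) (hN : 0 < N) (A B : X →ₗ[ℝ] Z)
    (x y : Fin N → X) :
    ∫ t, ⟪A (stepV (T / N) x t), B (stepV (T / N) y t)⟫ ∂timeMeasure T =
      T / N * ∑ m, ⟪A (x m), B (y m)⟫ := by
  have hN' : (0 : ℝ) < N := by exact_mod_cast hN
  have hk : 0 < T / N := by positivity
  rw [integral_timeMeasure_eq_sum hT hN (integrable_inner_of_memLp (memLp_map_stepV _ _)
    (memLp_map_stepV _ _)), Finset.mul_sum]
  refine Finset.sum_congr rfl fun m _ => ?_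
  rw [intervalIntegral_step_congr hk (g := fun _ => ⟪A (x m), B (y m)⟫) m fun t ht => by
    rw [stepV_of_mem hk x ht, stepV_of_mem hk y ht], intervalIntegral.integral_const, smul_eq_mul]
  ring

theorem gradNorm_sq (D : GradientDiscretisation.{v} L E) {T : ℝ} {N : ℕ} (hT : 0 < T) (hN : 0 < N)
    (y : Fin N → D.X) : D.gradNorm T N y ^ 2 = T / N * ∑ m, ‖D.Gr (y m)‖ ^ 2 := by
  rw [gradNorm, toReal_eLpNorm_two_sq (memLp_map_stepV _ _)]
  simp_rw [← real_inner_self_eq_norm_sq]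
  exact integral_inner_stepV hT hN D.Gr D.Gr y y

theorem eulerForm_sub (D : GradientDiscretisation.{v} L E) {Λ : ℝ → E →L[ℝ] E} {T : ℝ} {N : ℕ}
    (hΛ : ∀ ξ : E, AEStronglyMeasurable (fun t => Λ t ξ) (timeMeasure T)) {B : ℝ}
    (hB : ∀ᵐ t ∂timeMeasure T, ∀ ξ, ‖Λ t ξ‖ ≤ B * ‖ξ‖) (w v : Fin (N + 1) → D.X)
    (y : Fin N → D.X) :
    D.eulerForm Λ T N (w - v) y = D.eulerForm Λ T N w y - D.eulerForm Λ T N v y := by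
  have hPy : MemLp (fun t => D.P (stepV (T / N) y t)) 2 (timeMeasure T) := memLp_map_stepV _ _
  have hGy : MemLp (fun t => D.Gr (stepV (T / N) y t)) 2 (timeMeasure T) := memLp_map_stepV _ _
  simp only [eulerForm, stepV_discDeriv_sub, stepW_sub, map_sub, inner_sub_left]
  rw [integral_sub (integrable_inner_of_memLp (memLp_map_stepV _ _) hPy)
      (integrable_inner_of_memLp (memLp_map_stepV _ _) hPy),
    integral_sub (integrable_inner_of_memLp (memLp_apply hΛ hB (memLp_map_stepW _ _)) hGy)
      (integrable_inner_of_memLp (memLp_apply hΛ hB (memLp_map_stepW _ _)) hGy)]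
  ring

theorem abs_le_zetaT_mul (D : GradientDiscretisation.{v} L E) (G : GradientOperator L E)
    (S : E ≃L[ℝ] E) {T : ℝ} {N : ℕ} {φ : ℝ → E} (h : D.zetaT G S T N φ ≠ ∞) (y : Fin N → D.X) :
    |(∫ t, ⟪φ t, D.Gr (stepV (T / N) y t)⟫ ∂timeMeasure T) +
      ∫ t, ⟪G.div (φ t), D.P (stepV (T / N) y t)⟫ ∂timeMeasure T| ≤
      (D.zetaT G S T N φ).toReal * (√‖(S : E →L[ℝ] E)‖ * D.gradNorm T N y) := by
  by_cases hy : y = 0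
  · have e : ∀ t, stepV (T / N) y t = 0 := fun t => by simp [hy, stepV]
    simp only [e, map_zero, inner_zero_right, integral_zero, add_zero, abs_zero]
    exact mul_nonneg ENNReal.toReal_nonneg (mul_nonneg (Real.sqrt_nonneg _) (D.gradNorm_nonneg _ _ _))
  have hGy : MemLp (fun t => D.Gr (stepV (T / N) y t)) 2 (timeMeasure T) := memLp_map_stepV _ _
  set a := |(∫ t, ⟪φ t, D.Gr (stepV (T / N) y t)⟫ ∂timeMeasure T) +
      ∫ t, ⟪G.div (φ t), D.P (stepV (T / N) y t)⟫ ∂timeMeasure T| with ha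
  set b := eLpNorm (fun t => weightedNorm (S : E →L[ℝ] E) (D.Gr (stepV (T / N) y t))) 2
    (timeMeasure T) with hb
  have hle : ENNReal.ofReal a / b ≤ D.zetaT G S T N φ :=
    le_iSup₂ (f := fun (y : Fin N → D.X) (_ : y ≠ 0) => ENNReal.ofReal
        |(∫ t, ⟪φ t, D.Gr (stepV (T / N) y t)⟫ ∂timeMeasure T) +
          ∫ t, ⟪G.div (φ t), D.P (stepV (T / N) y t)⟫ ∂timeMeasure T| /
      eLpNorm (fun t => weightedNorm (S : E →L[ℝ] E) (D.Gr (stepV (T / N) y t))) 2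
        (timeMeasure T)) y hy
  have hbt : b ≤ ENNReal.ofReal √‖(S : E →L[ℝ] E)‖ *
      eLpNorm (fun t => D.Gr (stepV (T / N) y t)) 2 (timeMeasure T) := by
    refine eLpNorm_le_mul_eLpNorm_of_ae_le_mul (Eventually.of_forall fun t => ?_) 2
    rw [Real.norm_of_nonneg (weightedNorm_nonneg _ _)]
    exact weightedNorm_le _ _
  have hbtop : b ≠ ∞ := ne_top_of_le_ne_top (ENNReal.mul_ne_top ENNReal.ofReal_ne_top hGy.2.ne) hbt
  have hab : ENNReal.ofReal a ≤ D.zetaT G S T N φ * b := by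
    by_cases hb0 : b = 0
    · have h0 : ENNReal.ofReal a = 0 := by
        by_contra hne
        rw [hb0, ENNReal.div_zero hne] at hle
        exact h (top_le_iff.mp hle)
      rw [h0]
      exact zero_le
    · exact (ENNReal.div_le_iff hb0 hbtop).mp hle
  have h1 := ENNReal.toReal_mono (ENNReal.mul_ne_top h
    (ENNReal.mul_ne_top ENNReal.ofReal_ne_top hGy.2.ne)) (hab.trans (mul_le_mul_right hbt _))
  rwa [ENNReal.toReal_ofReal (abs_nonneg _), ENNReal.toReal_mul, ENNReal.toReal_mul,
    ENNReal.toReal_ofReal (Real.sqrt_nonneg _)] at h1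

variable [CompleteSpace L] [CompleteSpace E]

/-- The scheme tested with `y m` on each interval, multiplied by k and summed: the mean values of
the data become integrals over (0,T). -/
theorem IsSchemeSolution.eulerForm_eq {D : GradientDiscretisation.{v} L E} {T : ℝ} {N : ℕ}
    (hT : 0 < T) (hN : 0 < N) {Λ : ℝ → E →L[ℝ] E}
    (hΛ : ∀ ξ : E, AEStronglyMeasurable (fun t => Λ t ξ) (timeMeasure T)) {B : ℝ}
    (hB : ∀ᵐ t ∂timeMeasure T, ∀ ξ, ‖Λ t ξ‖ ≤ B * ‖ξ‖) {Φ : L →ₗ[ℝ] L}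
    {f : ℝ → L} (hf : MemLp f 2 (timeMeasure T)) {F : ℝ → E} (hF : MemLp F 2 (timeMeasure T))
    {ξ₀ : L} {w : Fin (N + 1) → D.X} (hw : D.IsSchemeSolution T N Λ Φ f F ξ₀ w)
    (y : Fin N → D.X) :
    D.eulerForm Λ T N w y = (∫ t, ⟪f t, D.P (stepV (T / N) y t)⟫ ∂timeMeasure T) -
      ∫ t, ⟪F t, D.Gr (stepV (T / N) y t)⟫ ∂timeMeasure T := by
  have hN' : (0 : ℝ) < N := by exact_mod_cast hN
  have hk : 0 < T / N := by positivity
  have hPy : MemLp (fun t => D.P (stepV (T / N) y t)) 2 (timeMeasure T) := memLp_map_stepV _ _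
  have hGy : MemLp (fun t => D.Gr (stepV (T / N) y t)) 2 (timeMeasure T) := memLp_map_stepV _ _
  have hΛw : MemLp (fun t => Λ t (D.Gr (stepW (T / N) w t))) 2 (timeMeasure T) :=
    memLp_apply hΛ hB (memLp_map_stepW _ _)
  rw [eulerForm, integral_inner_stepV hT hN,
    integral_timeMeasure_eq_sum hT hN (integrable_inner_of_memLp hΛw hGy),
    integral_timeMeasure_eq_sum hT hN (integrable_inner_of_memLp hf hPy),
    integral_timeMeasure_eq_sum hT hN (integrable_inner_of_memLp hF hGy), Finset.mul_sum,
    ← Finset.sum_add_distrib, ← Finset.sum_sub_distrib]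
  refine Finset.sum_congr rfl fun m _ => ?_
  have h1 := step_mem_Icc hT hN (m := m) m.2.le
  have h2 := step_mem_Icc hT hN (m := m + 1) m.2
  rw [Nat.cast_add, Nat.cast_one] at h2
  rw [intervalIntegral_step_congr hk (f := fun t => ⟪Λ t _, _⟫)
      (g := fun t => ⟪Λ t (D.Gr (w m.succ)), D.Gr (y m)⟫) m fun t ht => by
      rw [stepV_of_mem hk y ht, stepW_of_mem hk w (Ioo_subset_Ioc_self ht)],
    intervalIntegral_step_congr hk (f := fun t => ⟪f t, _⟫)
      (g := fun t => ⟪f t, D.P (y m)⟫) m fun t ht => by rw [stepV_of_mem hk y ht],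
    intervalIntegral_step_congr hk (f := fun t => ⟪F t, _⟫)
      (g := fun t => ⟪F t, D.Gr (y m)⟫) m fun t ht => by rw [stepV_of_mem hk y ht],
    intervalIntegral_inner_const (intervalIntegrable_of_memLp
      (memLp_apply hΛ hB (memLp_const _)) h1 h2),
    intervalIntegral_inner_const (intervalIntegrable_of_memLp hf h1 h2),
    intervalIntegral_inner_const (intervalIntegrable_of_memLp hF h1 h2)]
  have h := hw.2 m (y m)
  simp only [stepMean, inner_smul_left] at h
  simp only [conj_trivial] at h
  field_simp at h ⊢
  linarith

end GradientDiscretisation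

/-- The flux `S G R u' + Λ G u + F` of a solution. -/
def flux (G : GradientOperator L E) (S : E ≃L[ℝ] E) (T : ℝ) (Λ : ℝ → E →L[ℝ] E) (F : ℝ → E)
    (u : ℝ → G.Space) (t : ℝ) : E :=
  S (G.grad (G.riesz S (timeDeriv G T u t))) + Λ t (G.grad (u t)) + F t

variable [CompleteSpace L] [CompleteSpace E]

theorem MemW.memLp_grad_riesz {G : GradientOperator L E} {S : E ≃L[ℝ] E}
    (hS : (S : E →L[ℝ] E).IsPositive) {T : ℝ} {u : ℝ → G.Space} (hu : MemW G T u) :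
    MemLp (fun t => G.grad (G.riesz S (timeDeriv G T u t))) 2 (timeMeasure T) := by
  obtain ⟨A, -, hAr⟩ := G.exists_rieszMap hS
  simp_rw [hAr]
  exact (G.grad.comp A).comp_memLp' hu.memLp_rieszDeriv

/-- The Riesz operator rewrites u'(x) as ⟪S G R u', G x⟫, so the whole equation becomes a statement
on one divergence. The single terms of the flux need not lie in H_D. -/
theorem IsSolution.memL2HD_flux {G : GradientOperator L E} {S : E ≃L[ℝ] E}
    (hS : (S : E →L[ℝ] E).IsPositive) {T : ℝ} {Λ : ℝ → E →L[ℝ] E}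
    (hΛ : ∀ ξ : E, AEStronglyMeasurable (fun t => Λ t ξ) (timeMeasure T)) {B : ℝ}
    (hB : ∀ᵐ t ∂timeMeasure T, ∀ ξ, ‖Λ t ξ‖ ≤ B * ‖ξ‖) {Φ : L →ₗ[ℝ] L}
    {f : ℝ → L} (hf : MemLp f 2 (timeMeasure T)) {F : ℝ → E} (hF : MemLp F 2 (timeMeasure T))
    {ξ₀ : L} {u : ℝ → G.Space} (hu : IsSolution G T Λ Φ f F ξ₀ u) :
    MemL2HD G T (flux G S T Λ F u) ∧
      ∀ᵐ t ∂timeMeasure T, G.div (flux G S T Λ F u t) = -f t := by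
  have hdiv : ∀ᵐ t ∂timeMeasure T, G.IsDiv (flux G S T Λ F u t) (-f t) := by
    filter_upwards [hu.2.1] with t ht x
    have h1 : timeDeriv G T u t x - G.divDual (Λ t (G.grad (u t)) + F t) x =
        G.embedDual (f t) x := by
      rw [← ht]
      rfl
    have h2 : G.divDual (Λ t (G.grad (u t)) + F t) x = -⟪Λ t (G.grad (u t)) + F t, G.grad x⟫ := rfl
    have h3 : G.embedDual (f t) x = ⟪f t, G.incl x⟫ := rfl
    rw [flux, add_assoc, inner_add_left, G.inner_riesz hS, inner_neg_left]
    rw [h2, h3] at h1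
    linarith
  have hdiv' : ∀ᵐ t ∂timeMeasure T, G.div (flux G S T Λ F u t) = -f t :=
    hdiv.mono fun t ht => ht.div_eq
  refine ⟨⟨?_, hdiv.mono fun t ht => ⟨_, ht⟩, ?_⟩, hdiv'⟩
  · exact (((S : E →L[ℝ] E).comp_memLp' (hu.1.memLp_grad_riesz hS)).add
      (memLp_apply hΛ hB (G.grad.comp_memLp' hu.1.1))).add hF
  · exact hf.neg.ae_eq (hdiv'.mono fun t ht => ht.symm)

namespace GradientDiscretisation

/-- The consistency error of the implicit Euler scheme. -/
theorem IsSchemeSolution.abs_eulerForm_sub_le {D : GradientDiscretisation.{v} L E}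
    {G : GradientOperator L E} {S : E ≃L[ℝ] E} (hS : (S : E →L[ℝ] E).IsPositive) {T : ℝ} {N : ℕ}
    (hT : 0 < T) (hN : 0 < N) {Λ : ℝ → E →L[ℝ] E}
    (hΛ : ∀ ξ : E, AEStronglyMeasurable (fun t => Λ t ξ) (timeMeasure T)) {B : ℝ} (hB0 : 0 ≤ B)
    (hB : ∀ᵐ t ∂timeMeasure T, ∀ ξ, ‖Λ t ξ‖ ≤ B * ‖ξ‖) {Φ : L →ₗ[ℝ] L}
    {f : ℝ → L} (hf : MemLp f 2 (timeMeasure T)) {F : ℝ → E} (hF : MemLp F 2 (timeMeasure T))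
    {ξ₀ : L} {u : ℝ → G.Space} (hu : IsSolution G T Λ Φ f F ξ₀ u)
    {w : Fin (N + 1) → D.X} (hw : D.IsSchemeSolution T N Λ Φ f F ξ₀ w)
    (hζ : D.zetaT G S T N (flux G S T Λ F u) ≠ ∞) (v : Fin (N + 1) → D.X) (y : Fin N → D.X) :
    |D.eulerForm Λ T N (w - v) y| ≤
      ((D.zetaT G S T N (flux G S T Λ F u)).toReal * √‖(S : E →L[ℝ] E)‖ +
        ‖(S : E →L[ℝ] E)‖ * (D.derivError G S T N u v).toReal +
        B * (D.gradError G T N u v).toReal) * D.gradNorm T N y := by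
  have hGy : MemLp (fun t => D.Gr (stepV (T / N) y t)) 2 (timeMeasure T) := memLp_map_stepV _ _
  have hr := hu.1.memLp_grad_riesz hS
  have hg : MemLp (fun t => G.grad (u t)) 2 (timeMeasure T) := G.grad.comp_memLp' hu.1.1
  have hRv : MemLp (fun t => D.Gr (D.rieszDisc S (stepV (T / N) (discDeriv (T / N) v) t))) 2
      (timeMeasure T) := memLp_map_stepV (D.Gr.comp (D.rieszDiscₗ hS)) _
  have hGv : MemLp (fun t => D.Gr (stepW (T / N) v t)) 2 (timeMeasure T) := memLp_map_stepW _ _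
  have hd1 : MemLp (fun t => G.grad (G.riesz S (timeDeriv G T u t)) -
      D.Gr (D.rieszDisc S (stepV (T / N) (discDeriv (T / N) v) t))) 2 (timeMeasure T) := hr.sub hRv
  have hd2 : MemLp (fun t => G.grad (u t) - D.Gr (stepW (T / N) v t)) 2 (timeMeasure T) :=
    hg.sub hGv
  have hSr : ∀ {g : ℝ → E}, MemLp g 2 (timeMeasure T) → MemLp (fun t => S (g t)) 2 (timeMeasure T) :=
    fun h => (S : E →L[ℝ] E).comp_memLp' h
  have hΛg : ∀ {g : ℝ → E}, MemLp g 2 (timeMeasure T) →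
      MemLp (fun t => Λ t (g t)) 2 (timeMeasure T) := fun h => memLp_apply hΛ hB h
  have ev : D.eulerForm Λ T N v y =
      (∫ t, ⟪S (D.Gr (D.rieszDisc S (stepV (T / N) (discDeriv (T / N) v) t))),
        D.Gr (stepV (T / N) y t)⟫ ∂timeMeasure T) +
      ∫ t, ⟪Λ t (D.Gr (stepW (T / N) v t)), D.Gr (stepV (T / N) y t)⟫ ∂timeMeasure T := by
    rw [eulerForm]
    simp_rw [D.inner_rieszDisc hS]
  have i1 : ∫ t, ⟪S (G.grad (G.riesz S (timeDeriv G T u t)) -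
      D.Gr (D.rieszDisc S (stepV (T / N) (discDeriv (T / N) v) t))),
        D.Gr (stepV (T / N) y t)⟫ ∂timeMeasure T =
      (∫ t, ⟪S (G.grad (G.riesz S (timeDeriv G T u t))),
        D.Gr (stepV (T / N) y t)⟫ ∂timeMeasure T) -
      ∫ t, ⟪S (D.Gr (D.rieszDisc S (stepV (T / N) (discDeriv (T / N) v) t))),
        D.Gr (stepV (T / N) y t)⟫ ∂timeMeasure T := by
    rw [← integral_sub (integrable_inner_of_memLp (hSr hr) hGy)
      (integrable_inner_of_memLp (hSr hRv) hGy)]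
    simp only [map_sub, inner_sub_left]
  have i2 : ∫ t, ⟪Λ t (G.grad (u t) - D.Gr (stepW (T / N) v t)),
        D.Gr (stepV (T / N) y t)⟫ ∂timeMeasure T =
      (∫ t, ⟪Λ t (G.grad (u t)), D.Gr (stepV (T / N) y t)⟫ ∂timeMeasure T) -
      ∫ t, ⟪Λ t (D.Gr (stepW (T / N) v t)), D.Gr (stepV (T / N) y t)⟫ ∂timeMeasure T := by
    rw [← integral_sub (integrable_inner_of_memLp (hΛg hg) hGy)
      (integrable_inner_of_memLp (hΛg hGv) hGy)]
    simp only [map_sub, inner_sub_left]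
  have i3 : ∫ t, ⟪flux G S T Λ F u t, D.Gr (stepV (T / N) y t)⟫ ∂timeMeasure T =
      (∫ t, ⟪S (G.grad (G.riesz S (timeDeriv G T u t))),
        D.Gr (stepV (T / N) y t)⟫ ∂timeMeasure T) +
      (∫ t, ⟪Λ t (G.grad (u t)), D.Gr (stepV (T / N) y t)⟫ ∂timeMeasure T) +
      ∫ t, ⟪F t, D.Gr (stepV (T / N) y t)⟫ ∂timeMeasure T := by
    rw [← integral_add (integrable_inner_of_memLp (hSr hr) hGy)
      (integrable_inner_of_memLp (hΛg hg) hGy), ← integral_add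
      ((integrable_inner_of_memLp (hSr hr) hGy).fun_add (integrable_inner_of_memLp (hΛg hg) hGy))
      (integrable_inner_of_memLp hF hGy)]
    simp only [flux, inner_add_left]
  have i4 : ∫ t, ⟪G.div (flux G S T Λ F u t), D.P (stepV (T / N) y t)⟫ ∂timeMeasure T =
      -∫ t, ⟪f t, D.P (stepV (T / N) y t)⟫ ∂timeMeasure T := by
    rw [← integral_neg]
    refine integral_congr_ae ?_
    filter_upwards [(hu.memL2HD_flux hS hΛ hB hf hF).2] with t ht
    rw [ht, inner_neg_left]
  have hz := D.abs_le_zetaT_mul G S hζ y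
  have b1 := abs_integral_inner_le (hSr hd1) hGy
  have b2 := abs_integral_inner_le (hΛg hd2) hGy
  have n1 := toReal_eLpNorm_apply_le (Λ := fun _ => (S : E →L[ℝ] E)) (norm_nonneg (S : E →L[ℝ] E))
    (Eventually.of_forall fun _ => (S : E →L[ℝ] E).le_opNorm) hd1
  have n2 := toReal_eLpNorm_apply_le hB0 hB hd2
  have hy0 := D.gradNorm_nonneg T N y
  have c1 := b1.trans (mul_le_mul_of_nonneg_right n1 hy0)
  have c2 := b2.trans (mul_le_mul_of_nonneg_right n2 hy0)
  simp only [gradNorm] at hz ⊢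
  rw [i1] at c1
  rw [i2] at c2
  rw [i3, i4] at hz
  -- The residual is minus the conformity defect of the flux, plus the terms with S(G R u' - Gr R_h
  -- ∂v) and Λ(G u - Gr v); each is linear in Gr y.
  rw [D.eulerForm_sub hΛ hB, hw.eulerForm_eq hT hN hΛ hB hf hF, ev]
  rw [derivError, gradError]
  rw [abs_le] at *
  constructor <;> linarith [c1.1, c1.2, c2.1, c2.2, hz.1, hz.2]

end GradientDiscretisation
end Residual

/-! ### Stability of the scheme. -/

section Energy

theorem le_add_sqrt_of_sq_le {p q x : ℝ} (hp : 0 ≤ p) (h : x ^ 2 ≤ p * x + q) :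
    x ≤ p + √q := by
  by_contra hcon
  push Not at hcon
  have h1 : √q < x - p := by linarith
  have h2 := Real.lt_sq_of_sqrt_lt h1
  nlinarith [Real.sqrt_nonneg q]

/-- The scalar inequality behind the stability of the scheme. -/
theorem energy_le {β κ ε δ x a b : ℝ} (hβ : 0 < β) (hκ : 0 ≤ κ) (hε : 0 ≤ ε)
    (ha : 0 ≤ a) (h1 : 1 / 2 * (b ^ 2 - a ^ 2) + β * x ^ 2 ≤ ε * x)
    (h2 : a ≤ b + 2 * δ) (h3 : b ^ 2 ≤ κ * x ^ 2 + 2 * ε * x) :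
    x ≤ 2 * (1 + β / (κ + 1)) / β * ε + √(2 * (2 * (κ + 1) / β + 2) / β * δ ^ 2) := by
  -- Here x is the gradient norm, a and b the sizes at initial and final time. Young's inequality
  -- with weight η absorbs the mixed term 2δb: the part η κ x² stays below (β/2) x². The 1 in κ + 1
  -- only avoids a zero denominator.
  set η := β / (2 * (κ + 1)) with hη
  have hη0 : 0 < η := by positivity
  have e1 : β / (κ + 1) = 2 * η := by rw [hη]; field_simp
  have e2 : 2 * (κ + 1) / β = 1 / η := by rw [hη]; field_simp
  have e3 : η * κ ≤ β / 2 := by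
    have : η * (κ + 1) = β / 2 := by rw [hη]; field_simp
    nlinarith
  rw [e1, e2]
  have hsq : a ^ 2 ≤ (b + 2 * δ) ^ 2 := pow_le_pow_left₀ ha h2 2
  have young : 2 * (δ * b) ≤ δ ^ 2 * (1 / η) + η * b ^ 2 := by
    have h4 : 0 ≤ (δ - η * b) ^ 2 * (1 / η) := by positivity
    have h5 : (δ - η * b) ^ 2 * (1 / η) = δ ^ 2 * (1 / η) - 2 * (δ * b) + η * b ^ 2 := by
      field_simp
      ring
    linarith
  have hηb : η * b ^ 2 ≤ η * κ * x ^ 2 + 2 * η * ε * x := by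
    have := mul_le_mul_of_nonneg_left h3 hη0.le
    linarith
  have hκx : η * κ * x ^ 2 ≤ β / 2 * x ^ 2 := by gcongr
  have key : β / 2 * x ^ 2 ≤ (1 + 2 * η) * ε * x + (1 / η + 2) * δ ^ 2 := by linarith
  refine le_add_sqrt_of_sq_le (by positivity) ?_
  have h6 : x ^ 2 = 2 / β * (β / 2 * x ^ 2) := by field_simp
  rw [h6]
  calc _ ≤ 2 / β * ((1 + 2 * η) * ε * x + (1 / η + 2) * δ ^ 2) := by gcongr
    _ = _ := by ring

theorem sum_ite_telescope (a : ℕ → ℝ) {p q N : ℕ} (hpq : p ≤ q) (hq : q ≤ N) :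
    ∑ m : Fin N, (if p ≤ (m : ℕ) ∧ (m : ℕ) < q then a (m + 1) - a m else 0) = a q - a p := by
  rw [Fin.sum_univ_eq_sum_range (fun m => if p ≤ m ∧ m < q then a (m + 1) - a m else 0) N,
    ← Finset.sum_filter]
  have e : (Finset.range N).filter (fun m => p ≤ m ∧ m < q) = Finset.Ico p q := by
    ext m
    simp only [Finset.mem_filter, Finset.mem_range, Finset.mem_Ico]
    omega
  rw [e, Finset.sum_Ico_eq_sub _ hpq, Finset.sum_range_sub, Finset.sum_range_sub]
  ring

variable {L E : Type*} [NormedAddCommGroup L] [InnerProductSpace ℝ L]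
  [NormedAddCommGroup E] [InnerProductSpace ℝ E]

namespace GradientDiscretisation

variable (D : GradientDiscretisation.{v} L E) {T : ℝ} {N : ℕ} {Λ : ℝ → E →L[ℝ] E} {B β C ε : ℝ}
  {e : Fin (N + 1) → D.X}

/-- The energy inequality between two time steps. -/
theorem energy_step_le (hT : 0 < T) (hN : 0 < N)
    (hΛ : ∀ ξ : E, AEStronglyMeasurable (fun t => Λ t ξ) (timeMeasure T))
    (hB : ∀ᵐ t ∂timeMeasure T, ∀ ξ, ‖Λ t ξ‖ ≤ B * ‖ξ‖)
    (hβ : ∀ᵐ t ∂timeMeasure T, ∀ ξ, β * ‖ξ‖ ^ 2 ≤ ⟪Λ t ξ, ξ⟫)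
    (hres : ∀ y, |D.eulerForm Λ T N e y| ≤ ε * D.gradNorm T N y) {p q : Fin (N + 1)} (hpq : p ≤ q) :
    1 / 2 * (‖D.P (e q)‖ ^ 2 - ‖D.P (e p)‖ ^ 2) + β * D.gradNorm T N (fun m : Fin N =>
      if (p : ℕ) ≤ (m : ℕ) ∧ (m : ℕ) < q then e m.succ else 0) ^ 2 ≤
      ε * D.gradNorm T N (fun m : Fin N =>
      if (p : ℕ) ≤ (m : ℕ) ∧ (m : ℕ) < q then e m.succ else 0) := by
  have hN' : (0 : ℝ) < N := by exact_mod_cast hN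
  have hk : 0 < T / N := by positivity
  set y : Fin N → D.X := fun m => if (p : ℕ) ≤ (m : ℕ) ∧ (m : ℕ) < q then e m.succ else 0 with hy
  have hGy : MemLp (fun t => D.Gr (stepV (T / N) y t)) 2 (timeMeasure T) := memLp_map_stepV _ _
  have hΛe : MemLp (fun t => Λ t (D.Gr (stepW (T / N) e t))) 2 (timeMeasure T) :=
    memLp_apply hΛ hB (memLp_map_stepW _ _)
  refine le_trans ?_ ((le_abs_self _).trans (hres y))
  rw [eulerForm, integral_inner_stepV hT hN]
  -- The test function is e itself, cut off to the steps after p and up to q. In the first term ⟪a -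
  -- b, a⟫ ≥ (‖a‖² - ‖b‖²)/2 telescopes; the second is coercivity.
  refine add_le_add ?_ ?_
  · set a : ℕ → ℝ := fun m => if h : m < N + 1 then ‖D.P (e ⟨m, h⟩)‖ ^ 2 else 0 with ha
    have haq : ‖D.P (e q)‖ ^ 2 = a q := by simp only [ha]; rw [dif_pos q.2]
    have hap : ‖D.P (e p)‖ ^ 2 = a p := by simp only [ha]; rw [dif_pos p.2]
    rw [haq, hap, ← sum_ite_telescope a hpq (Nat.lt_succ_iff.mp q.2), Finset.mul_sum,
      Finset.mul_sum]
    refine Finset.sum_le_sum fun m _ => ?_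
    have hs : a (m + 1) = ‖D.P (e m.succ)‖ ^ 2 := by
      simp only [ha]
      rw [dif_pos (by omega)]
      rfl
    have hc : a m = ‖D.P (e m.castSucc)‖ ^ 2 := by
      simp only [ha]
      rw [dif_pos (by omega)]
      rfl
    simp only [hy]
    split_ifs with h
    · rw [hs, hc, discDeriv, map_smul, map_sub, real_inner_smul_left, ← mul_assoc,
        mul_inv_cancel₀ hk.ne', one_mul]
      have h1 := norm_sub_sq_real (D.P (e m.succ)) (D.P (e m.castSucc))
      rw [inner_sub_left, real_inner_self_eq_norm_sq, real_inner_comm]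
      nlinarith [sq_nonneg ‖D.P (e m.succ) - D.P (e m.castSucc)‖]
    · simp
  · rw [gradNorm, toReal_eLpNorm_two_sq hGy, ← integral_const_mul]
    refine integral_mono_ae ((hGy.integrable_norm_pow (by norm_num)).const_mul _)
      (integrable_inner_of_memLp hΛe hGy) ?_
    filter_upwards [hβ, ae_exists_mem_Ioo_step hT hN] with t ht ⟨m, hm⟩
    rw [stepV_of_mem hk y hm, stepW_of_mem hk e (Ioo_subset_Ioc_self hm)]
    simp only [hy]
    split_ifs with h
    · exact ht _
    · simp

theorem gradNorm_ite_le (hT : 0 < T) (hN : 0 < N) (s : Fin N → Prop) [DecidablePred s]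
    (y : Fin N → D.X) :
    D.gradNorm T N (fun m => if s m then y m else 0) ≤ D.gradNorm T N y := by
  have hN' : (0 : ℝ) < N := by exact_mod_cast hN
  refine le_of_sq_le_sq ?_ (D.gradNorm_nonneg _ _ _)
  rw [D.gradNorm_sq hT hN, D.gradNorm_sq hT hN]
  gcongr with m
  split_ifs
  · exact le_rfl
  · simp

/-- Stability of the implicit Euler scheme with respect to the consistency error. -/
theorem stability (hT : 0 < T) (hN : 0 < N)
    (hΛ : ∀ ξ : E, AEStronglyMeasurable (fun t => Λ t ξ) (timeMeasure T))
    (hB : ∀ᵐ t ∂timeMeasure T, ∀ ξ, ‖Λ t ξ‖ ≤ B * ‖ξ‖) (hβ0 : 0 < β)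
    (hβ : ∀ᵐ t ∂timeMeasure T, ∀ ξ, β * ‖ξ‖ ^ 2 ≤ ⟪Λ t ξ, ξ⟫)
    (hP : ∀ z, ‖D.P z‖ ≤ C * ‖D.Gr z‖) (hε : 0 ≤ ε)
    (hres : ∀ y, |D.eulerForm Λ T N e y| ≤ ε * D.gradNorm T N y) {δ : ℝ}
    (hinit : ‖D.P (e 0)‖ ≤ ‖D.P (e (Fin.last N))‖ + 2 * δ) :
    D.gradNorm T N (fun m => e m.succ) ≤ 2 * (1 + β / (C ^ 2 / T + 1)) / β * ε +
        √(2 * (2 * (C ^ 2 / T + 1) / β + 2) / β * δ ^ 2) ∧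
      ∀ m, ‖D.P (e m)‖ ^ 2 ≤
        (√(C ^ 2 / T * D.gradNorm T N (fun m => e m.succ) ^ 2 +
          2 * ε * D.gradNorm T N (fun m => e m.succ)) + 2 * δ) ^ 2 +
          2 * ε * D.gradNorm T N (fun m => e m.succ) := by
  have hN' : (0 : ℝ) < N := by exact_mod_cast hN
  have hk : 0 < T / N := by positivity
  set x := D.gradNorm T N (fun m => e m.succ) with hx
  have hx0 : 0 ≤ x := D.gradNorm_nonneg _ _ _
  have hgrow : ∀ p q : Fin (N + 1), p ≤ q →
      ‖D.P (e q)‖ ^ 2 ≤ ‖D.P (e p)‖ ^ 2 + 2 * ε * x := by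
    intro p q hpq
    have h1 := D.energy_step_le hT hN hΛ hB hβ hres hpq
    have h2 := D.gradNorm_ite_le hT hN (fun m => (p : ℕ) ≤ (m : ℕ) ∧ (m : ℕ) < q)
      (fun m => e m.succ)
    have h3 := mul_le_mul_of_nonneg_left h2 hε
    have h4 : 0 ≤ β * D.gradNorm T N (fun m : Fin N =>
      if (p : ℕ) ≤ (m : ℕ) ∧ (m : ℕ) < q then e m.succ else 0) ^ 2 := by positivity
    linarith
  have hfull : 1 / 2 * (‖D.P (e (Fin.last N))‖ ^ 2 - ‖D.P (e 0)‖ ^ 2) + β * x ^ 2 ≤ ε * x := by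
    have h1 := D.energy_step_le hT hN hΛ hB hβ hres (Fin.zero_le (Fin.last N))
    simpa using h1
  -- By the Poincaré inequality the time average of ‖P e‖² is at most C² x²/T, so at least one step
  -- is no larger. This replaces the missing initial bound.
  have hsmall : ∃ m : Fin N, T * ‖D.P (e m.succ)‖ ^ 2 ≤ C ^ 2 * x ^ 2 := by
    have hne : (Finset.univ : Finset (Fin N)).Nonempty := ⟨⟨0, hN⟩, Finset.mem_univ _⟩
    obtain ⟨m, -, hm⟩ := Finset.exists_le_of_sum_le (s := Finset.univ)
      (f := fun m : Fin N => T * ‖D.P (e m.succ)‖ ^ 2) (g := fun _ => C ^ 2 * x ^ 2) hne (by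
        rw [Finset.sum_const, Finset.card_univ, Fintype.card_fin, nsmul_eq_mul, hx,
          D.gradNorm_sq hT hN, Finset.mul_sum, Finset.mul_sum, Finset.mul_sum]
        refine Finset.sum_le_sum fun m _ => ?_
        have h1 : (N : ℝ) * (C ^ 2 * (T / N * ‖D.Gr (e m.succ)‖ ^ 2)) =
            T * (C * ‖D.Gr (e m.succ)‖) ^ 2 := by field_simp
        rw [h1]
        gcongr
        exact hP _)
    exact ⟨m, hm⟩
  have hlast : ‖D.P (e (Fin.last N))‖ ^ 2 ≤ C ^ 2 / T * x ^ 2 + 2 * ε * x := by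
    obtain ⟨m, hm⟩ := hsmall
    refine (hgrow m.succ (Fin.last N) (Fin.le_last _)).trans ?_
    gcongr
    rw [div_mul_eq_mul_div, le_div_iff₀ hT]
    linarith
  refine ⟨energy_le hβ0 (by positivity) hε (norm_nonneg _) hfull hinit hlast, fun m => ?_⟩
  refine (hgrow 0 m (Fin.zero_le m)).trans ?_
  gcongr
  refine hinit.trans ?_
  gcongr
  exact Real.le_sqrt_of_sq_le hlast

theorem gradNorm_rieszDisc_discDeriv_le {S : E ≃L[ℝ] E} (hS : (S : E →L[ℝ] E).IsPositive) {c : ℝ}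
    (hc : 0 < c) (hcoer : ∀ ξ : E, c * ‖ξ‖ ^ 2 ≤ ⟪S ξ, ξ⟫) (hT : 0 < T) (hN : 0 < N)
    (hΛ : ∀ ξ : E, AEStronglyMeasurable (fun t => Λ t ξ) (timeMeasure T)) (hB0 : 0 ≤ B)
    (hB : ∀ᵐ t ∂timeMeasure T, ∀ ξ, ‖Λ t ξ‖ ≤ B * ‖ξ‖) (hε : 0 ≤ ε)
    (hres : ∀ y, |D.eulerForm Λ T N e y| ≤ ε * D.gradNorm T N y) :
    D.gradNorm T N (fun m => D.rieszDisc S (discDeriv (T / N) e m)) ≤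
      (ε + B * D.gradNorm T N (fun m => e m.succ)) / c := by
  have hN' : (0 : ℝ) < N := by exact_mod_cast hN
  -- With this test function the derivative term equals ∫⟪S Gr y, Gr y⟫, which dominates the
  -- quantity sought.
  set y : Fin N → D.X := fun m => D.rieszDisc S (discDeriv (T / N) e m) with hy
  have hx0 := D.gradNorm_nonneg T N (fun m => e m.succ)
  refine le_div_of_mul_sq_le hc (by positivity) (D.gradNorm_nonneg _ _ _) ?_
  have hGy : MemLp (fun t => D.Gr (stepV (T / N) y t)) 2 (timeMeasure T) := memLp_map_stepV _ _
  have hGe : MemLp (fun t => D.Gr (stepW (T / N) e t)) 2 (timeMeasure T) := memLp_map_stepW _ _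
  have hnorm : (eLpNorm (fun t => D.Gr (stepW (T / N) e t)) 2 (timeMeasure T)).toReal =
      D.gradNorm T N (fun m => e m.succ) := by
    rw [gradNorm]
    congr 1
    refine eLpNorm_congr_ae ?_
    filter_upwards [stepV_succ_ae_eq_stepW hT hN e] with t ht
    rw [ht]
  have h1 : c * D.gradNorm T N y ^ 2 ≤ ∫ t, ⟪D.P (stepV (T / N) (discDeriv (T / N) e) t),
      D.P (stepV (T / N) y t)⟫ ∂timeMeasure T := by
    rw [D.gradNorm_sq hT hN, integral_inner_stepV hT hN, mul_left_comm, Finset.mul_sum]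
    gcongr with m
    rw [← D.inner_rieszDisc hS]
    exact hcoer _
  have h2 := abs_integral_inner_le (memLp_apply hΛ hB hGe) hGy
  have h3 := toReal_eLpNorm_apply_le hB0 hB hGe
  rw [hnorm] at h3
  have h4 : _ ≤ B * D.gradNorm T N (fun m => e m.succ) * D.gradNorm T N y :=
    h2.trans (mul_le_mul_of_nonneg_right h3 (D.gradNorm_nonneg T N y))
  have h5 := (le_abs_self _).trans (hres y)
  rw [eulerForm] at h5
  have h6 := (abs_le.mp h4).1
  linarith

end GradientDiscretisation
end Energy

/-! ### Convergence of the implicit Euler scheme. -/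

section Convergence

variable {L E : Type*} [NormedAddCommGroup L] [InnerProductSpace ℝ L]
  [NormedAddCommGroup E] [InnerProductSpace ℝ E]

namespace GradientDiscretisation

theorem enorm_contRep_sub_le_supError (D : GradientDiscretisation.{v} L E) (G : GradientOperator L E)
    {T : ℝ} {N : ℕ} (u : ℝ → G.Space) (w : Fin (N + 1) → D.X) {t : ℝ} (ht : t ∈ Icc 0 T) :
    ‖contRep G T u t - D.P (stepW (T / N) w t)‖ₑ ≤ D.supError G T N u w :=
  le_iSup₂ (f := fun t (_ : t ∈ Icc 0 T) => ‖contRep G T u t - D.P (stepW (T / N) w t)‖ₑ) t ht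

theorem norm_contRep_sub_le_supError (D : GradientDiscretisation.{v} L E) (G : GradientOperator L E)
    {T : ℝ} {N : ℕ} (u : ℝ → G.Space) (w : Fin (N + 1) → D.X)
    (h : D.supError G T N u w ≠ ∞) {t : ℝ} (ht : t ∈ Icc 0 T) :
    ‖contRep G T u t - D.P (stepW (T / N) w t)‖ ≤ (D.supError G T N u w).toReal := by
  have h1 := ENNReal.toReal_mono h (D.enorm_contRep_sub_le_supError G u w ht)
  rwa [toReal_enorm] at h1

/-- The discrete coupling condition minus the exact one, tested with e(0) where e = w - v. As Φ is a
contraction, the errors of v at times 0 and T each enter once, hence the factor 2. -/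
theorem IsSchemeSolution.norm_zero_sub_le {D : GradientDiscretisation.{v} L E}
    {G : GradientOperator L E} {T : ℝ} {N : ℕ} (hT : 0 < T) (hN : 0 < N) {Λ : ℝ → E →L[ℝ] E}
    {Φ : L →ₗ[ℝ] L} (hΦ : ∀ y, ‖Φ y‖ ≤ ‖y‖) {f : ℝ → L} {F : ℝ → E} {ξ₀ : L} {u : ℝ → G.Space}
    (hu : IsSolution G T Λ Φ f F ξ₀ u) {w : Fin (N + 1) → D.X}
    (hw : D.IsSchemeSolution T N Λ Φ f F ξ₀ w) {v : Fin (N + 1) → D.X}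
    (hv : D.supError G T N u v ≠ ∞) :
    ‖D.P ((w - v) 0)‖ ≤ ‖D.P ((w - v) (Fin.last N))‖ + 2 * (D.supError G T N u v).toReal := by
  have hN' : (0 : ℝ) < N := by exact_mod_cast hN
  have h0 := D.norm_contRep_sub_le_supError G u v hv (left_mem_Icc.mpr hT.le)
  have h1 := D.norm_contRep_sub_le_supError G u v hv (right_mem_Icc.mpr hT.le)
  rw [stepW_zero (by positivity)] at h0
  rw [stepW_last hT hN] at h1
  set e := w - v with he
  have hinner : ⟪D.P (e 0), D.P (e 0)⟫ = ⟪Φ (D.P (e (Fin.last N))) +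
      (contRep G T u 0 - D.P (v 0)) - Φ (contRep G T u T - D.P (v (Fin.last N))), D.P (e 0)⟫ := by
    have h2 := hw.1 (e 0)
    rw [← hu.2.2, ← sub_eq_zero, ← inner_sub_left] at h2
    rw [← sub_eq_zero, ← inner_sub_left]
    refine Eq.trans (congrArg (fun y => ⟪y, D.P (e 0)⟫) ?_) h2
    simp only [he, Pi.sub_apply, map_sub]
    abel
  have h3 := real_inner_le_norm (Φ (D.P (e (Fin.last N))) +
      (contRep G T u 0 - D.P (v 0)) - Φ (contRep G T u T - D.P (v (Fin.last N)))) (D.P (e 0))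
  rw [← hinner, real_inner_self_eq_norm_sq, sq] at h3
  have h4 : ‖D.P (e 0)‖ ≤ ‖Φ (D.P (e (Fin.last N))) +
      (contRep G T u 0 - D.P (v 0)) - Φ (contRep G T u T - D.P (v (Fin.last N)))‖ := by
    rcases (norm_nonneg (D.P (e 0))).eq_or_lt with h | h
    · rw [← h]
      exact norm_nonneg _
    · exact le_of_mul_le_mul_right h3 h
  have h5 := norm_sub_le (Φ (D.P (e (Fin.last N))) + (contRep G T u 0 - D.P (v 0)))
    (Φ (contRep G T u T - D.P (v (Fin.last N))))
  have h6 := norm_add_le (Φ (D.P (e (Fin.last N)))) (contRep G T u 0 - D.P (v 0))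
  have h7 := hΦ (D.P (e (Fin.last N)))
  have h8 := hΦ (contRep G T u T - D.P (v (Fin.last N)))
  linarith

variable [CompleteSpace L] [CompleteSpace E]

theorem approxError_le_add (D : GradientDiscretisation.{v} L E) {G : GradientOperator L E}
    {S : E ≃L[ℝ] E} (hS : (S : E →L[ℝ] E).IsPositive) {T : ℝ} {N : ℕ} (hT : 0 < T) (hN : 0 < N)
    {u : ℝ → G.Space} (hu : MemW G T u) (w v : Fin (N + 1) → D.X) {r : ℝ}
    (hr : ∀ m, ‖D.P ((w - v) m)‖ ≤ r) :
    D.approxError G S T N u w ≤ D.approxError G S T N u v +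
      (ENNReal.ofReal (D.gradNorm T N fun m =>
          D.rieszDisc S (discDeriv (T / N) (w - v) m)) +
        ENNReal.ofReal (D.gradNorm T N fun m => (w - v) m.succ) + ENNReal.ofReal r) := by
  have hgrad : MemLp (fun t => G.grad (u t)) 2 (timeMeasure T) := G.grad.comp_memLp' hu.1
  have b1 : D.derivError G S T N u w ≤ D.derivError G S T N u v +
      ENNReal.ofReal (D.gradNorm T N fun m => D.rieszDisc S (discDeriv (T / N) (w - v) m)) := by
    have hR : ∀ x : Fin (N + 1) → D.X,
        MemLp (fun t => D.Gr (D.rieszDisc S (stepV (T / N) (discDeriv (T / N) x) t))) 2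
          (timeMeasure T) := fun x => memLp_map_stepV (D.Gr.comp (D.rieszDiscₗ hS)) _
    have e : ∀ t, D.Gr (stepV (T / N) (fun m => D.rieszDisc S (discDeriv (T / N) (w - v) m)) t) =
        D.Gr (D.rieszDisc S (stepV (T / N) (discDeriv (T / N) w) t)) -
          D.Gr (D.rieszDisc S (stepV (T / N) (discDeriv (T / N) v) t)) := by
      intro t
      have h := map_stepV (D.rieszDiscₗ hS) (k := T / N) (discDeriv (T / N) (w - v)) t
      rw [stepV_discDeriv_sub, map_sub] at h
      rw [← map_sub]
      exact congrArg D.Gr h.symm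
    rw [gradNorm, ENNReal.ofReal_toReal (memLp_map_stepV D.Gr _).2.ne]
    simp only [e]
    rw [derivError, derivError]
    refine le_trans (le_of_eq ?_) (eLpNorm_sub_le ((hu.memLp_grad_riesz hS).sub (hR v)).1
      ((hR w).sub (hR v)).1 (by norm_num))
    congr 1
    funext t
    simp
  have b2 : D.gradError G T N u w ≤ D.gradError G T N u v +
      ENNReal.ofReal (D.gradNorm T N fun m => (w - v) m.succ) := by
    have hGr : ∀ x : Fin (N + 1) → D.X,
        MemLp (fun t => D.Gr (stepW (T / N) x t)) 2 (timeMeasure T) := fun x => memLp_map_stepW _ _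
    rw [gradNorm, ENNReal.ofReal_toReal (memLp_map_stepV D.Gr _).2.ne]
    have e : eLpNorm (fun t => D.Gr (stepV (T / N) (fun m => (w - v) m.succ) t)) 2
        (timeMeasure T) = eLpNorm (fun t => D.Gr (stepW (T / N) w t) - D.Gr (stepW (T / N) v t)) 2
        (timeMeasure T) := by
      refine eLpNorm_congr_ae ?_
      filter_upwards [stepV_succ_ae_eq_stepW hT hN (w - v)] with t ht
      rw [ht, stepW_sub, map_sub]
    rw [e, gradError, gradError]
    refine le_trans (le_of_eq ?_) (eLpNorm_sub_le (hgrad.sub (hGr v)).1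
      ((hGr w).sub (hGr v)).1 (by norm_num))
    congr 1
    funext t
    simp
  have b3 : D.supError G T N u w ≤ D.supError G T N u v + ENNReal.ofReal r := by
    refine iSup₂_le fun t ht => ?_
    have h1 : ‖D.P (stepW (T / N) (w - v) t)‖ₑ ≤ ENNReal.ofReal r := by
      obtain ⟨m, hm⟩ := exists_stepW_eq hT hN (w - v) ht
      rw [hm, ← ofReal_norm]
      exact ENNReal.ofReal_le_ofReal (hr m)
    have h2 : contRep G T u t - D.P (stepW (T / N) w t) =
        (contRep G T u t - D.P (stepW (T / N) v t)) - D.P (stepW (T / N) (w - v) t) := by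
      rw [stepW_sub, map_sub]
      abel
    rw [h2]
    exact enorm_sub_le.trans (add_le_add (D.enorm_contRep_sub_le_supError G u v ht) h1)
  rw [approxError, approxError]
  refine (add_le_add (add_le_add b1 b2) b3).trans (le_of_eq ?_)
  ring

/-- Convergence of the implicit Euler scheme. -/
theorem tendsto_approxError_of_isSchemeSolution (G : GradientOperator L E) {S : E ≃L[ℝ] E}
    (hS : (S : E →L[ℝ] E).IsPositive) {D : ℕ → GradientDiscretisation.{v} L E}
    (hcons : ∀ φ : G.Space, Tendsto (fun n => (D n).sigma G φ) atTop (𝓝 0))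
    (hconf : ∀ φ ∈ G.HD, Tendsto (fun n => (D n).zeta G S φ) atTop (𝓝 0)) {T : ℝ} (hT : 0 < T)
    {N : ℕ → ℕ} (hN : ∀ n, 0 < N n) (hNtop : Tendsto N atTop atTop) {Λ : ℝ → E →L[ℝ] E}
    (hΛ : ∀ ξ : E, AEStronglyMeasurable (fun t => Λ t ξ) (timeMeasure T)) {B : ℝ} (hB0 : 0 ≤ B)
    (hB : ∀ᵐ t ∂timeMeasure T, ∀ ξ, ‖Λ t ξ‖ ≤ B * ‖ξ‖) {β : ℝ} (hβ0 : 0 < β)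
    (hβ : ∀ᵐ t ∂timeMeasure T, ∀ ξ, β * ‖ξ‖ ^ 2 ≤ ⟪Λ t ξ, ξ⟫) {Φ : L →ₗ[ℝ] L}
    (hΦ : ∀ y, ‖Φ y‖ ≤ ‖y‖) {f : ℝ → L} (hf : MemLp f 2 (timeMeasure T)) {F : ℝ → E}
    (hF : MemLp F 2 (timeMeasure T)) {ξ₀ : L} {u : ℝ → G.Space}
    (hu : IsSolution G T Λ Φ f F ξ₀ u) {w : (n : ℕ) → Fin (N n + 1) → (D n).X}
    (hw : ∀ n, (D n).IsSchemeSolution T (N n) Λ Φ f F ξ₀ (w n)) :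
    Tendsto (fun n => (D n).approxError G S T (N n) u (w n)) atTop (𝓝 0) := by
  obtain ⟨c, hc, hcoer⟩ := coercive_of_isPositive hS
  obtain ⟨C, -, hP⟩ := exists_poincare G hS hconf
  obtain ⟨v, hv⟩ := exists_tendsto_approxError G hS hcons hconf hT hN hNtop hu.1
  have hζ := tendsto_zetaT G hS hconf N (hu.memL2HD_flux hS hΛ hB hf hF).1
  have toReal_zero : ∀ {a : ℕ → ℝ≥0∞}, Tendsto a atTop (𝓝 0) →
      Tendsto (fun n => (a n).toReal) atTop (𝓝 0) :=
    fun h => (ENNReal.tendsto_toReal ENNReal.zero_ne_top).comp h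
  have hderiv := toReal_zero (tendsto_of_tendsto_of_tendsto_of_le_of_le tendsto_const_nhds hv
    (fun _ => zero_le) fun n => (le_self_add.trans le_self_add :
      (D n).derivError G S T (N n) u (v n) ≤ (D n).approxError G S T (N n) u (v n)))
  have hgrad := toReal_zero (tendsto_of_tendsto_of_tendsto_of_le_of_le tendsto_const_nhds hv
    (fun _ => zero_le) fun n => (le_add_self.trans le_self_add :
      (D n).gradError G T (N n) u (v n) ≤ (D n).approxError G S T (N n) u (v n)))
  have hsup := tendsto_of_tendsto_of_tendsto_of_le_of_le tendsto_const_nhds hv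
    (fun _ => zero_le) fun n => (le_add_self :
      (D n).supError G T (N n) u (v n) ≤ (D n).approxError G S T (N n) u (v n))
  set ε : ℕ → ℝ := fun n => ((D n).zetaT G S T (N n) (flux G S T Λ F u)).toReal *
      √‖(S : E →L[ℝ] E)‖ + ‖(S : E →L[ℝ] E)‖ * ((D n).derivError G S T (N n) u (v n)).toReal +
        B * ((D n).gradError G T (N n) u (v n)).toReal with hε
  set δ : ℕ → ℝ := fun n => ((D n).supError G T (N n) u (v n)).toReal with hδ
  have hε0 : Tendsto ε atTop (𝓝 0) := by
    simpa using (((toReal_zero hζ).mul_const _).add (hderiv.const_mul _)).add (hgrad.const_mul B)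
  have hεnn : ∀ n, 0 ≤ ε n := fun n => by positivity
  have hδ0 : Tendsto δ atTop (𝓝 0) := toReal_zero hsup
  set x : ℕ → ℝ := fun n => (D n).gradNorm T (N n) fun m => (w n - v n) m.succ with hx
  -- Finiteness is needed because `toReal` sends ∞ to 0, which would falsify the real-valued bounds;
  -- it holds eventually because the limits are 0.
  have hgood : ∀ᶠ n in atTop, (D n).zetaT G S T (N n) (flux G S T Λ F u) ≠ ∞ ∧
      (D n).supError G T (N n) u (v n) ≠ ∞ :=
    (hζ.eventually_ne ENNReal.zero_ne_top).and (hsup.eventually_ne ENNReal.zero_ne_top)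
  have hres : ∀ᶠ n in atTop, ∀ y, |(D n).eulerForm Λ T (N n) (w n - v n) y| ≤
      ε n * (D n).gradNorm T (N n) y := hgood.mono fun n hn y =>
    (hw n).abs_eulerForm_sub_le hS hT (hN n) hΛ hB0 hB hf hF hu hn.1 (v n) y
  have hstab : ∀ᶠ n in atTop, x n ≤ 2 * (1 + β / (C ^ 2 / T + 1)) / β * ε n +
      √(2 * (2 * (C ^ 2 / T + 1) / β + 2) / β * δ n ^ 2) ∧
      ∀ m, ‖(D n).P ((w n - v n) m)‖ ^ 2 ≤
        (√(C ^ 2 / T * x n ^ 2 + 2 * ε n * x n) + 2 * δ n) ^ 2 + 2 * ε n * x n := by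
    filter_upwards [hgood, hres] with n hn hr
    exact (D n).stability hT (hN n) hΛ hB hβ0 hβ (hP n) (hεnn n) hr
      ((hw n).norm_zero_sub_le hT (hN n) hΦ hu hn.2)
  have hx0 : Tendsto x atTop (𝓝 0) := by
    refine tendsto_of_tendsto_of_tendsto_of_le_of_le' tendsto_const_nhds ?_
      (Eventually.of_forall fun n => (D n).gradNorm_nonneg _ _ _) (hstab.mono fun n hn => hn.1)
    simpa using (hε0.const_mul (2 * (1 + β / (C ^ 2 / T + 1)) / β)).add
      ((hδ0.pow 2).const_mul (2 * (2 * (C ^ 2 / T + 1) / β + 2) / β)).sqrt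
  set r : ℕ → ℝ := fun n =>
    √((√(C ^ 2 / T * x n ^ 2 + 2 * ε n * x n) + 2 * δ n) ^ 2 + 2 * ε n * x n) with hr
  have hr0 : Tendsto r atTop (𝓝 0) := by
    have h1 : Tendsto (fun n => 2 * ε n * x n) atTop (𝓝 0) := by
      simpa using (hε0.const_mul 2).mul hx0
    have h2 : Tendsto (fun n => √(C ^ 2 / T * x n ^ 2 + 2 * ε n * x n) + 2 * δ n) atTop (𝓝 0) := by
      simpa using (((hx0.pow 2).const_mul (C ^ 2 / T)).add h1).sqrt.add (hδ0.const_mul 2)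
    simpa using ((h2.pow 2).add h1).sqrt
  have hd0 : Tendsto (fun n => (ε n + B * x n) / c) atTop (𝓝 0) := by
    simpa using (hε0.add (hx0.const_mul B)).div_const c
  have ofReal_zero : ∀ {a : ℕ → ℝ}, Tendsto a atTop (𝓝 0) →
      Tendsto (fun n => ENNReal.ofReal (a n)) atTop (𝓝 0) := fun h => by
    simpa using ENNReal.tendsto_ofReal h
  have htop := hv.add (((ofReal_zero hd0).add (ofReal_zero hx0)).add (ofReal_zero hr0))
  simp only [add_zero] at htop
  refine tendsto_of_tendsto_of_tendsto_of_le_of_le' tendsto_const_nhds htop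
    (Eventually.of_forall fun _ => zero_le) ?_
  filter_upwards [hres, hstab] with n hn hs
  refine ((D n).approxError_le_add hS hT (hN n) hu.1 (w n) (v n)
    (fun m => Real.le_sqrt_of_sq_le (hs.2 m))).trans ?_
  gcongr
  exact (D n).gradNorm_rieszDisc_discDeriv_le hS hc hcoer hT (hN n) hΛ hB0 hB (hεnn n) hn

end GradientDiscretisation
end Convergence

end ParabolicGDM

end

theorem theorem5p1 {L E : Type*}
    [NormedAddCommGroup L] [InnerProductSpace ℝ L] [CompleteSpace L]
    [TopologicalSpace.SeparableSpace L]
    [NormedAddCommGroup E] [InnerProductSpace ℝ E] [CompleteSpace E]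
    [TopologicalSpace.SeparableSpace E]
    (G : ParabolicGDM.GradientOperator L E) (T : ℝ) (hT : 0 < T)
    (S : E ≃L[ℝ] E) (hS : (S : E →L[ℝ] E).IsPositive)
    (Λ : ℝ → E →L[ℝ] E)
    (hΛ : ∀ ξ : E, AEStronglyMeasurable (fun t => Λ t ξ) (ParabolicGDM.timeMeasure T))
    (M : ℝ) (hM : ∀ᵐ t ∂ParabolicGDM.timeMeasure T, ‖(S.symm : E →L[ℝ] E).comp (Λ t)‖ ≤ M)
    (D : ℕ → ParabolicGDM.GradientDiscretisation L E)
    (hcons : ∀ φ : G.Space, Tendsto (fun n => (D n).sigma G φ) atTop (𝓝 0))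
    (hconf : ∀ φ ∈ G.HD, Tendsto (fun n => (D n).zeta G S φ) atTop (𝓝 0))
    (N : ℕ → ℕ) (hN : ∀ n, 0 < N n) (hNtop : Tendsto N atTop atTop) :
    (∀ φ : ℝ → E, ParabolicGDM.MemL2HD G T φ →
      Tendsto (fun n => (D n).zetaT G S T (N n) φ) atTop (𝓝 0)) ∧
    (∀ w : ℝ → G.Space, ParabolicGDM.MemW G T w →
      Tendsto (fun n => ⨅ y : Fin (N n + 1) → (D n).X, (D n).deltaT G S Λ T (N n) w y)
        atTop (𝓝 0)) ∧
    (∀ α : ℝ, 0 < α →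
      (∀ᵐ t ∂ParabolicGDM.timeMeasure T, ∀ ξ : E, α * ⟪S ξ, ξ⟫ ≤ ⟪Λ t ξ, ξ⟫) →
      ∀ Φ : L →ₗ[ℝ] L, (∀ y : L, ‖Φ y‖ ≤ ‖y‖) →
      ∀ f : ℝ → L, MemLp f 2 (ParabolicGDM.timeMeasure T) →
      ∀ F : ℝ → E, MemLp F 2 (ParabolicGDM.timeMeasure T) →
      ∀ ξ₀ : L, ∀ u : ℝ → G.Space, ParabolicGDM.IsSolution G T Λ Φ f F ξ₀ u →
      ∀ w : (n : ℕ) → Fin (N n + 1) → (D n).X,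
        (∀ n, (D n).IsSchemeSolution T (N n) Λ Φ f F ξ₀ (w n)) →
        Tendsto (fun n => (D n).deltaT G S Λ T (N n) u (w n)) atTop (𝓝 0)) := by
  obtain ⟨K, hK, hdelta⟩ := ParabolicGDM.GradientDiscretisation.exists_deltaT_le G S hM
  have hlim : ∀ {a : ℕ → ℝ≥0∞}, Tendsto a atTop (𝓝 0) →
      Tendsto (fun n => K * a n) atTop (𝓝 0) := fun h => by
    simpa using ENNReal.Tendsto.const_mul h (Or.inr hK)
  refine ⟨fun φ hφ => ParabolicGDM.GradientDiscretisation.tendsto_zetaT G hS hconf N hφ,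
    fun w hw => ?_, fun α hα hcoer Φ hΦ f hf F hF ξ₀ u hu w hw => ?_⟩
  · obtain ⟨y, hy⟩ := ParabolicGDM.GradientDiscretisation.exists_tendsto_approxError G hS hcons
      hconf hT hN hNtop hw
    exact tendsto_of_tendsto_of_tendsto_of_le_of_le tendsto_const_nhds (hlim hy)
      (fun _ => zero_le) fun n => (iInf_le _ (y n)).trans (hdelta (D n) (N n) w (y n))
  · obtain ⟨c, hc, hScoer⟩ := ParabolicGDM.coercive_of_isPositive hS
    have hB : ∀ᵐ t ∂ParabolicGDM.timeMeasure T, ∀ ξ,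
        -- The maximum with 0 gives a constant that is nonnegative without any appeal to the
        -- essential bound.
        ‖Λ t ξ‖ ≤ ‖(S : E →L[ℝ] E)‖ * max M 0 * ‖ξ‖ := by
      filter_upwards [hM] with t ht ξ
      calc ‖Λ t ξ‖ = ‖(S : E →L[ℝ] E) ((S.symm : E →L[ℝ] E).comp (Λ t) ξ)‖ := by simp
        _ ≤ ‖(S : E →L[ℝ] E)‖ * (‖(S.symm : E →L[ℝ] E).comp (Λ t)‖ * ‖ξ‖) := by
            refine ((S : E →L[ℝ] E).le_opNorm _).trans ?_
            gcongr
            exact ContinuousLinearMap.le_opNorm _ _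
        _ ≤ ‖(S : E →L[ℝ] E)‖ * (max M 0 * ‖ξ‖) := by
            gcongr
            exact ht.trans (le_max_left _ _)
        _ = _ := by ring
    -- Coercivity relative to S becomes coercivity in the norm of E through the lower bound c of S.
    have hβ : ∀ᵐ t ∂ParabolicGDM.timeMeasure T, ∀ ξ, α * c * ‖ξ‖ ^ 2 ≤ ⟪Λ t ξ, ξ⟫ := by
      filter_upwards [hcoer] with t ht ξ
      refine le_trans ?_ (ht ξ)
      rw [mul_assoc]
      gcongr
      exact hScoer ξ
    have h := ParabolicGDM.GradientDiscretisation.tendsto_approxError_of_isSchemeSolution G hS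
      hcons hconf hT hN hNtop hΛ (by positivity) hB (mul_pos hα hc) hβ hΦ hf hF hu hw
    exact tendsto_of_tendsto_of_tendsto_of_le_of_le tendsto_const_nhds (hlim h)
      (fun _ => zero_le) fun n => hdelta (D n) (N n) u (w n)
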